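/- Let $B>0$ and let $V_0:\mathbb R\to\mathbb R$ be a $C^\infty$ edge potential, unbounded, with $V_0(y)=0$ for $y<0$, $V_0'(y)\ge 0$ for all $y$, and $\inf\{V_0'(y): y\ge b\}>0$ for every $b>0$. Let $E\in\mathbb R$ with $E\neq(2n+1)B$ for all $n\in\mathbb N_0$. Then there is a constant $\delta>0$ (depending only on $B$, $V_0$ and $E$) such that for every measurable disorder potential $V_d:\mathbb R^2\to\mathbb R$ with $|V_d|\le\delta$ the following holds. Put $V(x,y)=V_0(y)+V_d(x,y)$, and on $L^2(\mathbb R^2)$ let $$H=(p_x+By)^2+p_y^2+V,\qquad \Pi=p_y+Bx,\qquad p_x=-i\partial_x,\quad p_y=-i\partial_y,$$ be the operators obtained as the closures of these expressions on $C_c^\infty(\mathbb R^2)$ ($H$ is the half-plane Landau Hamiltonian $(p-A)^2+V$ in the gauge $A=(-By,0)$, and $\Pi$ is $B$ times the coordinate along the edge of the guiding centre). Then $\mathcal D(H)\cap\mathcal D(\Pi)$ is a core for $H$; the quadratic form $$\psi\mapsto i\bigl(\langle H\psi,\Pi\psi\rangle-\langle\Pi\psi,H\psi\rangle\bigr),\qquad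 \psi\in\mathcal D(H)\cap\mathcal D(\Pi),$$ of the commutator $[H,i\Pi]$ extends to a form on $\mathcal D(H)$, unique and continuous in the graph norm of $H$; on $C_c^\infty(\mathbb R^2)$ it is given by $-\partial_yV$ in the sense of distributions, that is, by $\varphi\mapsto\int V\,\partial_y|\varphi|^2\,dx\,dy$; and there are an open interval $\Delta\ni E$ and a constant $\alpha>0$ such that $$-E_\Delta(H)\,[H,i\Pi]\,E_\Delta(H)\ \ge\ \alpha\,E_\Delta(H)$$ in the sense of quadratic forms on $L^2(\mathbb R^2)$, where $E_\Delta(H)$ is the spectral projection of $H$ on $\Delta$ (whose range lies in $\mathcal D(H)$). -/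

import Mathlib

open MeasureTheory Filter Topology
open scoped ENNReal ContDiff InnerProductSpace

noncomputable section

namespace HalfPlaneLandau

/-! ### Spectral projections of unbounded operators -/

section Spectral

variable {H : Type*} [NormedAddCommGroup H] [InnerProductSpace ℂ H] [CompleteSpace H]

variable (H) in
/-- Projection-valued measures on the Borel sets of the real line. Only the values on Borel sets
carry a meaning. -/
structure PVM where
  toFun : Set ℝ → (H →L[ℂ] H)
  isStarProjection : ∀ S, MeasurableSet S → IsStarProjection (toFun S)
  univ : toFun Set.univ = 1
  inter : ∀ S T, MeasurableSet S → MeasurableSet T → toFun (S ∩ T) = toFun S * toFun T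
  hasSum_iUnion : ∀ S : ℕ → Set ℝ, (∀ n, MeasurableSet (S n)) →
    Pairwise (fun m n => Disjoint (S m) (S n)) →
      ∀ ψ : H, HasSum (fun n => toFun (S n) ψ) (toFun (⋃ n, S n) ψ)

namespace PVM

theorem empty (P : PVM H) : P.toFun ∅ = 0 := by
  ext ψ
  have h := P.hasSum_iUnion (fun _ => ∅) (fun _ => MeasurableSet.empty)
    (fun _ _ _ => disjoint_bot_left) ψ
  have h2 := h.summable.tendsto_atTop_zero
  simpa using tendsto_nhds_unique tendsto_const_nhds h2

theorem inner_self (P : PVM H) {S : Set ℝ} (hS : MeasurableSet S) (ψ : H) :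
    (⟪ψ, P.toFun S ψ⟫_ℂ).re = ‖P.toFun S ψ‖ ^ 2 := by
  have hp := P.isStarProjection S hS
  have h1 : P.toFun S (P.toFun S ψ) = P.toFun S ψ := by
    have h := congrArg (fun T : H →L[ℂ] H => T ψ) hp.isIdempotentElem
    simpa using h
  have h2 : ⟪P.toFun S ψ, P.toFun S ψ⟫_ℂ = ⟪ψ, P.toFun S ψ⟫_ℂ := by
    have h := (ContinuousLinearMap.isSelfAdjoint_iff_isSymmetric.1 hp.isSelfAdjoint) ψ
      (P.toFun S ψ)
    simp only [ContinuousLinearMap.coe_coe] at h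
    rw [h, h1]
  rw [← h2]
  exact (norm_sq_eq_re_inner (𝕜 := ℂ) (P.toFun S ψ)).symm

/-- The scalar spectral measure `S ↦ ⟪ψ, P(S) ψ⟫` of the vector `ψ`. -/
def scalarMeasure (P : PVM H) (ψ : H) : Measure ℝ :=
  Measure.ofMeasurable (fun S _ => ENNReal.ofReal (⟪ψ, P.toFun S ψ⟫_ℂ).re)
    (by simp [P.empty])
    (by
      intro S hS hd
      have h := P.hasSum_iUnion S hS hd ψ
      have h2 : HasSum (fun n => (⟪ψ, P.toFun (S n) ψ⟫_ℂ).re)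
          (⟪ψ, P.toFun (⋃ n, S n) ψ⟫_ℂ).re :=
        Complex.reCLM.hasSum ((innerSL ℂ ψ).hasSum h)
      rw [← h2.tsum_eq]
      refine ENNReal.ofReal_tsum_of_nonneg (fun n => ?_) h2.summable
      rw [P.inner_self (hS n)]
      positivity)

/-- `P` is the spectral measure of the operator `T`, that is `T = ∫ t dP(t)`: the domain of `T`
consists of the vectors whose scalar spectral measure has a finite second moment, and
`⟪ψ, T ψ⟫ = ∫ t d⟪ψ, P(t) ψ⟫` on this domain. -/
structure IsSpectralMeasureOf (P : PVM H) (T : H →ₗ.[ℂ] H) : Prop where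
  mem_domain_iff : ∀ ψ : H,
    ψ ∈ T.domain ↔ ∫⁻ t, ENNReal.ofReal (t ^ 2) ∂(P.scalarMeasure ψ) < ⊤
  inner_apply : ∀ ψ : T.domain,
    ⟪(ψ : H), T ψ⟫_ℂ = ((∫ t, t ∂(P.scalarMeasure (ψ : H)) : ℝ) : ℂ)

end PVM

open Classical in
/-- The spectral projection `E_S(T)` of the operator `T`: the value at `S` of the spectral measure
of `T`. By the spectral theorem every self-adjoint `T` has exactly one spectral measure; for other
operators there is none, and the value is the default `0`. -/
def spectralProjection (T : H →ₗ.[ℂ] H) (S : Set ℝ) : H →L[ℂ] H :=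
  if h : ∃ P : PVM H, P.IsSpectralMeasureOf T then h.choose.toFun S else 0

/-- `Q` is the quadratic form of the commutator `[T, iA]` on the domain of `T`: on `D(T) ∩ D(A)`
it is `ψ ↦ i (⟪T ψ, A ψ⟫ - ⟪A ψ, T ψ⟫)`, and it is extended from there to `D(T)` by continuity in
the graph norm of `T`. As `D(T) ∩ D(A)` is required to be a core for `T`, at most one `Q` has this
property. -/
structure IsCommutatorForm (T A : H →ₗ.[ℂ] H) (Q : T.domain → ℝ) : Prop where
  hasCore : T.HasCore (T.domain ⊓ A.domain)
  apply_eq : ∀ (ψ : H) (hT : ψ ∈ T.domain) (hA : ψ ∈ A.domain),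
    ((Q ⟨ψ, hT⟩ : ℝ) : ℂ)
      = Complex.I * (⟪T ⟨ψ, hT⟩, A ⟨ψ, hA⟩⟫_ℂ - ⟪A ⟨ψ, hA⟩, T ⟨ψ, hT⟩⟫_ℂ)
  continuous : ∀ (u : ℕ → T.domain) (ψ : T.domain),
    Tendsto (fun n => (u n : H)) atTop (𝓝 (ψ : H)) → Tendsto (fun n => T (u n)) atTop (𝓝 (T ψ)) →
      Tendsto (fun n => Q (u n)) atTop (𝓝 (Q ψ))

end Spectral

/-! ### The Hamiltonian -/

/-- The Hilbert space `L²(ℝ²)`; points of the plane are pairs `(x, y)`. -/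
abbrev L2Plane : Type := Lp ℂ 2 (volume : Measure (ℝ × ℝ))

/-- Complex-valued test functions on the plane, `φ ∈ C_c^∞(ℝ²)`. -/
def IsTest (φ : ℝ × ℝ → ℂ) : Prop := ContDiff ℝ ∞ φ ∧ HasCompactSupport φ

/-- `p_x = -i ∂_x`. -/
def px (φ : ℝ × ℝ → ℂ) (q : ℝ × ℝ) : ℂ := -Complex.I * fderiv ℝ φ q (1, 0)

/-- `p_y = -i ∂_y`. -/
def py (φ : ℝ × ℝ → ℂ) (q : ℝ × ℝ) : ℂ := -Complex.I * fderiv ℝ φ q (0, 1)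

/-- `p_x - A_x` in the Landau gauge `A = (-B y, 0)`. -/
def kinX (B : ℝ) (φ : ℝ × ℝ → ℂ) (q : ℝ × ℝ) : ℂ := px φ q + (B * q.2 : ℝ) * φ q

/-- The differential expression `(p - A)² + V`. -/
def schrodingerExpr (B : ℝ) (V : ℝ × ℝ → ℝ) (φ : ℝ × ℝ → ℂ) (q : ℝ × ℝ) : ℂ :=
  kinX B (kinX B φ) q + py (py φ) q + (V q : ℂ) * φ q

/-- The differential expression `Π = p_y + B x`. -/
def guidingExpr (B : ℝ) (φ : ℝ × ℝ → ℂ) (q : ℝ × ℝ) : ℂ := py φ q + (B * q.1 : ℝ) * φ q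

/-- The operator `φ ↦ L φ` in `L²(ℝ²)` with domain `C_c^∞(ℝ²)`, given by its graph. -/
def testOperator (L : (ℝ × ℝ → ℂ) → ℝ × ℝ → ℂ) : L2Plane →ₗ.[ℂ] L2Plane :=
  (Submodule.span ℂ {w : L2Plane × L2Plane |
    ∃ φ, IsTest φ ∧ w.1 =ᵐ[volume] φ ∧ w.2 =ᵐ[volume] L φ}).toLinearPMap

/-- The Hamiltonian `(p - A)² + V`, with `C_c^∞(ℝ²)` as a core. -/
def hamiltonian (B : ℝ) (V : ℝ × ℝ → ℝ) : L2Plane →ₗ.[ℂ] L2Plane :=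
  (testOperator (schrodingerExpr B V)).closure

/-- The guiding centre operator `Π = p_y + B x`, with `C_c^∞(ℝ²)` as a core. -/
def guidingCenter (B : ℝ) : L2Plane →ₗ.[ℂ] L2Plane :=
  (testOperator (guidingExpr B)).closure

/-- The total potential `V(x, y) = V₀(y) + V_d(x, y)`. -/
def totalPotential (V₀ : ℝ → ℝ) (Vd : ℝ × ℝ → ℝ) (q : ℝ × ℝ) : ℝ := V₀ q.2 + Vd q

/-- Smooth edge potentials: `V₀` vanishes for `y < 0`, is nondecreasing, and its derivative is
bounded away from `0` on `[b, ∞)` for every `b > 0` (so that `V₀` is unbounded). -/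
structure IsEdgePotential (V₀ : ℝ → ℝ) : Prop where
  smooth : ContDiff ℝ ∞ V₀
  eq_zero : ∀ y < 0, V₀ y = 0
  deriv_nonneg : ∀ y, 0 ≤ deriv V₀ y
  deriv_pos : ∀ b > 0, ∃ c > 0, ∀ y ≥ b, c ≤ deriv V₀ y

end HalfPlaneLandau

end

open HalfPlaneLandau

open MeasureTheory Filter Topology
open scoped ENNReal ContDiff InnerProductSpace

noncomputable section

namespace HalfPlaneLandau

/-! ### Test functions as vectors of `L²(ℝ²)` -/

/-! `Π` commutes with both kinetic momenta `p_x + B y` and `p_y`, so only the potential contributes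
to the commutator: formally `-[H, iΠ] = ∂_y V = V₀' + ∂_y V_d`. The first term is at least some `c >
0` on `y ≥ b`. The second is never differentiated: it enters as `2 Im ⟪V_d φ, p_y φ⟫`, and the
energy controls `p_y φ`, so smallness of `|V_d|` is enough.

What has to be shown is that a state of energy near `E` puts a definite share of its mass on `y ≥
b`. Suppose `η = (H - E) φ` is small. For small `b` the potential is at most `d / 2` on `y < 2b`,
where `d > 0` is the distance of `E` from the Landau levels. Multiplication by a cutoff `f(y)`,
equal to `1` below `b` and `0` above `2b`, gives an approximate solution for the free operator,
which satisfies `d ‖f φ‖ ≤ ‖((p - A)² - E) f φ‖`. The errors are `η`, a potential term absorbed by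
half of the gap, and commutator terms living on `y ≥ b`, which a local energy estimate controls.
This is `exists_norm_sq_le_upper`; with the positivity of `V₀'` it yields `exists_mourre_test`, an
estimate on test functions with error `‖η‖² + ‖η‖ ‖φ‖`. On the spectral subspace of a short interval
about `E` this error is absorbed (`exists_mourre_proj`).

Three further ingredients make this rigorous. The gap estimate `le_norm_kinOp_sub` comes from ladder
operators on polynomials times a Gaussian, which are complete in `L²`. Essential self-adjointness
(`denseRange_shiftedOp`) comes from bounded perturbations of the free operator followed by
localization; it supplies a bounded self-adjoint resolvent, and the continuous functional calculus
of the resolvent supplies the spectral measure of `H` (`exists_isSpectralMeasureOf`). Finally,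
eliminating the unbounded `B x` algebraically turns the commutator form into `commForm`, which
involves only operators bounded relative to `H`; that it agrees with the commutator on all of `D(H)
∩ D(Π)` is `commForm_eq`, proved with cutoffs in `x`. -/

/-- The directional derivative `-i ∂_v`. -/
def pd (v : ℝ × ℝ) (φ : ℝ × ℝ → ℂ) (q : ℝ × ℝ) : ℂ := -Complex.I * fderiv ℝ φ q v

theorem py_eq_pd (φ : ℝ × ℝ → ℂ) : py φ = pd (0, 1) φ := rfl

theorem contDiff_pd {φ : ℝ × ℝ → ℂ} (hφ : ContDiff ℝ ∞ φ) (v : ℝ × ℝ) :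
    ContDiff ℝ ∞ (pd v φ) :=
  contDiff_const.mul ((hφ.fderiv_right (by simp)).clm_apply contDiff_const)

theorem pd_add {φ ψ : ℝ × ℝ → ℂ} (hφ : ContDiff ℝ ∞ φ) (hψ : ContDiff ℝ ∞ ψ) (v : ℝ × ℝ) :
    pd v (φ + ψ) = pd v φ + pd v ψ := by
  funext q
  simp only [pd, Pi.add_apply]
  rw [fderiv_add ((hφ.differentiable (by simp)) q) ((hψ.differentiable (by simp)) q)]
  simp [mul_add]

theorem pd_const_smul {φ : ℝ × ℝ → ℂ} (hφ : ContDiff ℝ ∞ φ) (c : ℂ) (v : ℝ × ℝ) :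
    pd v (c • φ) = c • pd v φ := by
  funext q
  simp only [pd, Pi.smul_apply]
  rw [fderiv_const_smul ((hφ.differentiable (by simp)) q)]
  simp only [smul_apply, smul_eq_mul]
  ring

theorem pd_mul {φ ψ : ℝ × ℝ → ℂ} (hφ : ContDiff ℝ ∞ φ) (hψ : ContDiff ℝ ∞ ψ) (v : ℝ × ℝ) :
    pd v (φ * ψ) = φ * pd v ψ + pd v φ * ψ := by
  funext q
  simp only [pd, Pi.add_apply, Pi.mul_apply]
  rw [fderiv_mul ((hφ.differentiable (by simp)) q) ((hψ.differentiable (by simp)) q)]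
  simp only [add_apply, smul_apply, smul_eq_mul]
  ring

/-- `B y` as a complex-valued function on the plane. -/
def magY (B : ℝ) (q : ℝ × ℝ) : ℂ := (B * q.2 : ℝ)

/-- `B x` as a complex-valued function on the plane. -/
def magX (B : ℝ) (q : ℝ × ℝ) : ℂ := (B * q.1 : ℝ)

theorem contDiff_magY (B : ℝ) : ContDiff ℝ ∞ (magY B) :=
  Complex.ofRealCLM.contDiff.comp (contDiff_const.mul contDiff_snd)

theorem contDiff_magX (B : ℝ) : ContDiff ℝ ∞ (magX B) :=
  Complex.ofRealCLM.contDiff.comp (contDiff_const.mul contDiff_fst)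

theorem pd_magY (B : ℝ) (v q : ℝ × ℝ) : pd v (magY B) q = -Complex.I * (B * v.2 : ℝ) := by
  have h : HasFDerivAt (magY B)
      (Complex.ofRealCLM.comp (B • ContinuousLinearMap.snd ℝ ℝ ℝ)) q :=
    (Complex.ofRealCLM.comp (B • ContinuousLinearMap.snd ℝ ℝ ℝ)).hasFDerivAt
  rw [pd, h.fderiv]
  simp

theorem pd_magX (B : ℝ) (v q : ℝ × ℝ) : pd v (magX B) q = -Complex.I * (B * v.1 : ℝ) := by
  have h : HasFDerivAt (magX B)
      (Complex.ofRealCLM.comp (B • ContinuousLinearMap.fst ℝ ℝ ℝ)) q :=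
    (Complex.ofRealCLM.comp (B • ContinuousLinearMap.fst ℝ ℝ ℝ)).hasFDerivAt
  rw [pd, h.fderiv]
  simp

theorem kinX_eq (B : ℝ) (φ : ℝ × ℝ → ℂ) : kinX B φ = pd (1, 0) φ + magY B * φ := rfl

/-- The space `C_c^∞(ℝ²)`. -/
def testSubmodule : Submodule ℂ (ℝ × ℝ → ℂ) where
  carrier := {φ | IsTest φ}
  add_mem' h₁ h₂ := ⟨h₁.1.add h₂.1, h₁.2.add h₂.2⟩
  zero_mem' := ⟨contDiff_const, HasCompactSupport.zero⟩
  smul_mem' c _ h := ⟨contDiff_const.smul h.1, h.2.smul_left (f := fun _ => c)⟩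

/-- The type of test functions. -/
abbrev TestFn : Type := ↥testSubmodule

namespace TestFn

theorem contDiff (φ : TestFn) : ContDiff ℝ ∞ (φ : ℝ × ℝ → ℂ) := φ.2.1

theorem hasCompactSupport (φ : TestFn) : HasCompactSupport (φ : ℝ × ℝ → ℂ) := φ.2.2

theorem continuous (φ : TestFn) : Continuous (φ : ℝ × ℝ → ℂ) := φ.contDiff.continuous

theorem memLp (φ : TestFn) (p : ℝ≥0∞) : MemLp (φ : ℝ × ℝ → ℂ) p volume :=
  φ.continuous.memLp_of_hasCompactSupport φ.hasCompactSupport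

end TestFn

/-- The operator `-i ∂_v` on test functions. -/
def pdOp (v : ℝ × ℝ) : TestFn →ₗ[ℂ] TestFn where
  toFun φ := ⟨pd v φ, contDiff_pd φ.contDiff v,
    (φ.hasCompactSupport.fderiv_apply ℝ v).mul_left⟩
  map_add' φ ψ := Subtype.ext (pd_add φ.contDiff ψ.contDiff v)
  map_smul' c φ := Subtype.ext (pd_const_smul φ.contDiff c v)

/-- Multiplication of test functions by a smooth function. -/
def mulOp (m : ℝ × ℝ → ℂ) (hm : ContDiff ℝ ∞ m) : TestFn →ₗ[ℂ] TestFn where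
  toFun φ := ⟨m * φ, hm.mul φ.contDiff, φ.hasCompactSupport.mul_left⟩
  map_add' φ ψ := Subtype.ext (mul_add m (φ : ℝ × ℝ → ℂ) ψ)
  map_smul' c φ := Subtype.ext (mul_smul_comm c m (φ : ℝ × ℝ → ℂ))

/-- `p_x + B y` on test functions. -/
def kinXOp (B : ℝ) : TestFn →ₗ[ℂ] TestFn := pdOp (1, 0) + mulOp (magY B) (contDiff_magY B)

/-- `p_y` on test functions. -/
def kinYOp : TestFn →ₗ[ℂ] TestFn := pdOp (0, 1)

/-- `p_y + B x` on test functions. -/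
def guidingOp (B : ℝ) : TestFn →ₗ[ℂ] TestFn := kinYOp + mulOp (magX B) (contDiff_magX B)

@[simp] theorem coe_pdOp (v : ℝ × ℝ) (φ : TestFn) : (pdOp v φ : ℝ × ℝ → ℂ) = pd v φ := rfl

@[simp] theorem coe_mulOp (m : ℝ × ℝ → ℂ) (hm : ContDiff ℝ ∞ m) (φ : TestFn) :
    (mulOp m hm φ : ℝ × ℝ → ℂ) = m * φ := rfl

theorem coe_kinYOp (φ : TestFn) : (kinYOp φ : ℝ × ℝ → ℂ) = py φ := rfl

theorem pdOp_mulOp (v : ℝ × ℝ) (m : ℝ × ℝ → ℂ) (hm : ContDiff ℝ ∞ m) (φ : TestFn) :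
    pdOp v (mulOp m hm φ) = mulOp m hm (pdOp v φ) + mulOp (pd v m) (contDiff_pd hm v) φ :=
  Subtype.ext (pd_mul hm φ.contDiff v)

theorem mulOp_mulOp (m n : ℝ × ℝ → ℂ) (hm : ContDiff ℝ ∞ m) (hn : ContDiff ℝ ∞ n) (φ : TestFn) :
    mulOp m hm (mulOp n hn φ) = mulOp (m * n) (hm.mul hn) φ :=
  Subtype.ext (mul_assoc _ _ _).symm

theorem mulOp_comm (m n : ℝ × ℝ → ℂ) (hm : ContDiff ℝ ∞ m) (hn : ContDiff ℝ ∞ n) (φ : TestFn) :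
    mulOp m hm (mulOp n hn φ) = mulOp n hn (mulOp m hm φ) :=
  Subtype.ext (mul_left_comm _ _ _)

theorem pdOp_comm (v w : ℝ × ℝ) (φ : TestFn) : pdOp v (pdOp w φ) = pdOp w (pdOp v φ) := by
  refine Subtype.ext (funext fun q => ?_)
  have key : ∀ v w : ℝ × ℝ, pd v (pd w φ) q = -fderiv ℝ (fderiv ℝ (φ : ℝ × ℝ → ℂ)) q v w := by
    intro v w
    have h1 : DifferentiableAt ℝ (fderiv ℝ (φ : ℝ × ℝ → ℂ)) q :=
      ((φ.contDiff.fderiv_right (m := ∞) (by simp)).differentiable (by simp)) q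
    have h2 := ((h1.hasFDerivAt.clm_apply (hasFDerivAt_const w q)).const_mul (-Complex.I)).fderiv
    change -Complex.I * fderiv ℝ (fun r => -Complex.I * fderiv ℝ (φ : ℝ × ℝ → ℂ) r w) q v = _
    rw [h2]
    simp [← mul_assoc]
  have hs : IsSymmSndFDerivAt ℝ (φ : ℝ × ℝ → ℂ) q :=
    φ.contDiff.contDiffAt.isSymmSndFDerivAt (by simpa using ENat.LEInfty.out)
  simp only [coe_pdOp]
  rw [key, key, hs.eq]

theorem kinXOp_mulOp (B : ℝ) (m : ℝ × ℝ → ℂ) (hm : ContDiff ℝ ∞ m) (φ : TestFn) :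
    kinXOp B (mulOp m hm φ)
      = mulOp m hm (kinXOp B φ) + mulOp (pd (1, 0) m) (contDiff_pd hm _) φ := by
  simp only [kinXOp, LinearMap.add_apply, pdOp_mulOp, map_add]
  rw [mulOp_comm]
  abel

theorem kinYOp_mulOp (m : ℝ × ℝ → ℂ) (hm : ContDiff ℝ ∞ m) (φ : TestFn) :
    kinYOp (mulOp m hm φ) = mulOp m hm (kinYOp φ) + mulOp (pd (0, 1) m) (contDiff_pd hm _) φ :=
  pdOp_mulOp _ m hm φ

/-- The commutator of the two kinetic momenta is the magnetic field. It produces the Landau levels,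
and also the correction term with factor `B` in `commForm`. -/
theorem kinXOp_kinYOp (B : ℝ) (φ : TestFn) :
    kinXOp B (kinYOp φ) = kinYOp (kinXOp B φ) + (Complex.I * B) • φ := by
  have h : mulOp (pd (0, 1) (magY B)) (contDiff_pd (contDiff_magY B) _) φ
      = -((Complex.I * B) • φ) := by
    refine Subtype.ext (funext fun q => ?_)
    simp [pd_magY]
  simp only [kinXOp, LinearMap.add_apply, kinYOp_mulOp, map_add, h]
  rw [kinYOp, pdOp_comm]
  abel

/-- The `iB` from the two kinetic momenta cancels against the derivative of `B x`. Together with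
`kinYOp_guidingOp` this removes the kinetic energy from `[H, iΠ]`. -/
theorem kinXOp_guidingOp (B : ℝ) (φ : TestFn) :
    kinXOp B (guidingOp B φ) = guidingOp B (kinXOp B φ) := by
  have h : mulOp (pd (1, 0) (magX B)) (contDiff_pd (contDiff_magX B) _) φ
      = -((Complex.I * B) • φ) := by
    refine Subtype.ext (funext fun q => ?_)
    simp [pd_magX]
  simp only [guidingOp, LinearMap.add_apply, map_add, kinXOp_kinYOp, kinXOp_mulOp, h]
  abel

theorem kinYOp_guidingOp (B : ℝ) (φ : TestFn) :
    kinYOp (guidingOp B φ) = guidingOp B (kinYOp φ) := by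
  have h : mulOp (pd (0, 1) (magX B)) (contDiff_pd (contDiff_magX B) _) φ = 0 := by
    refine Subtype.ext (funext fun q => ?_)
    simp [pd_magX]
  simp only [guidingOp, LinearMap.add_apply, map_add, kinYOp_mulOp, h]
  abel

/-- The embedding of test functions into `L²(ℝ²)`. -/
def toL2 : TestFn →ₗ[ℂ] L2Plane where
  toFun φ := (φ.memLp 2).toLp φ
  map_add' _ _ := rfl
  map_smul' _ _ := rfl

theorem coeFn_toL2 (φ : TestFn) : toL2 φ =ᵐ[volume] φ := (φ.memLp 2).coeFn_toLp

theorem inner_toLp {f g : ℝ × ℝ → ℂ} (hf : MemLp f 2 volume) (hg : MemLp g 2 volume) :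
    ⟪hf.toLp f, hg.toLp g⟫_ℂ = ∫ q, starRingEnd ℂ (f q) * g q := by
  rw [L2.inner_def]
  refine integral_congr_ae ?_
  filter_upwards [hf.coeFn_toLp, hg.coeFn_toLp] with q h1 h2
  rw [h1, h2, RCLike.inner_apply, mul_comm]

theorem inner_pdOp (v : ℝ × ℝ) (φ ψ : TestFn) :
    ⟪toL2 (pdOp v φ), toL2 ψ⟫_ℂ = ⟪toL2 φ, toL2 (pdOp v ψ)⟫_ℂ := by
  have hd : ∀ φ : TestFn, Continuous fun q => fderiv ℝ (φ : ℝ × ℝ → ℂ) q v := fun φ =>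
    (φ.contDiff.continuous_fderiv (by simp)).clm_apply continuous_const
  have hcd : ∀ q, fderiv ℝ (fun r => starRingEnd ℂ ((φ : ℝ × ℝ → ℂ) r)) q v
      = starRingEnd ℂ (fderiv ℝ (φ : ℝ × ℝ → ℂ) q v) := by
    intro q
    have h := (Complex.conjCLE.toContinuousLinearMap.hasFDerivAt).comp q
      ((φ.contDiff.differentiable (by simp)) q).hasFDerivAt
    have h' : HasFDerivAt (fun r => starRingEnd ℂ ((φ : ℝ × ℝ → ℂ) r)) _ q := h
    rw [h'.fderiv]
    rfl
  have hcs : HasCompactSupport fun q => starRingEnd ℂ ((φ : ℝ × ℝ → ℂ) q) :=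
    φ.hasCompactSupport.comp_left (g := starRingEnd ℂ) (map_zero _)
  have hcc : Continuous fun q => starRingEnd ℂ ((φ : ℝ × ℝ → ℂ) q) :=
    Complex.continuous_conj.comp φ.continuous
  have ibp := integral_mul_fderiv_eq_neg_fderiv_mul_of_integrable (μ := (volume : Measure (ℝ × ℝ)))
    (f := fun q => starRingEnd ℂ ((φ : ℝ × ℝ → ℂ) q)) (g := (ψ : ℝ × ℝ → ℂ)) (v := v)
    (by
      simp only [hcd]
      exact ((Complex.continuous_conj.comp (hd φ)).mul ψ.continuous).integrable_of_hasCompactSupport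
        ψ.hasCompactSupport.mul_left)
    ((hcc.mul (hd ψ)).integrable_of_hasCompactSupport hcs.mul_right)
    ((hcc.mul ψ.continuous).integrable_of_hasCompactSupport hcs.mul_right)
    (fun q _ => Complex.conjCLE.toContinuousLinearMap.differentiableAt.comp q
      ((φ.contDiff.differentiable (by simp)) q))
    (fun q _ => (ψ.contDiff.differentiable (by simp)) q)
  simp only [hcd] at ibp
  change ⟪((pdOp v φ).memLp 2).toLp _, (ψ.memLp 2).toLp _⟫_ℂ
    = ⟪(φ.memLp 2).toLp _, ((pdOp v ψ).memLp 2).toLp _⟫_ℂ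
  rw [inner_toLp, inner_toLp]
  have e1 : ∀ q, starRingEnd ℂ ((pdOp v φ : ℝ × ℝ → ℂ) q) * (ψ : ℝ × ℝ → ℂ) q
      = Complex.I * (starRingEnd ℂ (fderiv ℝ (φ : ℝ × ℝ → ℂ) q v) * (ψ : ℝ × ℝ → ℂ) q) := by
    intro q
    simp [pd, mul_assoc]
  have e2 : ∀ q, starRingEnd ℂ ((φ : ℝ × ℝ → ℂ) q) * (pdOp v ψ : ℝ × ℝ → ℂ) q
      = -Complex.I * (starRingEnd ℂ ((φ : ℝ × ℝ → ℂ) q) * fderiv ℝ (ψ : ℝ × ℝ → ℂ) q v) := by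
    intro q
    simp [pd]
    ring
  simp only [e1, e2]
  rw [integral_const_mul, integral_const_mul, ibp]
  ring

theorem inner_mulOp (m : ℝ × ℝ → ℂ) (hm : ContDiff ℝ ∞ m) (hr : ∀ q, (m q).im = 0)
    (φ ψ : TestFn) :
    ⟪toL2 (mulOp m hm φ), toL2 ψ⟫_ℂ = ⟪toL2 φ, toL2 (mulOp m hm ψ)⟫_ℂ := by
  change ⟪((mulOp m hm φ).memLp 2).toLp _, (ψ.memLp 2).toLp _⟫_ℂ
    = ⟪(φ.memLp 2).toLp _, ((mulOp m hm ψ).memLp 2).toLp _⟫_ℂ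
  rw [inner_toLp, inner_toLp]
  congr 1
  funext q
  have : starRingEnd ℂ (m q) = m q := Complex.conj_eq_iff_im.2 (hr q)
  simp only [coe_mulOp, Pi.mul_apply, map_mul, this]
  ring

theorem inner_kinXOp (B : ℝ) (φ ψ : TestFn) :
    ⟪toL2 (kinXOp B φ), toL2 ψ⟫_ℂ = ⟪toL2 φ, toL2 (kinXOp B ψ)⟫_ℂ := by
  simp only [kinXOp, LinearMap.add_apply, map_add, inner_add_left, inner_add_right, inner_pdOp]
  rw [inner_mulOp]
  intro q
  simp only [magY, Complex.ofReal_im]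

theorem inner_kinYOp (φ ψ : TestFn) :
    ⟪toL2 (kinYOp φ), toL2 ψ⟫_ℂ = ⟪toL2 φ, toL2 (kinYOp ψ)⟫_ℂ := inner_pdOp _ φ ψ

theorem inner_guidingOp (B : ℝ) (φ ψ : TestFn) :
    ⟪toL2 (guidingOp B φ), toL2 ψ⟫_ℂ = ⟪toL2 φ, toL2 (guidingOp B ψ)⟫_ℂ := by
  simp only [guidingOp, LinearMap.add_apply, map_add, inner_add_left, inner_add_right,
    inner_kinYOp]
  rw [inner_mulOp]
  intro q
  simp only [magX, Complex.ofReal_im]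

/-- Test functions are dense in `L²(ℝ²)`. -/
theorem eq_zero_of_inner_toL2 (u : L2Plane) (hu : ∀ φ : TestFn, ⟪toL2 φ, u⟫_ℂ = 0) : u = 0 := by
  have hloc : LocallyIntegrable (u : ℝ × ℝ → ℂ) volume :=
    (Lp.memLp u).locallyIntegrable (by norm_num)
  rw [Lp.eq_zero_iff_ae_eq_zero]
  refine ae_eq_zero_of_integral_contDiff_smul_eq_zero hloc fun g hg hgs => ?_
  have hT : IsTest fun q => (g q : ℂ) :=
    ⟨Complex.ofRealCLM.contDiff.comp hg, hgs.comp_left (g := Complex.ofReal) rfl⟩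
  have h := hu ⟨_, hT⟩
  rw [L2.inner_def] at h
  rw [← h]
  refine integral_congr_ae ?_
  filter_upwards [coeFn_toL2 ⟨_, hT⟩] with q hq
  rw [hq, RCLike.inner_apply]
  simp [mul_comm]

theorem denseRange_toL2 : DenseRange toL2 := by
  have h : (LinearMap.range toL2).topologicalClosure = ⊤ := by
    rw [Submodule.topologicalClosure_eq_top_iff, Submodule.eq_bot_iff]
    intro u hu
    refine eq_zero_of_inner_toL2 u fun φ => ?_
    exact (Submodule.mem_orthogonal _ _).1 hu _ ⟨φ, rfl⟩
  have := Submodule.dense_iff_topologicalClosure_eq_top.2 h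
  rwa [LinearMap.coe_range] at this

theorem toL2_injective : Function.Injective toL2 := by
  intro φ ψ h
  have h1 : (φ : ℝ × ℝ → ℂ) =ᵐ[volume] ψ := by
    filter_upwards [coeFn_toL2 φ, coeFn_toL2 ψ] with q h1 h2
    rw [← h1, ← h2, h]
  exact Subtype.ext ((φ.continuous.ae_eq_iff_eq volume ψ.continuous).1 h1)

/-! ### Multiplication operators on `L²(ℝ²)` -/

/-- Bounded measurable functions on the plane. -/
structure IsBddMeas (m : ℝ × ℝ → ℂ) : Prop where
  measurable : Measurable m
  bound : ∃ C, ∀ q, ‖m q‖ ≤ C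

theorem IsBddMeas.memLp_mul {m : ℝ × ℝ → ℂ} (hm : IsBddMeas m) {f : ℝ × ℝ → ℂ}
    (hf : MemLp f 2 volume) : MemLp (m * f) 2 volume := by
  obtain ⟨C, hC⟩ := hm.bound
  refine hf.of_le_mul (c := C) (hm.measurable.aestronglyMeasurable.mul hf.1) (ae_of_all _ ?_)
  intro q
  rw [Pi.mul_apply, norm_mul]
  exact mul_le_mul_of_nonneg_right (hC q) (norm_nonneg _)

/-- Multiplication by a bounded measurable function on `L²(ℝ²)`. -/
def mulL2 (m : ℝ × ℝ → ℂ) (hm : IsBddMeas m) : L2Plane →L[ℂ] L2Plane :=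
  LinearMap.mkContinuousOfExistsBound
    { toFun := fun u => (hm.memLp_mul (Lp.memLp u)).toLp
      map_add' := by
        intro u v
        rw [← MemLp.toLp_add, MemLp.toLp_eq_toLp_iff]
        filter_upwards [Lp.coeFn_add u v] with q hq
        simp only [Pi.mul_apply, Pi.add_apply, hq, mul_add]
      map_smul' := by
        intro c u
        rw [RingHom.id_apply, ← MemLp.toLp_const_smul, MemLp.toLp_eq_toLp_iff]
        filter_upwards [Lp.coeFn_smul c u] with q hq
        simp only [Pi.mul_apply, hq, Pi.smul_apply, smul_eq_mul]
        ring }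
    (by
      obtain ⟨C, hC⟩ := hm.bound
      refine ⟨C, fun u => Lp.norm_le_mul_norm_of_ae_le_mul ?_⟩
      filter_upwards [(hm.memLp_mul (Lp.memLp u)).coeFn_toLp] with q hq
      refine (congrArg norm hq).le.trans ?_
      rw [Pi.mul_apply, norm_mul]
      exact mul_le_mul_of_nonneg_right (hC q) (norm_nonneg _))

theorem coeFn_mulL2 {m : ℝ × ℝ → ℂ} (hm : IsBddMeas m) (u : L2Plane) :
    mulL2 m hm u =ᵐ[volume] m * u :=
  (hm.memLp_mul (Lp.memLp u)).coeFn_toLp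

theorem norm_mulL2_le_mul {m n : ℝ × ℝ → ℂ} (hm : IsBddMeas m) (hn : IsBddMeas n) {C : ℝ}
    (h : ∀ q, ‖m q‖ ≤ C * ‖n q‖) (u : L2Plane) : ‖mulL2 m hm u‖ ≤ C * ‖mulL2 n hn u‖ := by
  refine Lp.norm_le_mul_norm_of_ae_le_mul ?_
  filter_upwards [coeFn_mulL2 hm u, coeFn_mulL2 hn u] with q h1 h2
  rw [h1, h2, Pi.mul_apply, Pi.mul_apply, norm_mul, norm_mul, ← mul_assoc]
  exact mul_le_mul_of_nonneg_right (h q) (norm_nonneg _)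

theorem norm_mulL2_le {m : ℝ × ℝ → ℂ} (hm : IsBddMeas m) {C : ℝ} (h : ∀ q, ‖m q‖ ≤ C)
    (u : L2Plane) : ‖mulL2 m hm u‖ ≤ C * ‖u‖ := by
  refine Lp.norm_le_mul_norm_of_ae_le_mul ?_
  filter_upwards [coeFn_mulL2 hm u] with q h1
  rw [h1, Pi.mul_apply, norm_mul]
  exact mul_le_mul_of_nonneg_right (h q) (norm_nonneg _)

theorem mulL2_toL2 {m : ℝ × ℝ → ℂ} (hm : IsBddMeas m) (hs : ContDiff ℝ ∞ m) (φ : TestFn) :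
    mulL2 m hm (toL2 φ) = toL2 (mulOp m hs φ) := by
  refine Lp.ext ?_
  filter_upwards [coeFn_mulL2 hm (toL2 φ), coeFn_toL2 φ, coeFn_toL2 (mulOp m hs φ)] with q h1 h2 h3
  rw [h1, h3, Pi.mul_apply, h2]
  rfl

theorem inner_mulL2 {m : ℝ × ℝ → ℂ} (hm : IsBddMeas m) (hr : ∀ q, (m q).im = 0) (u v : L2Plane) :
    ⟪mulL2 m hm u, v⟫_ℂ = ⟪u, mulL2 m hm v⟫_ℂ := by
  rw [L2.inner_def, L2.inner_def]
  refine integral_congr_ae ?_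
  filter_upwards [coeFn_mulL2 hm u, coeFn_mulL2 hm v] with q h1 h2
  rw [h1, h2]
  simp only [RCLike.inner_apply, Pi.mul_apply, map_mul, Complex.conj_eq_iff_im.2 (hr q)]
  ring

theorem tendsto_mulL2 {m : ℕ → ℝ × ℝ → ℂ} (hm : ∀ n, IsBddMeas (m n)) {m₀ : ℝ × ℝ → ℂ}
    (hm₀ : IsBddMeas m₀) {C : ℝ} (hC : ∀ n q, ‖m n q‖ ≤ C)
    (hlim : ∀ q, Tendsto (fun n => m n q) atTop (𝓝 (m₀ q))) (u : L2Plane) :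
    Tendsto (fun n => mulL2 (m n) (hm n) u) atTop (𝓝 (mulL2 m₀ hm₀ u)) := by
  have hC₀ : ∀ q, ‖m₀ q‖ ≤ C := fun q => le_of_tendsto' (hlim q).norm fun n => hC n q
  rw [tendsto_iff_norm_sub_tendsto_zero]
  have hsq : ∀ n, ‖mulL2 (m n) (hm n) u - mulL2 m₀ hm₀ u‖ ^ 2
      = ∫ q, ‖(m n q - m₀ q) * u q‖ ^ 2 := by
    intro n
    have h := congrArg RCLike.re (L2.inner_def (𝕜 := ℂ)
      (mulL2 (m n) (hm n) u - mulL2 m₀ hm₀ u) (mulL2 (m n) (hm n) u - mulL2 m₀ hm₀ u))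
    rw [← norm_sq_eq_re_inner] at h
    rw [h, ← integral_re (L2.integrable_inner _ _)]
    refine integral_congr_ae ?_
    filter_upwards [Lp.coeFn_sub (mulL2 (m n) (hm n) u) (mulL2 m₀ hm₀ u),
      coeFn_mulL2 (hm n) u, coeFn_mulL2 hm₀ u] with q h1 h2 h3
    rw [← norm_sq_eq_re_inner, h1, Pi.sub_apply, h2, h3, Pi.mul_apply, Pi.mul_apply, sub_mul]
  have hlim2 : Tendsto (fun n => ∫ q, ‖(m n q - m₀ q) * u q‖ ^ 2) atTop (𝓝 (∫ _ : ℝ × ℝ, 0)) := by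
    refine tendsto_integral_of_dominated_convergence (fun q => (2 * C) ^ 2 * ‖u q‖ ^ 2) ?_ ?_ ?_ ?_
    · intro n
      exact ((((hm n).measurable.sub hm₀.measurable).aestronglyMeasurable.mul
        (Lp.aestronglyMeasurable u)).norm.pow 2)
    · exact ((memLp_two_iff_integrable_sq_norm (Lp.aestronglyMeasurable u)).1
        (Lp.memLp u)).const_mul _
    · intro n
      refine ae_of_all _ fun q => ?_
      have hb : ‖m n q - m₀ q‖ ≤ 2 * C :=
        (norm_sub_le _ _).trans (by linarith [hC n q, hC₀ q])
      rw [norm_mul, mul_pow, norm_mul, norm_pow, norm_pow, norm_norm, norm_norm]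
      gcongr
    · refine ae_of_all _ fun q => ?_
      have h1 := ((((hlim q).sub_const (m₀ q)).mul_const (u q)).norm).pow 2
      simpa using h1
  simp only [← hsq, integral_zero] at hlim2
  have := (Real.continuous_sqrt.tendsto 0).comp hlim2
  simpa [Function.comp_def, Real.sqrt_sq (norm_nonneg _)] using this

/-! ### Locally bounded potentials and the Hamiltonian on test functions -/

/-- Measurable, locally bounded potentials. -/
structure IsPotential (V : ℝ × ℝ → ℝ) : Prop where
  measurable : Measurable V
  locBdd : ∀ r, ∃ C, ∀ q, ‖q‖ ≤ r → |V q| ≤ C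

theorem IsPotential.memLp_mul {V : ℝ × ℝ → ℝ} (hV : IsPotential V) (φ : TestFn) :
    MemLp (fun q => (V q : ℂ) * (φ : ℝ × ℝ → ℂ) q) 2 volume := by
  obtain ⟨r, hr⟩ := φ.hasCompactSupport.isCompact.isBounded.exists_norm_le
  obtain ⟨C, hC⟩ := hV.locBdd r
  refine (φ.memLp 2).of_le_mul (c := C)
    ((Complex.measurable_ofReal.comp hV.measurable).aestronglyMeasurable.mul
      (φ.memLp 2).1) (ae_of_all _ fun q => ?_)
  by_cases hq : q ∈ tsupport (φ : ℝ × ℝ → ℂ)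
  · rw [norm_mul, Complex.norm_real]
    exact mul_le_mul_of_nonneg_right (hC q (hr q hq)) (norm_nonneg _)
  · simp [image_eq_zero_of_notMem_tsupport hq]

/-- Multiplication of test functions by a potential. -/
def potOp (V : ℝ × ℝ → ℝ) (hV : IsPotential V) : TestFn →ₗ[ℂ] L2Plane where
  toFun φ := (hV.memLp_mul φ).toLp
  map_add' φ ψ := by
    rw [← MemLp.toLp_add, MemLp.toLp_eq_toLp_iff]
    exact ae_of_all _ fun q => by simp [mul_add]
  map_smul' c φ := by
    rw [RingHom.id_apply, ← MemLp.toLp_const_smul, MemLp.toLp_eq_toLp_iff]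
    exact ae_of_all _ fun q => by simp [mul_left_comm]

theorem coeFn_potOp {V : ℝ × ℝ → ℝ} (hV : IsPotential V) (φ : TestFn) :
    potOp V hV φ =ᵐ[volume] fun q => (V q : ℂ) * (φ : ℝ × ℝ → ℂ) q :=
  (hV.memLp_mul φ).coeFn_toLp

theorem inner_potOp_left {V : ℝ × ℝ → ℝ} (hV : IsPotential V) (φ ψ : TestFn) :
    ⟪potOp V hV φ, toL2 ψ⟫_ℂ
      = ∫ q, (V q : ℂ) * (starRingEnd ℂ ((φ : ℝ × ℝ → ℂ) q) * (ψ : ℝ × ℝ → ℂ) q) := by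
  refine (inner_toLp (hV.memLp_mul φ) (ψ.memLp 2)).trans ?_
  congr 1
  funext q
  rw [map_mul, Complex.conj_ofReal, mul_assoc]

theorem inner_potOp {V : ℝ × ℝ → ℝ} (hV : IsPotential V) (φ ψ : TestFn) :
    ⟪potOp V hV φ, toL2 ψ⟫_ℂ = ⟪toL2 φ, potOp V hV ψ⟫_ℂ := by
  refine (inner_potOp_left hV φ ψ).trans (Eq.trans ?_
    (inner_toLp (φ.memLp 2) (hV.memLp_mul ψ)).symm)
  congr 1
  funext q
  ring

theorem norm_potOp_le {V : ℝ × ℝ → ℝ} (hV : IsPotential V) {C : ℝ} (h : ∀ q, |V q| ≤ C)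
    (φ : TestFn) : ‖potOp V hV φ‖ ≤ C * ‖toL2 φ‖ := by
  refine Lp.norm_le_mul_norm_of_ae_le_mul ?_
  filter_upwards [coeFn_potOp hV φ, coeFn_toL2 φ] with q h1 h2
  rw [h1, h2, norm_mul, Complex.norm_real]
  exact mul_le_mul_of_nonneg_right (h q) (norm_nonneg _)

theorem neg_mul_norm_sq_le_inner_potOp {V : ℝ × ℝ → ℝ} (hV : IsPotential V) {C : ℝ}
    (h : ∀ q, -C ≤ V q) (φ : TestFn) :
    -C * ‖toL2 φ‖ ^ 2 ≤ (⟪toL2 φ, potOp V hV φ⟫_ℂ).re := by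
  have h1 : ⟪toL2 φ, potOp V hV φ⟫_ℂ = ((∫ q, V q * ‖(φ : ℝ × ℝ → ℂ) q‖ ^ 2 : ℝ) : ℂ) := by
    rw [← inner_potOp, inner_potOp_left, ← integral_complex_ofReal]
    congr 1
    funext q
    rw [Complex.conj_mul']
    push_cast
    ring
  have h2 : ‖toL2 φ‖ ^ 2 = ∫ q, ‖(φ : ℝ × ℝ → ℂ) q‖ ^ 2 := by
    have h3 : ⟪toL2 φ, toL2 φ⟫_ℂ = ((∫ q, ‖(φ : ℝ × ℝ → ℂ) q‖ ^ 2 : ℝ) : ℂ) := by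
      refine (inner_toLp (φ.memLp 2) (φ.memLp 2)).trans ?_
      rw [← integral_complex_ofReal]
      congr 1
      funext q
      rw [Complex.conj_mul']
      push_cast
      rfl
    have h4 := norm_sq_eq_re_inner (𝕜 := ℂ) (toL2 φ)
    rw [h3] at h4
    simpa using h4
  have hi : Integrable (fun q => ‖(φ : ℝ × ℝ → ℂ) q‖ ^ 2) (volume : Measure (ℝ × ℝ)) :=
    (memLp_two_iff_integrable_sq_norm (φ.memLp 2).1).1 (φ.memLp 2)
  have hi2 : Integrable (fun q => V q * ‖(φ : ℝ × ℝ → ℂ) q‖ ^ 2)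
      (volume : Measure (ℝ × ℝ)) := by
    have h5 := ((hV.memLp_mul φ).integrable_mul (φ.memLp 2).star).re
    refine h5.congr (ae_of_all _ fun q => ?_)
    simp only [Pi.mul_apply, Pi.star_apply, RCLike.star_def, mul_assoc, Complex.mul_conj']
    rw [← Complex.ofReal_pow, ← Complex.ofReal_mul]
    rfl
  rw [h1, Complex.ofReal_re, h2, ← integral_const_mul]
  exact integral_mono (hi.const_mul _) hi2 fun q =>
    mul_le_mul_of_nonneg_right (h q) (by positivity)

/-- The kinetic energy `(p - A)²` on test functions. -/
def kinOp (B : ℝ) : TestFn →ₗ[ℂ] TestFn := kinXOp B ∘ₗ kinXOp B + kinYOp ∘ₗ kinYOp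

/-- The Hamiltonian `(p - A)² + V` on test functions. -/
def hamOp (B : ℝ) (V : ℝ × ℝ → ℝ) (hV : IsPotential V) : TestFn →ₗ[ℂ] L2Plane :=
  toL2 ∘ₗ kinOp B + potOp V hV

theorem inner_kinOp (B : ℝ) (φ ψ : TestFn) :
    ⟪toL2 (kinOp B φ), toL2 ψ⟫_ℂ = ⟪toL2 φ, toL2 (kinOp B ψ)⟫_ℂ := by
  simp only [kinOp, LinearMap.add_apply, LinearMap.comp_apply, map_add, inner_add_left,
    inner_add_right, inner_kinXOp, inner_kinYOp]

theorem inner_hamOp (B : ℝ) {V : ℝ × ℝ → ℝ} (hV : IsPotential V) (φ ψ : TestFn) :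
    ⟪hamOp B V hV φ, toL2 ψ⟫_ℂ = ⟪toL2 φ, hamOp B V hV ψ⟫_ℂ := by
  simp only [hamOp, LinearMap.add_apply, LinearMap.comp_apply, inner_add_left,
    inner_add_right, inner_kinOp, inner_potOp]

theorem inner_kinOp_self (B : ℝ) (φ : TestFn) :
    (⟪toL2 φ, toL2 (kinOp B φ)⟫_ℂ).re
      = ‖toL2 (kinXOp B φ)‖ ^ 2 + ‖toL2 (kinYOp φ)‖ ^ 2 := by
  simp only [kinOp, LinearMap.add_apply, LinearMap.comp_apply, map_add, inner_add_right]
  rw [← inner_kinXOp, ← inner_kinYOp, Complex.add_re]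
  exact congrArg₂ (· + ·) (norm_sq_eq_re_inner (𝕜 := ℂ) _).symm
    (norm_sq_eq_re_inner (𝕜 := ℂ) _).symm

theorem norm_kin_sq_le (B : ℝ) {V : ℝ × ℝ → ℝ} (hV : IsPotential V) {C : ℝ} (h : ∀ q, -C ≤ V q)
    (φ : TestFn) :
    ‖toL2 (kinXOp B φ)‖ ^ 2 + ‖toL2 (kinYOp φ)‖ ^ 2
      ≤ (⟪toL2 φ, hamOp B V hV φ⟫_ℂ).re + C * ‖toL2 φ‖ ^ 2 := by
  have h1 := neg_mul_norm_sq_le_inner_potOp hV h φ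
  simp only [hamOp, LinearMap.add_apply, LinearMap.comp_apply, inner_add_right, Complex.add_re,
    inner_kinOp_self]
  linarith

/-! ### Closures of operators on test functions -/

/-- `Submodule.toLinearPMap` has the given submodule as its graph only if that submodule is
single-valued. This holds because an `L²` class contains at most one continuous function. -/
theorem graph_testOperator {L : (ℝ × ℝ → ℂ) → ℝ × ℝ → ℂ} (A : TestFn →ₗ[ℂ] L2Plane)
    (hA : ∀ φ : TestFn, A φ =ᵐ[volume] L φ) :
    (testOperator L).graph = LinearMap.range (toL2.prod A) := by
  have hset : {w : L2Plane × L2Plane |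
      ∃ φ, IsTest φ ∧ w.1 =ᵐ[volume] φ ∧ w.2 =ᵐ[volume] L φ}
      = (LinearMap.range (toL2.prod A) : Set (L2Plane × L2Plane)) := by
    ext w
    constructor
    · rintro ⟨φ, hφ, h1, h2⟩
      refine ⟨⟨φ, hφ⟩, Prod.ext (Lp.ext ?_) (Lp.ext ?_)⟩
      · exact (coeFn_toL2 ⟨φ, hφ⟩).trans h1.symm
      · exact (hA ⟨φ, hφ⟩).trans h2.symm
    · rintro ⟨φ, rfl⟩
      exact ⟨φ, φ.2, coeFn_toL2 φ, hA φ⟩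
  rw [testOperator, hset, Submodule.span_eq, Submodule.toLinearPMap_graph_eq]
  rintro _ ⟨φ, rfl⟩ h
  have h0 : φ = 0 := toL2_injective (h.trans (map_zero toL2).symm)
  rw [h0]
  simp

/-- A symmetric, densely defined operator is closable: if `φₙ → 0` and `A φₙ → y`, then `⟪ψ, y⟫ =
lim ⟪A ψ, φₙ⟫ = 0` for every test function `ψ`. -/
theorem isClosable_testOperator {L : (ℝ × ℝ → ℂ) → ℝ × ℝ → ℂ} (A : TestFn →ₗ[ℂ] L2Plane)
    (hA : ∀ φ : TestFn, A φ =ᵐ[volume] L φ)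
    (hs : ∀ φ ψ : TestFn, ⟪A φ, toL2 ψ⟫_ℂ = ⟪toL2 φ, A ψ⟫_ℂ) :
    (testOperator L).IsClosable := by
  refine ⟨(testOperator L).graph.topologicalClosure.toLinearPMap, ?_⟩
  rw [Submodule.toLinearPMap_graph_eq]
  rintro ⟨x, y⟩ hx (rfl : x = 0)
  refine eq_zero_of_inner_toL2 y fun ψ => ?_
  have hc : IsClosed {w : L2Plane × L2Plane | ⟪toL2 ψ, w.2⟫_ℂ = ⟪A ψ, w.1⟫_ℂ} :=
    isClosed_eq (by fun_prop) (by fun_prop)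
  have hsub : ((testOperator L).graph : Set (L2Plane × L2Plane)) ⊆
      {w : L2Plane × L2Plane | ⟪toL2 ψ, w.2⟫_ℂ = ⟪A ψ, w.1⟫_ℂ} := by
    rw [graph_testOperator A hA]
    rintro _ ⟨φ, rfl⟩
    exact (hs ψ φ).symm
  have h := closure_minimal hsub hc hx
  simpa using h

theorem mem_graph_closure_iff {L : (ℝ × ℝ → ℂ) → ℝ × ℝ → ℂ} (A : TestFn →ₗ[ℂ] L2Plane)
    (hA : ∀ φ : TestFn, A φ =ᵐ[volume] L φ)
    (hs : ∀ φ ψ : TestFn, ⟪A φ, toL2 ψ⟫_ℂ = ⟪toL2 φ, A ψ⟫_ℂ) (ψ η : L2Plane) :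
    (ψ, η) ∈ (testOperator L).closure.graph ↔ ∃ φ : ℕ → TestFn,
      Tendsto (fun n => toL2 (φ n)) atTop (𝓝 ψ) ∧ Tendsto (fun n => A (φ n)) atTop (𝓝 η) := by
  rw [← (isClosable_testOperator A hA hs).graph_closure_eq_closure_graph,
    graph_testOperator A hA, ← SetLike.mem_coe, Submodule.topologicalClosure_coe,
    mem_closure_iff_seq_limit]
  constructor
  · rintro ⟨w, hw, hlim⟩
    choose φ hφ using hw
    refine ⟨φ, ?_, ?_⟩
    · have := (continuous_fst.tendsto _).comp hlim
      simpa [Function.comp_def, ← hφ] using this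
    · have := (continuous_snd.tendsto _).comp hlim
      simpa [Function.comp_def, ← hφ] using this
  · rintro ⟨φ, h1, h2⟩
    exact ⟨fun n => (toL2 (φ n), A (φ n)), fun n => ⟨φ n, rfl⟩, h1.prodMk_nhds h2⟩

theorem coeFn_hamOp (B : ℝ) {V : ℝ × ℝ → ℝ} (hV : IsPotential V) (φ : TestFn) :
    hamOp B V hV φ =ᵐ[volume] schrodingerExpr B V φ := by
  filter_upwards [Lp.coeFn_add (toL2 (kinOp B φ)) (potOp V hV φ), coeFn_toL2 (kinOp B φ),
    coeFn_potOp hV φ] with q h1 h2 h3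
  refine h1.trans ?_
  rw [Pi.add_apply, h2, h3]
  rfl

theorem coeFn_guidingOp (B : ℝ) (φ : TestFn) :
    (toL2 ∘ₗ guidingOp B) φ =ᵐ[volume] guidingExpr B φ := coeFn_toL2 (guidingOp B φ)

/-- `(ψ, η)` is in the graph of the Hamiltonian iff it is a limit of test functions. -/
theorem mem_graph_hamiltonian (B : ℝ) {V : ℝ × ℝ → ℝ} (hV : IsPotential V) (ψ η : L2Plane) :
    (ψ, η) ∈ (hamiltonian B V).graph ↔ ∃ φ : ℕ → TestFn,
      Tendsto (fun n => toL2 (φ n)) atTop (𝓝 ψ) ∧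
        Tendsto (fun n => hamOp B V hV (φ n)) atTop (𝓝 η) :=
  mem_graph_closure_iff (hamOp B V hV) (coeFn_hamOp B hV) (inner_hamOp B hV) ψ η

theorem mem_graph_guidingCenter (B : ℝ) (ψ η : L2Plane) :
    (ψ, η) ∈ (guidingCenter B).graph ↔ ∃ φ : ℕ → TestFn,
      Tendsto (fun n => toL2 (φ n)) atTop (𝓝 ψ) ∧
        Tendsto (fun n => toL2 (guidingOp B (φ n))) atTop (𝓝 η) :=
  mem_graph_closure_iff (toL2 ∘ₗ guidingOp B) (coeFn_guidingOp B) (inner_guidingOp B) ψ η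

/-! ### The spectral theorem -/

section SpectralTheorem

set_option linter.unusedSectionVars false

variable {H : Type*} [NormedAddCommGroup H] [InnerProductSpace ℂ H] [CompleteSpace H]
  {X : Type*} [MetricSpace X] [CompactSpace X] [MeasurableSpace X] [BorelSpace X]
  (π : C(X, ℝ) →⋆ₐ[ℝ] (H →L[ℂ] H))

theorem inner_rep (f : C(X, ℝ)) (φ ψ : H) : ⟪π f φ, ψ⟫_ℂ = ⟪φ, π f ψ⟫_ℂ := by
  have h : IsSelfAdjoint (π f) := by
    rw [IsSelfAdjoint, ← map_star, star_trivial]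
  exact ContinuousLinearMap.isSelfAdjoint_iff_isSymmetric.1 h φ ψ

theorem re_inner_rep_mul_self (f : C(X, ℝ)) (ψ : H) :
    (⟪ψ, π (f * f) ψ⟫_ℂ).re = ‖π f ψ‖ ^ 2 := by
  rw [map_mul, mul_apply_eq_comp, ← inner_rep]
  exact (norm_sq_eq_re_inner (𝕜 := ℂ) _).symm

/-- The positive functional `f ↦ ⟪ψ, π(f) ψ⟫`. -/
def repFunctional (ψ : H) : CompactlySupportedContinuousMap X ℝ →ₚ[ℝ] ℝ :=
  PositiveLinearMap.mk₀
    { toFun := fun f => (⟪ψ, π f.toContinuousMap ψ⟫_ℂ).re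
      map_add' := by
        intro f g
        have : (f + g).toContinuousMap = f.toContinuousMap + g.toContinuousMap := rfl
        rw [this, map_add, add_apply, inner_add_right, Complex.add_re]
      map_smul' := by
        intro c f
        have : (c • f).toContinuousMap = c • f.toContinuousMap := rfl
        rw [this, map_smul, smul_apply, inner_smul_right_eq_smul, Complex.smul_re,
          RingHom.id_apply] }
    (by
      intro f hf
      -- Positivity: `f` is the square of `√f`, and a square is mapped to `‖π(√f) ψ‖² ≥ 0`.
      have hs : f.toContinuousMap
          = (⟨fun x => √(f x), by fun_prop⟩ : C(X, ℝ)) * ⟨fun x => √(f x), by fun_prop⟩ :=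
        ContinuousMap.ext fun x => (Real.mul_self_sqrt (hf x)).symm
      change 0 ≤ (⟪ψ, π f.toContinuousMap ψ⟫_ℂ).re
      rw [hs, re_inner_rep_mul_self]
      positivity)

/-- The measure representing `f ↦ ⟪ψ, π(f) ψ⟫`. -/
def repMeasure (ψ : H) : Measure X := RealRMK.rieszMeasure (repFunctional π ψ)

instance (ψ : H) : IsFiniteMeasure (repMeasure π ψ) :=
  inferInstanceAs (IsFiniteMeasure (RealRMK.rieszMeasure (repFunctional π ψ)))

theorem integral_repMeasure (f : C(X, ℝ)) (ψ : H) :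
    ∫ x, f x ∂(repMeasure π ψ) = (⟪ψ, π f ψ⟫_ℂ).re :=
  RealRMK.integral_rieszMeasure (repFunctional π ψ) ⟨f, HasCompactSupport.of_compactSpace _⟩

theorem memLp_continuousMap (f : C(X, ℝ)) (μ : Measure X) [IsFiniteMeasure μ] (p : ℝ≥0∞) :
    MemLp f p μ :=
  MemLp.of_bound f.continuous.aestronglyMeasurable ‖f‖ (ae_of_all _ f.norm_coe_le_norm)

/-- The isometry behind the whole construction: `f ↦ π(f) ψ` extends from continuous functions to
`L²(μ_ψ)`, in particular to indicator functions, by completeness of `H`. -/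
theorem enorm_rep (f : C(X, ℝ)) (ψ : H) : ‖π f ψ‖ₑ = eLpNorm f 2 (repMeasure π ψ) := by
  have h1 : ‖π f ψ‖ ^ 2 = ∫ x, ‖f x‖ ^ 2 ∂(repMeasure π ψ) := by
    rw [← re_inner_rep_mul_self, ← integral_repMeasure]
    congr 1
    funext x
    rw [ContinuousMap.mul_apply, Real.norm_eq_abs, sq_abs, sq]
  rw [(memLp_continuousMap f _ 2).eLpNorm_eq_integral_rpow_norm (by norm_num) (by norm_num)]
  simp only [ENNReal.toReal_ofNat, Real.rpow_ofNat]
  rw [← h1, ← ofReal_norm]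
  congr 1
  simpa using (Real.pow_rpow_inv_natCast (norm_nonneg (π f ψ)) two_ne_zero).symm

/-- `η` is the limit of `π(f) ψ` as `f` tends to `g` in `L²`. -/
def IsRepLimit (g : X → ℝ) (ψ η : H) : Prop :=
  ∀ f : ℕ → C(X, ℝ), Tendsto (fun n => eLpNorm (⇑(f n) - g) 2 (repMeasure π ψ)) atTop (𝓝 0) →
    Tendsto (fun n => π (f n) ψ) atTop (𝓝 η)

theorem exists_tendsto_eLpNorm (μ : Measure X) [IsFiniteMeasure μ] {g : X → ℝ}
    (hg : MemLp g 2 μ) :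
    ∃ f : ℕ → C(X, ℝ), Tendsto (fun n => eLpNorm (⇑(f n) - g) 2 μ) atTop (𝓝 0) := by
  have h : ∀ n : ℕ, ∃ f : C(X, ℝ), eLpNorm (⇑f - g) 2 μ ≤ ((n : ℝ≥0∞))⁻¹ := by
    intro n
    obtain ⟨f, hf, -⟩ := hg.exists_boundedContinuous_eLpNorm_sub_le (by norm_num)
      (ENNReal.inv_ne_zero.2 (ENNReal.natCast_ne_top n))
    refine ⟨f.toContinuousMap, ?_⟩
    rw [eLpNorm_sub_comm]
    exact hf
  choose f hf using h
  exact ⟨f, tendsto_of_tendsto_of_tendsto_of_le_of_le tendsto_const_nhds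
    ENNReal.tendsto_inv_nat_nhds_zero (fun _ => zero_le) hf⟩

theorem tendsto_rep_sub {ψ : H} {g : X → ℝ} (hg : MemLp g 2 (repMeasure π ψ))
    {ι : Type*} {l : Filter ι} {f k : ι → C(X, ℝ)}
    (hf : Tendsto (fun n => eLpNorm (⇑(f n) - g) 2 (repMeasure π ψ)) l (𝓝 0))
    (hk : Tendsto (fun n => eLpNorm (⇑(k n) - g) 2 (repMeasure π ψ)) l (𝓝 0)) :
    Tendsto (fun n => π (f n) ψ - π (k n) ψ) l (𝓝 0) := by
  rw [tendsto_zero_iff_enorm_tendsto_zero]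
  refine tendsto_of_tendsto_of_tendsto_of_le_of_le tendsto_const_nhds
    (by simpa using hf.add hk) (fun _ => zero_le) fun n => ?_
  change ‖π (f n) ψ - π (k n) ψ‖ₑ ≤ _
  rw [← sub_apply, ← map_sub, enorm_rep]
  have e : ⇑(f n - k n) = (⇑(f n) - g) - (⇑(k n) - g) := by
    funext x
    simp
  rw [e]
  exact eLpNorm_sub_le ((f n).continuous.aestronglyMeasurable.sub hg.1)
    ((k n).continuous.aestronglyMeasurable.sub hg.1) (by norm_num)

theorem exists_isRepLimit {ψ : H} {g : X → ℝ} (hg : MemLp g 2 (repMeasure π ψ)) :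
    ∃ η, IsRepLimit π g ψ η := by
  obtain ⟨f, hf⟩ := exists_tendsto_eLpNorm (repMeasure π ψ) hg
  have hc : CauchySeq fun n => π (f n) ψ := by
    rw [cauchySeq_iff_tendsto_dist_atTop_0, ← prod_atTop_atTop_eq]
    simp only [dist_eq_norm]
    exact tendsto_zero_iff_norm_tendsto_zero.1
      (tendsto_rep_sub π hg (hf.comp tendsto_fst) (hf.comp tendsto_snd))
  obtain ⟨η, hη⟩ := cauchySeq_tendsto_of_complete hc
  refine ⟨η, fun k hk => ?_⟩
  have := hη.sub (tendsto_rep_sub π hg hf hk)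
  simpa using this

variable {π} in
theorem IsRepLimit.unique {ψ : H} {g : X → ℝ} (hg : MemLp g 2 (repMeasure π ψ)) {η η' : H}
    (h : IsRepLimit π g ψ η) (h' : IsRepLimit π g ψ η') : η = η' := by
  obtain ⟨f, hf⟩ := exists_tendsto_eLpNorm (repMeasure π ψ) hg
  exact tendsto_nhds_unique (h f hf) (h' f hf)

variable {π} in
theorem IsRepLimit.of_tendsto {ψ : H} {g : X → ℝ} (hg : MemLp g 2 (repMeasure π ψ)) {η : H}
    {f : ℕ → C(X, ℝ)}
    (hf : Tendsto (fun n => eLpNorm (⇑(f n) - g) 2 (repMeasure π ψ)) atTop (𝓝 0))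
    (h : Tendsto (fun n => π (f n) ψ) atTop (𝓝 η)) : IsRepLimit π g ψ η := by
  intro k hk
  have := h.sub (tendsto_rep_sub π hg hf hk)
  simpa using this

theorem isRepLimit_continuousMap (f : C(X, ℝ)) (ψ : H) : IsRepLimit π f ψ (π f ψ) :=
  .of_tendsto (memLp_continuousMap f _ 2) (f := fun _ => f) (by simp) tendsto_const_nhds

variable {π} in
theorem IsRepLimit.sub {ψ : H} {g g' : X → ℝ} (hg : MemLp g 2 (repMeasure π ψ))
    (hg' : MemLp g' 2 (repMeasure π ψ)) {η η' : H}
    (h : IsRepLimit π g ψ η) (h' : IsRepLimit π g' ψ η') : IsRepLimit π (g - g') ψ (η - η') := by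
  obtain ⟨f, hf⟩ := exists_tendsto_eLpNorm (repMeasure π ψ) hg
  obtain ⟨f', hf'⟩ := exists_tendsto_eLpNorm (repMeasure π ψ) hg'
  refine .of_tendsto (hg.sub hg') (f := fun n => f n - f' n) ?_ ?_
  · refine tendsto_of_tendsto_of_tendsto_of_le_of_le tendsto_const_nhds
      (by simpa using hf.add hf') (fun _ => zero_le) fun n => ?_
    have e : ⇑(f n - f' n) - (g - g') = (⇑(f n) - g) - (⇑(f' n) - g') := by
      funext x
      simp only [ContinuousMap.coe_sub, Pi.sub_apply]
      ring
    simp only [e]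
    exact eLpNorm_sub_le ((f n).continuous.aestronglyMeasurable.sub hg.1)
      ((f' n).continuous.aestronglyMeasurable.sub hg'.1) (by norm_num)
  · simpa using (h f hf).sub (h' f' hf')

variable {π} in
theorem IsRepLimit.enorm_le {ψ : H} {g : X → ℝ} (hg : MemLp g 2 (repMeasure π ψ)) {η : H}
    (h : IsRepLimit π g ψ η) : ‖η‖ₑ ≤ eLpNorm g 2 (repMeasure π ψ) := by
  obtain ⟨f, hf⟩ := exists_tendsto_eLpNorm (repMeasure π ψ) hg
  have h1 : Tendsto (fun n => ‖π (f n) ψ‖ₑ) atTop (𝓝 ‖η‖ₑ) := (h f hf).enorm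
  have h2 := hf.add_const (eLpNorm g 2 (repMeasure π ψ))
  rw [zero_add] at h2
  refine le_of_tendsto_of_tendsto' h1 h2 fun n => ?_
  rw [enorm_rep]
  have := eLpNorm_add_le ((f n).continuous.aestronglyMeasurable.sub hg.1) hg.1
    (p := 2) (by norm_num)
  rwa [sub_add_cancel] at this

variable {π} in
/-- `η` is a limit of `π(f) ψ` with a bounded continuous factor applied. -/
theorem IsRepLimit.rep {ψ : H} {g : X → ℝ} (hg : MemLp g 2 (repMeasure π ψ)) {η : H}
    (h : IsRepLimit π g ψ η) (k : C(X, ℝ)) : IsRepLimit π (k * g) ψ (π k η) := by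
  obtain ⟨f, hf⟩ := exists_tendsto_eLpNorm (repMeasure π ψ) hg
  have hkg : MemLp (⇑k * g) 2 (repMeasure π ψ) :=
    hg.of_le_mul (c := ‖k‖) (k.continuous.aestronglyMeasurable.mul hg.1) (ae_of_all _ fun x => by
      rw [Pi.mul_apply, norm_mul]
      exact mul_le_mul_of_nonneg_right (k.norm_coe_le_norm x) (norm_nonneg _))
  refine .of_tendsto hkg (f := fun n => k * f n) ?_ ?_
  · have hb : Tendsto (fun n => ENNReal.ofReal ‖k‖ * eLpNorm (⇑(f n) - g) 2 (repMeasure π ψ))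
        atTop (𝓝 0) := by
      have := ENNReal.Tendsto.const_mul (a := ENNReal.ofReal ‖k‖) hf
        (Or.inr ENNReal.ofReal_ne_top)
      rwa [mul_zero] at this
    refine tendsto_of_tendsto_of_tendsto_of_le_of_le tendsto_const_nhds hb
      (fun _ => zero_le) fun n => ?_
    refine eLpNorm_le_mul_eLpNorm_of_ae_le_mul (ae_of_all _ fun x => ?_) 2
    simp only [ContinuousMap.coe_mul, Pi.sub_apply, Pi.mul_apply]
    rw [← mul_sub, norm_mul]
    exact mul_le_mul_of_nonneg_right (k.norm_coe_le_norm x) (norm_nonneg _)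
  · have := ((π k).continuous.tendsto η).comp (h f hf)
    simpa [Function.comp_def] using this

variable {π} in
theorem IsRepLimit.re_inner {ψ : H} {g : X → ℝ} (hg : MemLp g 2 (repMeasure π ψ)) {η : H}
    (h : IsRepLimit π g ψ η) : (⟪ψ, η⟫_ℂ).re = ∫ x, g x ∂(repMeasure π ψ) := by
  obtain ⟨f, hf⟩ := exists_tendsto_eLpNorm (repMeasure π ψ) hg
  have h1 : Tendsto (fun n => (⟪ψ, π (f n) ψ⟫_ℂ).re) atTop (𝓝 (⟪ψ, η⟫_ℂ).re) :=
    (Complex.continuous_re.tendsto _).comp (tendsto_const_nhds.inner (h f hf))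
  simp only [← integral_repMeasure] at h1
  refine tendsto_nhds_unique h1 (tendsto_integral_of_L1' g hg.1
    (Eventually.of_forall fun n => (memLp_continuousMap (f n) _ 1).integrable le_rfl) ?_)
  have hb : Tendsto (fun n => eLpNorm (⇑(f n) - g) 2 (repMeasure π ψ) *
      (repMeasure π ψ) Set.univ ^ (1 / (1 : ℝ≥0∞).toReal - 1 / (2 : ℝ≥0∞).toReal))
      atTop (𝓝 0) := by
    have := ENNReal.Tendsto.mul_const (b := (repMeasure π ψ) Set.univ ^
      (1 / (1 : ℝ≥0∞).toReal - 1 / (2 : ℝ≥0∞).toReal)) hf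
      (Or.inr (ENNReal.rpow_ne_top_of_nonneg (by norm_num) (measure_ne_top _ _)))
    simpa using this
  exact tendsto_of_tendsto_of_tendsto_of_le_of_le tendsto_const_nhds hb (fun _ => zero_le)
    fun n => eLpNorm_le_eLpNorm_mul_rpow_measure_univ (by norm_num)
      ((f n).continuous.aestronglyMeasurable.sub hg.1)

theorem inner_rep_self_im (f : C(X, ℝ)) (ψ : H) : (⟪ψ, π f ψ⟫_ℂ).im = 0 := by
  rw [← Complex.conj_eq_iff_im, inner_conj_symm, inner_rep]

variable {π} in
theorem IsRepLimit.inner_im {ψ : H} {g : X → ℝ} (hg : MemLp g 2 (repMeasure π ψ)) {η : H}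
    (h : IsRepLimit π g ψ η) : (⟪ψ, η⟫_ℂ).im = 0 := by
  obtain ⟨f, hf⟩ := exists_tendsto_eLpNorm (repMeasure π ψ) hg
  have h1 : Tendsto (fun n => (⟪ψ, π (f n) ψ⟫_ℂ).im) atTop (𝓝 (⟪ψ, η⟫_ℂ).im) :=
    (Complex.continuous_im.tendsto _).comp (tendsto_const_nhds.inner (h f hf))
  simp only [inner_rep_self_im] at h1
  exact tendsto_nhds_unique h1 tendsto_const_nhds

/-- The indicator function of a set. -/
abbrev ind (S : Set X) : X → ℝ := S.indicator fun _ => 1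

theorem memLp_ind {S : Set X} (hS : MeasurableSet S) (μ : Measure X) [IsFiniteMeasure μ] :
    MemLp (ind S) 2 μ :=
  memLp_indicator_const 2 hS 1 (Or.inr (measure_ne_top _ _))

/-- The vector `P(S) ψ`. -/
def projVec {S : Set X} (hS : MeasurableSet S) (ψ : H) : H :=
  (exists_isRepLimit π (memLp_ind hS (repMeasure π ψ))).choose

theorem isRepLimit_projVec {S : Set X} (hS : MeasurableSet S) (ψ : H) :
    IsRepLimit π (ind S) ψ (projVec π hS ψ) :=
  (exists_isRepLimit π (memLp_ind hS (repMeasure π ψ))).choose_spec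

theorem tendsto_eLpNorm_of_le {μ ν : Measure X} (h : μ ≤ ν) {g : X → ℝ} {f : ℕ → C(X, ℝ)}
    (hf : Tendsto (fun n => eLpNorm (⇑(f n) - g) 2 ν) atTop (𝓝 0)) :
    Tendsto (fun n => eLpNorm (⇑(f n) - g) 2 μ) atTop (𝓝 0) :=
  tendsto_of_tendsto_of_tendsto_of_le_of_le tendsto_const_nhds hf (fun _ => zero_le)
    fun _ => eLpNorm_mono_measure _ h

/-- Approximation in `L²` of the sum of the three measures gives one sequence that serves all three
vectors. Linearity and symmetry of the operators `π(fₙ)` can then be passed to the limit. -/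
theorem exists_tendsto_projVec {S : Set X} (hS : MeasurableSet S) (ψ₁ ψ₂ ψ₃ : H) :
    ∃ f : ℕ → C(X, ℝ), ∀ ψ ∈ ({ψ₁, ψ₂, ψ₃} : Set H),
      Tendsto (fun n => π (f n) ψ) atTop (𝓝 (projVec π hS ψ)) := by
  obtain ⟨f, hf⟩ := exists_tendsto_eLpNorm
    (repMeasure π ψ₁ + (repMeasure π ψ₂ + repMeasure π ψ₃)) (memLp_ind hS _)
  refine ⟨f, ?_⟩
  rintro ψ (rfl | rfl | rfl)
  · exact isRepLimit_projVec π hS _ f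
      (tendsto_eLpNorm_of_le (Measure.le_add_right le_rfl) hf)
  · exact isRepLimit_projVec π hS _ f
      (tendsto_eLpNorm_of_le (Measure.le_add_left (Measure.le_add_right le_rfl)) hf)
  · exact isRepLimit_projVec π hS _ f
      (tendsto_eLpNorm_of_le (Measure.le_add_left (Measure.le_add_left le_rfl)) hf)

theorem norm_projVec_le {S : Set X} (hS : MeasurableSet S) (ψ : H) : ‖projVec π hS ψ‖ ≤ ‖ψ‖ := by
  have h1 := (isRepLimit_projVec π hS ψ).enorm_le (memLp_ind hS _)
  have h2 : eLpNorm (ind S) 2 (repMeasure π ψ) ≤ eLpNorm (1 : C(X, ℝ)) 2 (repMeasure π ψ) := by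
    refine eLpNorm_mono fun x => ?_
    by_cases hx : x ∈ S <;> simp [ind, hx]
  rw [← enorm_rep, map_one, one_apply_eq_self] at h2
  exact enorm_le_iff_norm_le.1 (h1.trans h2)

/-- The spectral projection `P(S)`. -/
def projCLM {S : Set X} (hS : MeasurableSet S) : H →L[ℂ] H :=
  LinearMap.mkContinuous
    { toFun := projVec π hS
      map_add' := by
        intro φ ψ
        obtain ⟨f, hf⟩ := exists_tendsto_projVec π hS φ ψ (φ + ψ)
        refine tendsto_nhds_unique (hf (φ + ψ) (by simp)) ?_
        simpa using (hf φ (by simp)).add (hf ψ (by simp))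
      map_smul' := by
        intro c ψ
        obtain ⟨f, hf⟩ := exists_tendsto_projVec π hS ψ ψ (c • ψ)
        refine tendsto_nhds_unique (hf (c • ψ) (by simp)) ?_
        simpa using (hf ψ (by simp)).const_smul c }
    1 (fun ψ => by simpa using norm_projVec_le π hS ψ)

theorem isRepLimit_projCLM {S : Set X} (hS : MeasurableSet S) (ψ : H) :
    IsRepLimit π (ind S) ψ (projCLM π hS ψ) := isRepLimit_projVec π hS ψ

theorem inner_projCLM {S : Set X} (hS : MeasurableSet S) (φ ψ : H) :
    ⟪projCLM π hS φ, ψ⟫_ℂ = ⟪φ, projCLM π hS ψ⟫_ℂ := by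
  obtain ⟨f, hf⟩ := exists_tendsto_projVec π hS φ φ ψ
  refine tendsto_nhds_unique ((hf φ (by simp)).inner tendsto_const_nhds) ?_
  simp only [inner_rep]
  exact tendsto_const_nhds.inner (hf ψ (by simp))

theorem re_inner_projCLM {S : Set X} (hS : MeasurableSet S) (ψ : H) :
    (⟪ψ, projCLM π hS ψ⟫_ℂ).re = (repMeasure π ψ S).toReal := by
  rw [(isRepLimit_projCLM π hS ψ).re_inner (memLp_ind hS _), ind, integral_indicator_const _ hS]
  simp [Measure.real]

/-- With `ξ = P(T) ψ` and `fₙ → 1_S` for both `μ_ψ` and `μ_ξ`, the vectors `π(fₙ) ξ` tend to `P(S)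
ξ`. Read as limits over `ψ` they represent `fₙ 1_T`, whose distance to `1_S 1_T` is at most that of
`fₙ` to `1_S`. -/
theorem projCLM_inter {S T : Set X} (hS : MeasurableSet S) (hT : MeasurableSet T) :
    projCLM π (hS.inter hT) = projCLM π hS * projCLM π hT := by
  ext ψ
  set ξ := projCLM π hT ψ with hξ
  obtain ⟨f, hf⟩ := exists_tendsto_eLpNorm (repMeasure π ψ + repMeasure π ξ) (memLp_ind hS _)
  have h1 : Tendsto (fun n => π (f n) ξ) atTop (𝓝 (projCLM π hS ξ)) :=
    isRepLimit_projCLM π hS ξ f (tendsto_eLpNorm_of_le (Measure.le_add_left le_rfl) hf)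
  have h2 : Tendsto (fun n => π (f n) ξ) atTop (𝓝 (projCLM π (hS.inter hT) ψ)) := by
    rw [← tendsto_sub_nhds_zero_iff, tendsto_zero_iff_enorm_tendsto_zero]
    refine tendsto_of_tendsto_of_tendsto_of_le_of_le tendsto_const_nhds
      (tendsto_eLpNorm_of_le (Measure.le_add_right le_rfl) hf) (fun _ => zero_le) fun n => ?_
    have hm : MemLp (⇑(f n) * ind T) 2 (repMeasure π ψ) :=
      (memLp_ind hT (repMeasure π ψ)).of_le_mul (c := ‖f n‖)
        ((f n).continuous.aestronglyMeasurable.mul (memLp_ind hT _).1) (ae_of_all _ fun x => by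
          rw [Pi.mul_apply, norm_mul]
          exact mul_le_mul_of_nonneg_right ((f n).norm_coe_le_norm x) (norm_nonneg _))
    have h3 := (((isRepLimit_projCLM π hT ψ).rep (memLp_ind hT _) (f n)).sub hm
      (memLp_ind (hS.inter hT) _) (isRepLimit_projCLM π (hS.inter hT) ψ)).enorm_le
        (hm.sub (memLp_ind (hS.inter hT) _))
    refine h3.trans (eLpNorm_mono fun x => ?_)
    by_cases hxS : x ∈ S <;> by_cases hxT : x ∈ T <;> simp [ind, hxS, hxT]
  exact tendsto_nhds_unique h2 h1

theorem projCLM_union {S T : Set X} (hS : MeasurableSet S) (hT : MeasurableSet T)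
    (hd : Disjoint S T) (ψ : H) :
    projCLM π (hS.union hT) ψ = projCLM π hS ψ + projCLM π hT ψ := by
  have h := (isRepLimit_projCLM π (hS.union hT) ψ).sub (memLp_ind (hS.union hT) _)
    (memLp_ind hT _)
    (isRepLimit_projCLM π hT ψ)
  have e : ind (S ∪ T) - ind T = ind S := by
    funext x
    by_cases hxS : x ∈ S
    · have hxT : x ∉ T := fun h => hd.le_bot ⟨hxS, h⟩
      simp [ind, hxS, hxT]
    · by_cases hxT : x ∈ T <;> simp [ind, hxS, hxT]
  rw [e] at h
  rw [← h.unique (memLp_ind hS _) (isRepLimit_projCLM π hS ψ), sub_add_cancel]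

theorem projCLM_univ : projCLM π (MeasurableSet.univ : MeasurableSet (Set.univ : Set X)) = 1 := by
  ext ψ
  have h := isRepLimit_continuousMap π (1 : C(X, ℝ)) ψ
  have e : (⇑(1 : C(X, ℝ)) : X → ℝ) = ind Set.univ := by
    funext x
    simp [ind]
  rw [e, map_one] at h
  exact (isRepLimit_projCLM π _ ψ).unique (memLp_ind MeasurableSet.univ _) h

theorem hasSum_projCLM {S : ℕ → Set X} (hS : ∀ n, MeasurableSet (S n))
    (hd : Pairwise fun m n => Disjoint (S m) (S n)) (ψ : H) :
    HasSum (fun n => projCLM π (hS n) ψ) (projCLM π (MeasurableSet.iUnion hS) ψ) := by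
  -- Finite additivity splits off the sets indexed by `F`. The remainder tends to zero because its
  -- squared norm is bounded by a tail of the convergent series `∑ μ_ψ(S n)`.
  have hfin : ∀ F : Finset ℕ, projCLM π (MeasurableSet.iUnion hS) ψ
      = ∑ n ∈ F, projCLM π (hS n) ψ
        + projCLM π (MeasurableSet.iUnion fun n : {n // n ∉ F} => hS n) ψ := by
    intro F
    induction F using Finset.induction_on with
    | empty =>
      rw [Finset.sum_empty, zero_add]
      congr 2
      ext x
      simp
    | insert a F ha ih =>
      rw [ih, Finset.sum_insert ha, add_comm (projCLM π (hS a) ψ), add_assoc]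
      congr 1
      rw [← projCLM_union]
      · congr 2
        ext x
        simp only [Set.mem_iUnion, Subtype.exists, Set.mem_union, Finset.mem_insert]
        constructor
        · rintro ⟨n, hn, hx⟩
          by_cases h : n = a
          · exact Or.inl (h ▸ hx)
          · exact Or.inr ⟨n, by simp [h, hn], hx⟩
        · rintro (hx | ⟨n, hn, hx⟩)
          · exact ⟨a, ha, hx⟩
          · exact ⟨n, fun h => hn (Or.inr h), hx⟩
      · rw [Set.disjoint_iUnion_right]
        rintro ⟨n, hn⟩
        refine hd ?_
        rintro rfl
        exact hn (Finset.mem_insert_self _ _)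
  have hne : ∑' n, repMeasure π ψ (S n) ≠ ⊤ := by
    rw [← measure_iUnion hd hS]
    exact measure_ne_top _ _
  have h0 := ENNReal.tendsto_tsum_compl_atTop_zero hne
  rw [HasSum]
  have hsub : Tendsto (fun F : Finset ℕ =>
      projCLM π (MeasurableSet.iUnion fun n : {n // n ∉ F} => hS n) ψ) atTop (𝓝 0) := by
    rw [tendsto_zero_iff_enorm_tendsto_zero]
    have h1 := (ENNReal.continuous_rpow_const (y := 1 / (2 : ℝ≥0∞).toReal)).tendsto 0 |>.comp h0
    rw [ENNReal.zero_rpow_of_pos (by norm_num)] at h1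
    refine tendsto_of_tendsto_of_tendsto_of_le_of_le tendsto_const_nhds h1
      (fun _ => zero_le) fun F => ?_
    have hm : MeasurableSet (⋃ n : {n // n ∉ F}, S n) := MeasurableSet.iUnion fun n => hS n
    refine ((isRepLimit_projCLM π hm ψ).enorm_le (memLp_ind hm _)).trans ?_
    rw [ind, eLpNorm_indicator_const hm (by norm_num) (by norm_num), enorm_one, one_mul]
    exact ENNReal.rpow_le_rpow (measure_iUnion_le _) (by norm_num)
  have h2 := hsub.const_sub (projCLM π (MeasurableSet.iUnion hS) ψ)
  rw [sub_zero] at h2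
  refine h2.congr fun F => ?_
  rw [hfin F, add_sub_cancel_right]

end SpectralTheorem

section SpectralMeasure

set_option linter.unusedSectionVars false

variable {H : Type*} [NormedAddCommGroup H] [InnerProductSpace ℂ H] [CompleteSpace H]

/-! ### Transporting the projection-valued measure to the real line -/

section Pushforward

variable {X : Type*} [MetricSpace X] [CompactSpace X] [MeasurableSpace X] [BorelSpace X]
  (π : C(X, ℝ) →⋆ₐ[ℝ] (H →L[ℂ] H))

open Classical in
/-- The projection-valued measure `S ↦ P(h⁻¹(S))`. -/
def repPVM {h : X → ℝ} (hh : Measurable h) : PVM H where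
  toFun S := if hS : MeasurableSet S then projCLM π (hh hS) else 0
  isStarProjection S hS := by
    rw [dif_pos hS]
    refine ⟨?_, ContinuousLinearMap.isSelfAdjoint_iff_isSymmetric.2 (inner_projCLM π (hh hS))⟩
    rw [IsIdempotentElem, ← projCLM_inter]
    congr 1
    exact Set.inter_self _
  univ := by
    rw [dif_pos MeasurableSet.univ]
    exact projCLM_univ π
  inter S T hS hT := by
    rw [dif_pos (hS.inter hT), dif_pos hS, dif_pos hT]
    exact projCLM_inter π (hh hS) (hh hT)
  hasSum_iUnion S hS hd ψ := by
    rw [dif_pos (MeasurableSet.iUnion hS)]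
    have h1 := hasSum_projCLM π (fun n => hh (hS n)) (fun m n hmn => (hd hmn).preimage h) ψ
    convert h1 using 1
    · funext n
      rw [dif_pos (hS n)]
    · congr 2
      exact Set.preimage_iUnion

theorem repPVM_apply {h : X → ℝ} (hh : Measurable h) {S : Set ℝ} (hS : MeasurableSet S) :
    (repPVM π hh).toFun S = projCLM π (hh hS) := dif_pos hS

theorem scalarMeasure_repPVM {h : X → ℝ} (hh : Measurable h) (ψ : H) :
    (repPVM π hh).scalarMeasure ψ = (repMeasure π ψ).map h := by
  ext S hS
  rw [PVM.scalarMeasure, Measure.ofMeasurable_apply _ hS, Measure.map_apply hh hS,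
    repPVM_apply π hh hS, re_inner_projCLM, ENNReal.ofReal_toReal (measure_ne_top _ _)]

end Pushforward

/-! ### From a bounded self-adjoint resolvent to a spectral measure -/

section Resolvent

variable {R : H →L[ℂ] H} (hR : IsSelfAdjoint R)

/-- The continuous functional calculus of a bounded self-adjoint operator. -/
def calculus : C(spectrum ℝ R, ℝ) →⋆ₐ[ℝ] (H →L[ℂ] H) := cfcHom hR

/-- The identity function on the spectrum. -/
def specId (R : H →L[ℂ] H) : C(spectrum ℝ R, ℝ) :=
  ContinuousMap.restrict (spectrum ℝ R) (ContinuousMap.id ℝ)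

theorem calculus_specId : calculus hR (specId R) = R := cfcHom_id hR

/-- The function `r ↦ r⁻¹` on the spectrum. -/
def specInv (R : H →L[ℂ] H) (x : spectrum ℝ R) : ℝ := (x : ℝ)⁻¹

theorem measurable_specInv : Measurable (specInv R) := measurable_subtype_coe.inv

/-- The continuous functions `x / (x² + 1/(n+1))` converge pointwise to `x⁻¹`, including the
convention `0⁻¹ = 0`. Multiplied by `x` they are bounded by `1`, so applied to `R ξ` they have norm
at most `‖ξ‖`; Fatou's lemma concludes. -/
theorem memLp_specInv (ξ : H) : MemLp (specInv R) 2 (repMeasure (calculus hR) (R ξ)) := by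
  set μ := repMeasure (calculus hR) (R ξ)
  let k : ℕ → C(spectrum ℝ R, ℝ) := fun n =>
    ⟨fun x => (x : ℝ) / ((x : ℝ) ^ 2 + 1 / ((n : ℝ) + 1)), by
      refine Continuous.div (by fun_prop) (by fun_prop) fun x => ?_
      positivity⟩
  have hk : ∀ n, eLpNorm (k n) 2 μ ≤ ‖ξ‖ₑ := by
    intro n
    have h1 : calculus hR (k n) (R ξ) = calculus hR (k n * specId R) ξ := by
      rw [map_mul, calculus_specId]
      rfl
    rw [← enorm_rep, h1, enorm_rep]
    have h2 : ‖ξ‖ₑ = eLpNorm (1 : C(spectrum ℝ R, ℝ)) 2 (repMeasure (calculus hR) ξ) := by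
      rw [← enorm_rep, map_one, one_apply_eq_self]
    rw [h2]
    refine eLpNorm_mono fun x => ?_
    simp only [ContinuousMap.coe_mul, Pi.mul_apply, ContinuousMap.one_apply, norm_one]
    change ‖(x : ℝ) / ((x : ℝ) ^ 2 + 1 / ((n : ℝ) + 1)) * (x : ℝ)‖ ≤ 1
    have hp : (0 : ℝ) < 1 / ((n : ℝ) + 1) := by positivity
    rw [div_mul_eq_mul_div, Real.norm_of_nonneg (div_nonneg (mul_self_nonneg _) (by positivity)),
      div_le_one (by positivity)]
    nlinarith
  have hlim : ∀ x, Tendsto (fun n => k n x) atTop (𝓝 (specInv R x)) := by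
    intro x
    by_cases hx : (x : ℝ) = 0
    · have : ∀ n, k n x = 0 := fun n => by
        change (x : ℝ) / _ = 0
        rw [hx, zero_div]
      simp [this, specInv, hx]
    · have h1 := tendsto_const_nhds (x := (x : ℝ)) (f := atTop) |>.div
        (tendsto_const_nhds (x := (x : ℝ) ^ 2).add tendsto_one_div_add_atTop_nhds_zero_nat)
        (by simpa using hx)
      have e : (x : ℝ) / ((x : ℝ) ^ 2 + 0) = specInv R x := by
        rw [specInv]
        field_simp
        ring
      rw [e] at h1
      exact h1
  refine ⟨measurable_specInv.aestronglyMeasurable, ?_⟩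
  refine (Lp.eLpNorm_lim_le_liminf_eLpNorm (f := fun n => ⇑(k n))
    (fun n => (k n).continuous.aestronglyMeasurable) _ (ae_of_all _ hlim)).trans_lt ?_
  exact lt_of_le_of_lt (liminf_le_of_frequently_le' (Eventually.of_forall hk).frequently)
    enorm_lt_top

/-- The identity `x x⁻¹ = 1` fails at `x = 0`, but `x (x x⁻¹ - 1) = 0` holds everywhere. This gives
`R (R ξ - ψ) = 0`, and injectivity removes the extra factor. -/
theorem apply_eq_of_isRepLimit_specInv (hinj : Function.Injective R) {ψ ξ : H}
    (hm : MemLp (specInv R) 2 (repMeasure (calculus hR) ψ))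
    (h : IsRepLimit (calculus hR) (specInv R) ψ ξ) : R ξ = ψ := by
  have hm2 : MemLp (⇑(specId R) * specInv R) 2 (repMeasure (calculus hR) ψ) :=
    hm.of_le_mul (c := ‖specId R‖) ((specId R).continuous.aestronglyMeasurable.mul hm.1)
      (ae_of_all _ fun x => by
        rw [Pi.mul_apply, norm_mul]
        exact mul_le_mul_of_nonneg_right ((specId R).norm_coe_le_norm x) (norm_nonneg _))
  have h1 := h.rep hm (specId R)
  have h2 := (h1.sub hm2 (memLp_continuousMap (1 : C(spectrum ℝ R, ℝ)) _ 2)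
    (isRepLimit_continuousMap (calculus hR) 1 ψ))
  have hm3 := hm2.sub (memLp_continuousMap (1 : C(spectrum ℝ R, ℝ))
    (repMeasure (calculus hR) ψ) 2)
  have h3 := h2.rep hm3 (specId R)
  have e : ⇑(specId R) * (⇑(specId R) * specInv R - ⇑(1 : C(spectrum ℝ R, ℝ)))
      = ⇑(0 : C(spectrum ℝ R, ℝ)) := by
    funext x
    change (x : ℝ) * ((x : ℝ) * (x : ℝ)⁻¹ - 1) = 0
    by_cases hx : (x : ℝ) = 0
    · rw [hx, zero_mul]
    · rw [mul_inv_cancel₀ hx, sub_self, mul_zero]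
  rw [e] at h3
  have h4 := h3.unique (memLp_continuousMap 0 _ 2) (isRepLimit_continuousMap (calculus hR) 0 ψ)
  rw [calculus_specId, map_one, map_zero, one_apply_eq_self, zero_apply, ← map_zero R] at h4
  exact sub_eq_zero.1 (hinj h4)

theorem memLp_specInv_iff (hinj : Function.Injective R) (ψ : H) :
    MemLp (specInv R) 2 (repMeasure (calculus hR) ψ) ↔ ∃ ξ, R ξ = ψ := by
  constructor
  · intro hm
    obtain ⟨ξ, hξ⟩ := exists_isRepLimit (calculus hR) hm
    exact ⟨ξ, apply_eq_of_isRepLimit_specInv hR hinj hm hξ⟩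
  · rintro ⟨ξ, rfl⟩
    exact memLp_specInv hR ξ

include hR in
/-- The spectral theorem: an operator which has a bounded, self-adjoint resolvent has a spectral
measure. -/
theorem exists_isSpectralMeasureOf (hinj : Function.Injective R) (lam : ℝ) (T : H →ₗ.[ℂ] H)
    (hT : ∀ ψ η, (ψ, η) ∈ T.graph ↔ R (η + (lam : ℂ) • ψ) = ψ) :
    ∃ P : PVM H, P.IsSpectralMeasureOf T := by
  have hh : Measurable fun x => specInv R x - lam := measurable_specInv.sub_const _
  refine ⟨repPVM (calculus hR) hh, ?_, ?_⟩
  · intro ψ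
    have hdom : ψ ∈ T.domain ↔ ∃ ξ, R ξ = ψ := by
      rw [LinearPMap.mem_domain_iff]
      constructor
      · rintro ⟨η, h⟩
        exact ⟨_, (hT _ _).1 h⟩
      · rintro ⟨ξ, h⟩
        exact ⟨ξ - (lam : ℂ) • ψ, (hT _ _).2 (by rw [sub_add_cancel, h])⟩
    have hc : MemLp (fun _ : spectrum ℝ R => lam) 2 (repMeasure (calculus hR) ψ) :=
      memLp_const lam
    have hm : MemLp (specInv R) 2 (repMeasure (calculus hR) ψ) ↔
        MemLp (fun x => specInv R x - lam) 2 (repMeasure (calculus hR) ψ) :=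
      ⟨fun h => h.sub hc, 
        fun h => (h.add hc).ae_eq (ae_of_all _ fun x => sub_add_cancel _ _)⟩
    rw [hdom, ← memLp_specInv_iff hR hinj, hm, scalarMeasure_repPVM,
      lintegral_map (by fun_prop) hh,
      memLp_two_iff_integrable_sq hh.aestronglyMeasurable]
    rw [Integrable, hasFiniteIntegral_iff_ofReal (ae_of_all _ fun x => sq_nonneg _)]
    exact and_iff_right (hh.pow_const 2).aestronglyMeasurable
  · rintro ⟨ψ, hψ⟩
    have hg : (ψ, T ⟨ψ, hψ⟩) ∈ T.graph := T.mem_graph ⟨ψ, hψ⟩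
    have hr := (hT _ _).1 hg
    set ξ := T ⟨ψ, hψ⟩ + (lam : ℂ) • ψ with hξ
    have hm := (memLp_specInv_iff hR hinj ψ).2 ⟨ξ, hr⟩
    obtain ⟨ξ', hξ'⟩ := exists_isRepLimit (calculus hR) hm
    have e : ξ' = ξ := hinj ((apply_eq_of_isRepLimit_specInv hR hinj hm hξ').trans hr.symm)
    rw [e] at hξ'
    have hT' : T ⟨ψ, hψ⟩ = ξ - (lam : ℂ) • ψ := (add_sub_cancel_right _ _).symm
    have h1 : ⟪ψ, ξ⟫_ℂ = ((∫ x, specInv R x ∂(repMeasure (calculus hR) ψ) : ℝ) : ℂ) :=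
      Complex.ext (by rw [hξ'.re_inner hm, Complex.ofReal_re])
        (by rw [hξ'.inner_im hm, Complex.ofReal_im])
    have h2 : (repMeasure (calculus hR) ψ).real Set.univ = ‖ψ‖ ^ 2 := by
      have := integral_repMeasure (calculus hR) 1 ψ
      rw [map_one, one_apply_eq_self] at this
      rw [norm_sq_eq_re_inner (𝕜 := ℂ) ψ]
      refine Eq.trans ?_ this
      simp
    change ⟪ψ, T ⟨ψ, hψ⟩⟫_ℂ = _
    rw [scalarMeasure_repPVM, integral_map hh.aemeasurable (by fun_prop),
      integral_sub (hm.integrable (by norm_num)) (integrable_const _), integral_const, h2, hT',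
      inner_sub_right, h1, inner_smul_right, inner_self_eq_norm_sq_to_K]
    simp [mul_comm]

end Resolvent

/-! ### Spectral subspaces -/

section SpectralSubspace

variable {T : H →ₗ.[ℂ] H} {P : PVM H} (hP : P.IsSpectralMeasureOf T)

theorem PVM.scalarMeasure_apply (P : PVM H) (ψ : H) {S : Set ℝ} (hS : MeasurableSet S) :
    P.scalarMeasure ψ S = ENNReal.ofReal (‖P.toFun S ψ‖ ^ 2) := by
  rw [PVM.scalarMeasure, Measure.ofMeasurable_apply _ hS, P.inner_self hS]

instance (P : PVM H) (ψ : H) : IsFiniteMeasure (P.scalarMeasure ψ) := by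
  refine ⟨?_⟩
  rw [P.scalarMeasure_apply ψ MeasurableSet.univ]
  exact ENNReal.ofReal_lt_top

theorem PVM.real_scalarMeasure_univ (P : PVM H) (ψ : H) :
    (P.scalarMeasure ψ).real Set.univ = ‖ψ‖ ^ 2 := by
  rw [Measure.real, P.scalarMeasure_apply ψ MeasurableSet.univ, P.univ, one_apply_eq_self,
    ENNReal.toReal_ofReal (by positivity)]

theorem PVM.apply_apply (P : PVM H) {S U : Set ℝ} (hS : MeasurableSet S) (hU : MeasurableSet U)
    (ψ : H) : P.toFun S (P.toFun U ψ) = P.toFun (S ∩ U) ψ := by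
  rw [P.inter S U hS hU, mul_apply_eq_comp]

theorem PVM.inner_apply_left (P : PVM H) {S : Set ℝ} (hS : MeasurableSet S) (φ ψ : H) :
    ⟪P.toFun S φ, ψ⟫_ℂ = ⟪φ, P.toFun S ψ⟫_ℂ :=
  ContinuousLinearMap.isSelfAdjoint_iff_isSymmetric.1
    (P.isStarProjection S hS).isSelfAdjoint φ ψ

theorem PVM.scalarMeasure_proj (P : PVM H) {U : Set ℝ} (hU : MeasurableSet U) (ψ : H) :
    P.scalarMeasure (P.toFun U ψ) = (P.scalarMeasure ψ).restrict U := by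
  ext S hS
  rw [Measure.restrict_apply hS, P.scalarMeasure_apply _ hS,
    P.scalarMeasure_apply _ (hS.inter hU), P.apply_apply hS hU]

/-- Spectral measures of vectors from complementary spectral subspaces add up. -/
theorem PVM.scalarMeasure_add (P : PVM H) {U : Set ℝ} (hU : MeasurableSet U) {φ ψ : H}
    (hφ : P.toFun U φ = 0) (hψ : P.toFun U ψ = ψ) :
    P.scalarMeasure (φ + ψ) = P.scalarMeasure φ + P.scalarMeasure ψ := by
  ext S hS
  rw [Measure.add_apply, P.scalarMeasure_apply _ hS, P.scalarMeasure_apply _ hS,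
    P.scalarMeasure_apply _ hS, ← ENNReal.ofReal_add (by positivity) (by positivity)]
  congr 1
  have h0 : ⟪P.toFun S φ, P.toFun S ψ⟫_ℂ = 0 := by
    rw [← hψ, P.apply_apply hS hU, Set.inter_comm, ← P.apply_apply hU hS, ← P.inner_apply_left hU,
      P.apply_apply hU hS, Set.inter_comm, ← P.apply_apply hS hU, hφ, map_zero, inner_zero_left]
  rw [map_add, norm_add_sq (𝕜 := ℂ), h0]
  simp

include hP in
-- Polarization: the definition of a spectral measure determines only the diagonal of the form, but
-- makes it real. Evaluation at `φ + ψ` and `φ + iψ` recovers symmetry.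
theorem PVM.IsSpectralMeasureOf.symm (φ ψ : T.domain) :
    ⟪(φ : H), T ψ⟫_ℂ = ⟪T φ, (ψ : H)⟫_ℂ := by
  have hq : ∀ χ : T.domain, ⟪(χ : H), T χ⟫_ℂ = ⟪T χ, (χ : H)⟫_ℂ := by
    intro χ
    rw [← inner_conj_symm (T χ), hP.inner_apply, Complex.conj_ofReal]
  have h1 := hq (φ + ψ)
  have h2 := hq (φ + Complex.I • ψ)
  simp only [LinearPMap.map_add, LinearPMap.map_smul, Submodule.coe_add, Submodule.coe_smul,
    inner_add_left, inner_add_right, inner_smul_left, inner_smul_right, hq φ, hq ψ,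
    Complex.conj_I] at h1 h2
  linear_combination (1 / 2 : ℂ) * h1 + (-Complex.I / 2) * h2
    - (1 / 2 : ℂ) * (⟪(ψ : H), T φ⟫_ℂ - ⟪(φ : H), T ψ⟫_ℂ - ⟪T ψ, (φ : H)⟫_ℂ + ⟪T φ, (ψ : H)⟫_ℂ)
      * Complex.I_sq

include hP in
theorem PVM.IsSpectralMeasureOf.integrable {ψ : H} (hψ : ψ ∈ T.domain) :
    Integrable (fun t => t) (P.scalarMeasure ψ) := by
  have h := (hP.mem_domain_iff ψ).1 hψ
  have h2 : MemLp (fun t : ℝ => t) 2 (P.scalarMeasure ψ) := by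
    rw [memLp_two_iff_integrable_sq (by fun_prop), Integrable,
      hasFiniteIntegral_iff_ofReal (ae_of_all _ fun x => sq_nonneg _)]
    exact ⟨by fun_prop, h⟩
  exact h2.integrable (by norm_num)

include hP in
theorem PVM.IsSpectralMeasureOf.mem_domain_proj (E r : ℝ) (ψ : H) :
    P.toFun (Set.Ioo (E - r) (E + r)) ψ ∈ T.domain := by
  rw [hP.mem_domain_iff, P.scalarMeasure_proj measurableSet_Ioo]
  refine (setLIntegral_mono (g := fun _ => ENNReal.ofReal ((|E| + |r|) ^ 2)) (by fun_prop)
    fun t ht => ENNReal.ofReal_le_ofReal ?_).trans_lt ?_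
  · rw [← sq_abs t]
    refine pow_le_pow_left₀ (abs_nonneg _) (abs_le.2 ⟨?_, ?_⟩) 2
    · linarith [ht.1, neg_abs_le E, le_abs_self r]
    · linarith [ht.2, le_abs_self E, le_abs_self r]
  · rw [setLIntegral_const]
    exact ENNReal.mul_lt_top ENNReal.ofReal_lt_top (measure_lt_top _ _)

include hP in
theorem PVM.IsSpectralMeasureOf.abs_form_sub_le {E r : ℝ} {ψ : T.domain}
    (hψ : P.toFun (Set.Ioo (E - r) (E + r)) (ψ : H) = ψ) :
    |(⟪(ψ : H), T ψ⟫_ℂ).re - E * ‖(ψ : H)‖ ^ 2| ≤ r * ‖(ψ : H)‖ ^ 2 := by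
  have hμ := P.scalarMeasure_proj (U := Set.Ioo (E - r) (E + r)) measurableSet_Ioo (ψ : H)
  rw [hψ] at hμ
  have h1 : (⟪(ψ : H), T ψ⟫_ℂ).re - E * ‖(ψ : H)‖ ^ 2
      = ∫ t, (t - E) ∂(P.scalarMeasure (ψ : H)) := by
    rw [integral_sub (hP.integrable ψ.2) (integrable_const _), integral_const,
      P.real_scalarMeasure_univ, hP.inner_apply, Complex.ofReal_re, smul_eq_mul, mul_comm E]
  rw [h1, ← Real.norm_eq_abs, ← P.real_scalarMeasure_univ]
  refine norm_integral_le_of_norm_le_const ?_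
  rw [hμ]
  filter_upwards [ae_restrict_mem measurableSet_Ioo] with t ht
  rw [Real.norm_eq_abs, abs_le]
  exact ⟨by linarith [ht.1], by linarith [ht.2]⟩

include hP in
-- Scalar measures of vectors from complementary spectral subspaces add, so the diagonal form is
-- additive on `φ + ψ` and its cross terms, twice this real part, must vanish.
theorem PVM.IsSpectralMeasureOf.re_inner_eq_zero {U : Set ℝ} (hU : MeasurableSet U)
    {φ ψ : T.domain} (hφ : P.toFun U (φ : H) = 0) (hψ : P.toFun U (ψ : H) = ψ) :
    (⟪(φ : H), T ψ⟫_ℂ).re = 0 := by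
  have h1 := hP.inner_apply (φ + ψ)
  rw [Submodule.coe_add, P.scalarMeasure_add hU hφ hψ,
    integral_add_measure (hP.integrable φ.2) (hP.integrable ψ.2), Complex.ofReal_add,
    ← hP.inner_apply, ← hP.inner_apply, LinearPMap.map_add, inner_add_left, inner_add_right,
    inner_add_right, hP.symm ψ φ, ← inner_conj_symm (T ψ)] at h1
  have h2 := congrArg Complex.re h1
  simp only [Complex.add_re, Complex.conj_re] at h2
  linarith

include hP in
/-- On the spectral subspace of an interval of radius `r` about `E`, `T` differs from `E` by at
most `r`. -/
theorem PVM.IsSpectralMeasureOf.norm_sub_le (hd : Dense (T.domain : Set H)) {E r : ℝ} (hr : 0 < r)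
    {ψ : T.domain} (hψ : P.toFun (Set.Ioo (E - r) (E + r)) (ψ : H) = ψ) :
    ‖T ψ - (E : ℂ) • (ψ : H)‖ ≤ r * ‖(ψ : H)‖ := by
  set U := Set.Ioo (E - r) (E + r) with hU
  have hUm : MeasurableSet U := measurableSet_Ioo
  set η := T ψ - (E : ℂ) • (ψ : H) with hη
  -- Duality replaces a formula for `‖T ψ‖`. Only the spectral component `φ₁` of `φ` pairs with `η`,
  -- and the form bounds at `φ₁ + ψ` and `φ₁ - ψ` polarize to this estimate.
  have hdom : ∀ φ : T.domain, (⟪(φ : H), η⟫_ℂ).re ≤ r / 2 * (‖(φ : H)‖ ^ 2 + ‖(ψ : H)‖ ^ 2) := by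
    intro φ
    let φ₁ : T.domain := ⟨P.toFun U (φ : H), hP.mem_domain_proj E r _⟩
    have hφ₁ : P.toFun U (φ₁ : H) = φ₁ := by
      change P.toFun U (P.toFun U (φ : H)) = P.toFun U (φ : H)
      rw [P.apply_apply hUm hUm, Set.inter_self]
    have hφ₂ : P.toFun U ((φ - φ₁ : T.domain) : H) = 0 := by
      rw [Submodule.coe_sub, map_sub, hφ₁, sub_self]
    have h1 := hP.re_inner_eq_zero hUm hφ₂ hψ
    have h2 : ⟪((φ - φ₁ : T.domain) : H), (ψ : H)⟫_ℂ = 0 := by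
      rw [← hψ, ← P.inner_apply_left hUm, hφ₂, inner_zero_left]
    have h3 : (⟪(φ : H), η⟫_ℂ).re = (⟪(φ₁ : H), η⟫_ℂ).re := by
      rw [Submodule.coe_sub, inner_sub_left] at h1 h2
      rw [hη, inner_sub_right, inner_sub_right, inner_smul_right, inner_smul_right,
        sub_eq_zero.1 h2]
      simp only [Complex.sub_re] at h1 ⊢
      linarith
    have h4 := hP.abs_form_sub_le (ψ := φ₁ + ψ) (E := E) (r := r) (by
      rw [Submodule.coe_add, map_add, hφ₁, hψ])
    have h5 := hP.abs_form_sub_le (ψ := φ₁ - ψ) (E := E) (r := r) (by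
      rw [Submodule.coe_sub, map_sub, hφ₁, hψ])
    have hn : ‖(φ₁ : H)‖ ^ 2 ≤ ‖(φ : H)‖ ^ 2 := by
      have h6 : (φ : H) = (φ₁ : H) + ((φ - φ₁ : T.domain) : H) := by
        rw [Submodule.coe_sub, add_sub_cancel]
      have h7 : ⟪(φ₁ : H), ((φ - φ₁ : T.domain) : H)⟫_ℂ = 0 := by
        rw [← hφ₁, P.inner_apply_left hUm, hφ₂, inner_zero_right]
      rw [h6, norm_add_sq (𝕜 := ℂ), h7]
      simp only [map_zero, mul_zero, add_zero]
      have := sq_nonneg ‖((φ - φ₁ : T.domain) : H)‖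
      linarith
    have hs : ⟪(ψ : H), T φ₁⟫_ℂ = starRingEnd ℂ ⟪(φ₁ : H), T ψ⟫_ℂ := by
      rw [hP.symm ψ φ₁, inner_conj_symm]
    have hs' : ⟪(ψ : H), (φ₁ : H)⟫_ℂ = starRingEnd ℂ ⟪(φ₁ : H), (ψ : H)⟫_ℂ :=
      (inner_conj_symm _ _).symm
    rw [h3, hη, inner_sub_right, inner_smul_right, Complex.sub_re, Complex.re_ofReal_mul]
    rw [LinearPMap.map_add, Submodule.coe_add, norm_add_sq (𝕜 := ℂ), inner_add_left,
      inner_add_right, inner_add_right, hs] at h4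
    rw [LinearPMap.map_sub, Submodule.coe_sub, norm_sub_sq (𝕜 := ℂ), inner_sub_left,
      inner_sub_right, inner_sub_right, hs] at h5
    have h8 := (abs_le.1 h4).2
    have h9 := (abs_le.1 h5).1
    simp only [Complex.add_re, Complex.sub_re, Complex.conj_re, RCLike.re_eq_complex_re]
      at h8 h9
    nlinarith [hn, hr]
  have hall : ∀ φ : H, (⟪φ, η⟫_ℂ).re ≤ r / 2 * (‖φ‖ ^ 2 + ‖(ψ : H)‖ ^ 2) := by
    have hc : IsClosed {φ : H | (⟪φ, η⟫_ℂ).re ≤ r / 2 * (‖φ‖ ^ 2 + ‖(ψ : H)‖ ^ 2)} :=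
      isClosed_le (by fun_prop) (by fun_prop)
    intro φ
    exact hc.closure_subset_iff.2 (fun χ hχ => hdom ⟨χ, hχ⟩) (hd φ)
  -- The factor `r⁻¹` is the scaling for which the two terms on the right balance; it yields `r⁻¹
  -- ‖η‖² ≤ r ‖ψ‖²`.
  have h := hall (((r⁻¹ : ℝ) : ℂ) • η)
  rw [inner_smul_left, Complex.conj_ofReal, Complex.re_ofReal_mul, norm_smul, Complex.norm_real,
    Real.norm_of_nonneg (inv_nonneg.2 hr.le)] at h
  have h0 : (⟪η, η⟫_ℂ).re = ‖η‖ ^ 2 := (norm_sq_eq_re_inner (𝕜 := ℂ) η).symm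
  rw [h0] at h
  have h1 : r / 2 * ((r⁻¹ * ‖η‖) ^ 2 + ‖(ψ : H)‖ ^ 2)
      = r⁻¹ / 2 * ‖η‖ ^ 2 + r / 2 * ‖(ψ : H)‖ ^ 2 := by
    field_simp
  rw [h1] at h
  have h2 : ‖η‖ ^ 2 ≤ (r * ‖(ψ : H)‖) ^ 2 := by
    have h3 : r⁻¹ * ‖η‖ ^ 2 ≤ r * ‖(ψ : H)‖ ^ 2 := by linarith
    have h4 := mul_le_mul_of_nonneg_left h3 hr.le
    rw [← mul_assoc, mul_inv_cancel₀ hr.ne', one_mul] at h4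
    linarith [h4, mul_pow r ‖(ψ : H)‖ 2]
  exact le_of_sq_le_sq h2 (by positivity)

end SpectralSubspace

end SpectralMeasure

/-! ### Cutoff functions -/

/-- Smooth functions on the plane, equal to `1` near the origin, which are bounded together with
their derivatives of order at most two. -/
structure IsCutoff (m : ℝ × ℝ → ℂ) : Prop where
  smooth : ContDiff ℝ ∞ m
  bdd : ∃ C, ∀ q, ‖m q‖ ≤ C
  bdd_pd : ∀ v, ∃ C, ∀ q, ‖pd v m q‖ ≤ C
  bdd_pd_pd : ∀ v w, ∃ C, ∀ q, ‖pd v (pd w m) q‖ ≤ C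
  eq_one : ∀ᶠ q in 𝓝 0, m q = 1

/-- The rescaled function `q ↦ m (q / (n + 1))`. -/
def scaled (m : ℝ × ℝ → ℂ) (n : ℕ) (q : ℝ × ℝ) : ℂ := m (((n : ℝ) + 1)⁻¹ • q)

theorem contDiff_scaled {m : ℝ × ℝ → ℂ} (hm : ContDiff ℝ ∞ m) (n : ℕ) :
    ContDiff ℝ ∞ (scaled m n) := hm.comp (contDiff_const_smul _)

theorem pd_scaled {m : ℝ × ℝ → ℂ} (hm : ContDiff ℝ ∞ m) (v : ℝ × ℝ) (n : ℕ) :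
    pd v (scaled m n) = ((((n : ℝ) + 1)⁻¹ : ℝ) : ℂ) • scaled (pd v m) n := by
  funext q
  have h : HasFDerivAt (scaled m n)
      ((fderiv ℝ m (((n : ℝ) + 1)⁻¹ • q)).comp (((n : ℝ) + 1)⁻¹ • .id ℝ (ℝ × ℝ))) q :=
    ((hm.differentiable (by simp)) _).hasFDerivAt.comp q
      (((n : ℝ) + 1)⁻¹ • ContinuousLinearMap.id ℝ (ℝ × ℝ)).hasFDerivAt
  rw [pd, h.fderiv]
  simp [scaled, pd, mul_left_comm]

namespace IsCutoff

variable {m : ℝ × ℝ → ℂ} (hm : IsCutoff m)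
include hm

theorem isBddMeas_scaled (n : ℕ) : IsBddMeas (scaled m n) := by
  obtain ⟨C, hC⟩ := hm.bdd
  exact ⟨(contDiff_scaled hm.smooth n).continuous.measurable, C, fun q => hC _⟩

theorem norm_pd_scaled_le (v : ℝ × ℝ) :
    ∃ C, ∀ n q, ‖pd v (scaled m n) q‖ ≤ C * ((n : ℝ) + 1)⁻¹ := by
  obtain ⟨C, hC⟩ := hm.bdd_pd v
  refine ⟨C, fun n q => ?_⟩
  rw [pd_scaled hm.smooth, Pi.smul_apply, norm_smul, Complex.norm_real,
    Real.norm_of_nonneg (by positivity), mul_comm]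
  exact mul_le_mul_of_nonneg_right (hC _) (by positivity)

theorem norm_pd_pd_scaled_le (v w : ℝ × ℝ) :
    ∃ C, ∀ n q, ‖pd v (pd w (scaled m n)) q‖ ≤ C * ((n : ℝ) + 1)⁻¹ := by
  obtain ⟨C, hC⟩ := hm.bdd_pd_pd v w
  refine ⟨C, fun n q => ?_⟩
  have hC0 : 0 ≤ C := (norm_nonneg _).trans (hC 0)
  rw [pd_scaled hm.smooth, pd_const_smul (contDiff_scaled (contDiff_pd hm.smooth w) n),
    pd_scaled (contDiff_pd hm.smooth w), Pi.smul_apply, Pi.smul_apply, norm_smul, norm_smul,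
    Complex.norm_real, Real.norm_of_nonneg (by positivity)]
  have h1 : ((n : ℝ) + 1)⁻¹ ≤ 1 := inv_le_one_of_one_le₀ (by linarith [n.cast_nonneg (α := ℝ)])
  have h2 : (0 : ℝ) ≤ ((n : ℝ) + 1)⁻¹ := by positivity
  calc ((n : ℝ) + 1)⁻¹ * (((n : ℝ) + 1)⁻¹ * ‖scaled (pd v (pd w m)) n q‖)
      ≤ 1 * (((n : ℝ) + 1)⁻¹ * C) := by
        gcongr
        exact hC _
    _ = _ := by ring

theorem isBddMeas_pd_scaled (v : ℝ × ℝ) (n : ℕ) : IsBddMeas (pd v (scaled m n)) := by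
  obtain ⟨C, hC⟩ := hm.norm_pd_scaled_le v
  exact ⟨(contDiff_pd (contDiff_scaled hm.smooth n) v).continuous.measurable, _, hC n⟩

theorem isBddMeas_pd_pd_scaled (v w : ℝ × ℝ) (n : ℕ) :
    IsBddMeas (pd v (pd w (scaled m n))) := by
  obtain ⟨C, hC⟩ := hm.norm_pd_pd_scaled_le v w
  exact ⟨(contDiff_pd (contDiff_pd (contDiff_scaled hm.smooth n) w) v).continuous.measurable, _,
    hC n⟩

theorem eventually_scaled_eq_one (q : ℝ × ℝ) : ∀ᶠ n : ℕ in atTop, scaled m n q = 1 := by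
  have h : Tendsto (fun n : ℕ => ((n : ℝ) + 1)⁻¹ • q) atTop (𝓝 ((0 : ℝ) • q)) := by
    refine Tendsto.smul_const ?_ q
    simpa using tendsto_one_div_add_atTop_nhds_zero_nat (𝕜 := ℝ)
  rw [zero_smul] at h
  exact h.eventually hm.eq_one

theorem tendsto_mulL2_scaled (u : L2Plane) :
    Tendsto (fun n => mulL2 (scaled m n) (hm.isBddMeas_scaled n) u) atTop (𝓝 u) := by
  obtain ⟨C, hC⟩ := hm.bdd
  have h1 : IsBddMeas fun _ => 1 := ⟨measurable_const, 1, by simp⟩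
  have h2 : mulL2 (fun _ => 1) h1 u = u := by
    refine Lp.ext ?_
    filter_upwards [coeFn_mulL2 h1 u] with q hq
    rw [hq, Pi.mul_apply, one_mul]
  have := tendsto_mulL2 hm.isBddMeas_scaled h1 (fun n q => hC _)
    (fun q => tendsto_const_nhds.congr' <| by
      filter_upwards [hm.eventually_scaled_eq_one q] with n hn
      exact hn.symm) u
  rwa [h2] at this

theorem tendsto_mulL2_pd_scaled (v : ℝ × ℝ) (u : L2Plane) :
    Tendsto (fun n => mulL2 (pd v (scaled m n)) (hm.isBddMeas_pd_scaled v n) u) atTop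
      (𝓝 0) := by
  obtain ⟨C, hC⟩ := hm.norm_pd_scaled_le v
  refine squeeze_zero_norm (fun n => norm_mulL2_le _ (hC n) u) ?_
  have := (tendsto_one_div_add_atTop_nhds_zero_nat (𝕜 := ℝ)).const_mul C |>.mul_const ‖u‖
  simpa using this

theorem tendsto_mulL2_pd_pd_scaled (v w : ℝ × ℝ) (u : L2Plane) :
    Tendsto (fun n => mulL2 (pd v (pd w (scaled m n))) (hm.isBddMeas_pd_pd_scaled v w n) u) atTop
      (𝓝 0) := by
  obtain ⟨C, hC⟩ := hm.norm_pd_pd_scaled_le v w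
  refine squeeze_zero_norm (fun n => norm_mulL2_le _ (hC n) u) ?_
  have := (tendsto_one_div_add_atTop_nhds_zero_nat (𝕜 := ℝ)).const_mul C |>.mul_const ‖u‖
  simpa using this

end IsCutoff

theorem hasCompactSupport_pd {m : ℝ × ℝ → ℂ} (hs : HasCompactSupport m) (v : ℝ × ℝ) :
    HasCompactSupport (pd v m) := (hs.fderiv_apply ℝ v).mul_left

theorem exists_isCutoff_hasCompactSupport : ∃ m, IsCutoff m ∧ HasCompactSupport m := by
  let b : ContDiffBump (0 : ℝ × ℝ) := ⟨1, 2, one_pos, one_lt_two⟩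
  have hs : ContDiff ℝ ∞ fun q => (b q : ℂ) := Complex.ofRealCLM.contDiff.comp b.contDiff
  have hc : HasCompactSupport fun q => (b q : ℂ) :=
    b.hasCompactSupport.comp_left (g := Complex.ofReal) rfl
  refine ⟨fun q => b q, ⟨hs, hc.exists_bound_of_continuous hs.continuous, fun v =>
    (hasCompactSupport_pd hc v).exists_bound_of_continuous (contDiff_pd hs v).continuous,
    fun v w => (hasCompactSupport_pd (hasCompactSupport_pd hc w) v).exists_bound_of_continuous
      (contDiff_pd (contDiff_pd hs w) v).continuous, ?_⟩, hc⟩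
  filter_upwards [b.eventuallyEq_one] with q hq
  rw [hq, Pi.one_apply, Complex.ofReal_one]

theorem hasCompactSupport_scaled {m : ℝ × ℝ → ℂ} (hs : HasCompactSupport m) (n : ℕ) :
    HasCompactSupport (scaled m n) :=
  hs.comp_homeomorph (Homeomorph.smulOfNeZero (((n : ℝ) + 1)⁻¹) (by positivity))

theorem pd_comp_linear {f : ℝ → ℂ} (hf : ContDiff ℝ ∞ f) (L : ℝ × ℝ →L[ℝ] ℝ) (v : ℝ × ℝ) :
    pd v (fun q => f (L q)) = fun q => (-Complex.I * L v) * deriv f (L q) := by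
  funext q
  have h : HasFDerivAt (fun q => f (L q)) (_ : ℝ × ℝ →L[ℝ] ℂ) q :=
    (((hf.differentiable (by simp)) (L q)).hasFDerivAt).comp q L.hasFDerivAt
  rw [pd, h.fderiv]
  simp only [ContinuousLinearMap.comp_apply, mul_assoc]
  congr 1
  rw [← fderiv_apply_one_eq_deriv]
  simp

/-- Cutoff functions of one linear coordinate. -/
theorem isCutoff_comp_linear {f : ℝ → ℂ} (hf : ContDiff ℝ ∞ f) (hs : HasCompactSupport f)
    (h1 : ∀ᶠ t in 𝓝 0, f t = 1) (L : ℝ × ℝ →L[ℝ] ℝ) : IsCutoff fun q => f (L q) := by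
  have hd : ContDiff ℝ ∞ (deriv f) := (contDiff_infty_iff_deriv.1 hf).2
  have hdd : ContDiff ℝ ∞ (deriv (deriv f)) := (contDiff_infty_iff_deriv.1 hd).2
  obtain ⟨C, hC⟩ := hs.exists_bound_of_continuous hf.continuous
  obtain ⟨C', hC'⟩ := hs.deriv.exists_bound_of_continuous hd.continuous
  obtain ⟨C'', hC''⟩ := hs.deriv.deriv.exists_bound_of_continuous hdd.continuous
  refine ⟨hf.comp L.contDiff, ⟨C, fun q => hC _⟩, fun v => ⟨‖-Complex.I * L v‖ * C', fun q => ?_⟩,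
    fun v w => ⟨‖(-Complex.I * L w) * (-Complex.I * L v)‖ * C'', fun q => ?_⟩, ?_⟩
  · rw [pd_comp_linear hf, norm_mul]
    exact mul_le_mul_of_nonneg_left (hC' _) (norm_nonneg _)
  · have e : pd w (fun q => f (L q)) = (-Complex.I * L w : ℂ) • fun q => deriv f (L q) :=
      pd_comp_linear hf L w
    rw [e, pd_const_smul (φ := fun q => deriv f (L q)) (hd.comp L.contDiff), pd_comp_linear hd,
      Pi.smul_apply, smul_eq_mul, ← mul_assoc, norm_mul]
    exact mul_le_mul_of_nonneg_left (hC'' _) (norm_nonneg _)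
  · have : Tendsto L (𝓝 0) (𝓝 0) := by simpa using L.continuous.tendsto 0
    exact this.eventually h1

theorem exists_bump_line : ∃ f : ℝ → ℂ, ContDiff ℝ ∞ f ∧ HasCompactSupport f ∧
    (∀ᶠ t in 𝓝 0, f t = 1) ∧ (∀ t, 2 ≤ |t| → f t = 0) ∧ ∀ t, ‖f t‖ ≤ 1 := by
  let b : ContDiffBump (0 : ℝ) := ⟨1, 2, one_pos, one_lt_two⟩
  refine ⟨fun t => (b t : ℂ), Complex.ofRealCLM.contDiff.comp b.contDiff,
    b.hasCompactSupport.comp_left (g := Complex.ofReal) rfl, ?_, fun t ht => ?_, fun t => ?_⟩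
  · filter_upwards [b.eventuallyEq_one] with q hq
    rw [hq, Pi.one_apply, Complex.ofReal_one]
  · change (b t : ℂ) = 0
    rw [b.zero_of_le_dist (by simpa using ht), Complex.ofReal_zero]
  · rw [Complex.norm_real, Real.norm_of_nonneg b.nonneg]
    exact b.le_one

theorem kinX_mul (B : ℝ) {m f : ℝ × ℝ → ℂ} (hm : ContDiff ℝ ∞ m) (hf : ContDiff ℝ ∞ f) :
    kinX B (m * f) = m * kinX B f + pd (1, 0) m * f := by
  rw [kinX_eq, kinX_eq, pd_mul hm hf]
  ring

theorem kinX_add (B : ℝ) {f g : ℝ × ℝ → ℂ} (hf : ContDiff ℝ ∞ f) (hg : ContDiff ℝ ∞ g) :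
    kinX B (f + g) = kinX B f + kinX B g := by
  rw [kinX_eq, kinX_eq, kinX_eq, pd_add hf hg]
  ring

theorem kinX_const_smul (B : ℝ) {f : ℝ × ℝ → ℂ} (hf : ContDiff ℝ ∞ f) (c : ℂ) :
    kinX B (c • f) = c • kinX B f := by
  rw [kinX_eq, kinX_eq, pd_const_smul hf, smul_add, mul_smul_comm]

/-! ### Landau levels -/

section Ladder

variable {M : Type*} [AddCommGroup M] [Module ℂ M] {a b : M →ₗ[ℂ] M} {c : ℂ}

theorem ladder_apply_pow (h : ∀ w, a (b w) = b (a w) + c • w) {v : M} (hv : a v = 0) (k : ℕ) :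
    a ((b ^ (k + 1)) v) = (((k : ℂ) + 1) * c) • (b ^ k) v := by
  induction k with
  | zero => simp [h, hv]
  | succ k ih =>
    rw [pow_succ', Module.End.mul_apply, h, ih, map_smul, ← Module.End.mul_apply, ← pow_succ',
      ← add_smul]
    congr 1
    push_cast
    ring

theorem ladder_number (h : ∀ w, a (b w) = b (a w) + c • w) {v : M} (hv : a v = 0) (k : ℕ) :
    b (a ((b ^ k) v)) = ((k : ℂ) * c) • (b ^ k) v := by
  cases k with
  | zero => simp [hv]
  | succ k =>
    rw [ladder_apply_pow h hv, map_smul, ← Module.End.mul_apply, ← pow_succ']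
    push_cast
    rfl

theorem ladder_pow_pow (h : ∀ w, a (b w) = b (a w) + c • w) {v : M} (hv : a v = 0) (n : ℕ) :
    (a ^ n) ((b ^ n) v) = ((n.factorial : ℂ) * c ^ n) • v := by
  induction n with
  | zero => simp
  | succ n ih =>
    rw [pow_succ a, Module.End.mul_apply, ladder_apply_pow h hv, map_smul, ih, smul_smul]
    congr 1
    rw [Nat.factorial_succ]
    push_cast
    ring

/-- If `[a, b] = c ≠ 0`, then every vector killed by a power of `a` is a sum of eigenvectors of
`b a` with eigenvalues `c j`. -/
theorem exists_ladder_decomposition (h : ∀ w, a (b w) = b (a w) + c • w) (hc : c ≠ 0) (n : ℕ) :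
    ∀ w : M, (a ^ n) w = 0 → ∃ v : ℕ → M, (∑ j ∈ Finset.range n, v j = w) ∧
      ∀ j, b (a (v j)) = ((j : ℂ) * c) • v j := by
  induction n with
  | zero =>
    intro w hw
    refine ⟨fun _ => 0, ?_, by simp⟩
    simpa [eq_comm] using hw
  | succ n ih =>
    intro w hw
    have hv : a ((a ^ n) w) = 0 := by
      rw [← Module.End.mul_apply, ← pow_succ', hw]
    have hne : (n.factorial : ℂ) * c ^ n ≠ 0 :=
      mul_ne_zero (Nat.cast_ne_zero.2 n.factorial_ne_zero) (pow_ne_zero _ hc)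
    -- This is the component at the top level `n`: `aⁿ bⁿ` acts on the kernel of `a` as `n! cⁿ`, so
    -- subtracting `u` leaves a vector killed by `aⁿ`.
    set u : M := ((n.factorial : ℂ) * c ^ n)⁻¹ • (b ^ n) ((a ^ n) w) with hu
    have hu1 : (a ^ n) (w - u) = 0 := by
      rw [map_sub, hu, map_smul, ladder_pow_pow h hv, smul_smul, inv_mul_cancel₀ hne, one_smul,
        sub_self]
    obtain ⟨v, hv1, hv2⟩ := ih (w - u) hu1
    refine ⟨fun j => if j = n then u else v j, ?_, fun j => ?_⟩
    · rw [Finset.sum_range_succ, if_pos rfl]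
      rw [Finset.sum_congr rfl fun j hj => if_neg (Finset.mem_range.1 hj).ne, hv1,
        sub_add_cancel]
    · by_cases hj : j = n
      · simp only [hj, if_true]
        rw [hu, map_smul, map_smul, ladder_number h hv, smul_comm]
      · simp only [hj, if_false]
        exact hv2 j

end Ladder

/-! ### Polynomials in `z` and `z̄` times a Gaussian -/

/-- `z = x + i y`. -/
def zF (q : ℝ × ℝ) : ℂ := q.1 + Complex.I * q.2

/-- `z̄ = x - i y`. -/
def zbF (q : ℝ × ℝ) : ℂ := q.1 - Complex.I * q.2

/-- The Gaussian state of the lowest Landau level. -/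
def gF (B : ℝ) (q : ℝ × ℝ) : ℂ :=
  Complex.exp (-(B / 4 : ℝ) * (q.1 ^ 2 + q.2 ^ 2) - (B / 2 : ℝ) * Complex.I * q.1 * q.2)

theorem contDiff_ofReal_fst : ContDiff ℝ ∞ fun q : ℝ × ℝ => (q.1 : ℂ) :=
  Complex.ofRealCLM.contDiff.comp contDiff_fst

theorem contDiff_ofReal_snd : ContDiff ℝ ∞ fun q : ℝ × ℝ => (q.2 : ℂ) :=
  Complex.ofRealCLM.contDiff.comp contDiff_snd

theorem contDiff_zF : ContDiff ℝ ∞ zF :=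
  contDiff_ofReal_fst.add (contDiff_const.mul contDiff_ofReal_snd)

theorem contDiff_zbF : ContDiff ℝ ∞ zbF :=
  contDiff_ofReal_fst.sub (contDiff_const.mul contDiff_ofReal_snd)

theorem contDiff_gF (B : ℝ) : ContDiff ℝ ∞ (gF B) := by
  have h1 := contDiff_ofReal_fst
  have h2 := contDiff_ofReal_snd
  exact Complex.contDiff_exp.comp (((contDiff_const.mul ((h1.pow 2).add (h2.pow 2)))).sub
    ((contDiff_const.mul h1).mul h2))

theorem hasFDerivAt_ofReal_fst (q : ℝ × ℝ) : HasFDerivAt (fun q : ℝ × ℝ => (q.1 : ℂ))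
    (Complex.ofRealCLM.comp (ContinuousLinearMap.fst ℝ ℝ ℝ)) q :=
  (Complex.ofRealCLM.comp (ContinuousLinearMap.fst ℝ ℝ ℝ)).hasFDerivAt

theorem hasFDerivAt_ofReal_snd (q : ℝ × ℝ) : HasFDerivAt (fun q : ℝ × ℝ => (q.2 : ℂ))
    (Complex.ofRealCLM.comp (ContinuousLinearMap.snd ℝ ℝ ℝ)) q :=
  (Complex.ofRealCLM.comp (ContinuousLinearMap.snd ℝ ℝ ℝ)).hasFDerivAt

theorem pd_zF (v : ℝ × ℝ) : pd v zF = fun _ => -Complex.I * (v.1 + Complex.I * v.2) := by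
  funext q
  have h : HasFDerivAt zF _ q :=
    (hasFDerivAt_ofReal_fst q).add ((hasFDerivAt_ofReal_snd q).const_mul Complex.I)
  rw [pd, h.fderiv]
  simp

theorem pd_zbF (v : ℝ × ℝ) : pd v zbF = fun _ => -Complex.I * (v.1 - Complex.I * v.2) := by
  funext q
  have h : HasFDerivAt zbF _ q :=
    (hasFDerivAt_ofReal_fst q).sub ((hasFDerivAt_ofReal_snd q).const_mul Complex.I)
  rw [pd, h.fderiv]
  simp

theorem pd_gF (B : ℝ) (v : ℝ × ℝ) : pd v (gF B) = fun q =>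
    (-Complex.I * (-(B / 2 : ℝ) * (q.1 * v.1 + q.2 * v.2)
      - (B / 2 : ℝ) * Complex.I * (q.1 * v.2 + q.2 * v.1))) * gF B q := by
  funext q
  have h1 := hasFDerivAt_ofReal_fst q
  have h2 := hasFDerivAt_ofReal_snd q
  have h : HasFDerivAt (gF B) _ q :=
    ((((h1.pow 2).add (h2.pow 2)).const_mul (-((B / 4 : ℝ) : ℂ))).sub
      ((h1.const_mul (((B / 2 : ℝ) : ℂ) * Complex.I)).mul h2)).cexp
  rw [pd, h.fderiv]
  simp [gF]
  ring

theorem contDiff_fun_pow {f : ℝ × ℝ → ℂ} (hf : ContDiff ℝ ∞ f) (k : ℕ) : ContDiff ℝ ∞ (f ^ k) :=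
  hf.pow k

theorem contDiff_zF_pow_mul (k j : ℕ) : ContDiff ℝ ∞ (zF ^ k * zbF ^ j) :=
  (contDiff_zF.pow k).mul (contDiff_zbF.pow j)

theorem pd_pow {f : ℝ × ℝ → ℂ} (hf : ContDiff ℝ ∞ f) (v : ℝ × ℝ) (k : ℕ) :
    pd v (f ^ k) = (k : ℂ) • (f ^ (k - 1) * pd v f) := by
  induction k with
  | zero =>
    funext q
    simp [pd]
  | succ k ih =>
    rw [pow_succ, pd_mul (contDiff_fun_pow hf k) hf, ih]
    cases k with
    | zero => simp
    | succ k =>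
      funext q
      simp only [Pi.add_apply, Pi.mul_apply, Pi.pow_apply, Pi.smul_apply, smul_eq_mul,
        Nat.add_sub_cancel]
      push_cast
      ring

/-- The functions `z^k z̄^j g`. -/
def landauFn (B : ℝ) (p : ℕ × ℕ) : ℝ × ℝ → ℂ := zF ^ p.1 * zbF ^ p.2 * gF B

theorem contDiff_landauFn (B : ℝ) (p : ℕ × ℕ) : ContDiff ℝ ∞ (landauFn B p) :=
  ((contDiff_zF.pow _).mul (contDiff_zbF.pow _)).mul (contDiff_gF B)

/-- The truncated subtractions `k - 1` and `j - 1` are harmless here and below, since the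
coefficients `k` and `j` vanish in those cases. -/
theorem kinX_landauFn (B : ℝ) (k j : ℕ) :
    kinX B (landauFn B (k, j)) = (-Complex.I * k) • landauFn B (k - 1, j)
      + (-Complex.I * j) • landauFn B (k, j - 1)
      + (Complex.I * (B / 2 : ℝ)) • landauFn B (k, j + 1) := by
  rw [kinX_eq, landauFn, pd_mul (contDiff_zF_pow_mul _ _) (contDiff_gF B),
    pd_mul (contDiff_fun_pow contDiff_zF _) (contDiff_fun_pow contDiff_zbF _), pd_pow contDiff_zF, pd_pow contDiff_zbF,
    pd_zF, pd_zbF, pd_gF]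
  funext q
  simp only [landauFn, magY, Pi.add_apply, Pi.mul_apply, Pi.pow_apply, Pi.smul_apply, smul_eq_mul,
    pow_succ, Complex.ofReal_mul, Complex.ofReal_div, Complex.ofReal_ofNat, Complex.ofReal_one,
    Complex.ofReal_zero]
  have hz : zbF q = q.1 - Complex.I * q.2 := rfl
  rw [show zbF q ^ j * zbF q = zbF q ^ j * (q.1 - Complex.I * q.2) by rw [← hz]]
  linear_combination (zF q ^ k * zbF q ^ j * gF B q * B * q.2) * Complex.I_sq

theorem py_landauFn (B : ℝ) (k j : ℕ) :
    py (landauFn B (k, j)) = (k : ℂ) • landauFn B (k - 1, j)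
      + (-(j : ℂ)) • landauFn B (k, j - 1)
      + (-((B / 2 : ℝ) : ℂ)) • landauFn B (k, j + 1) := by
  rw [py_eq_pd, landauFn, pd_mul (contDiff_zF_pow_mul _ _) (contDiff_gF B),
    pd_mul (contDiff_fun_pow contDiff_zF _) (contDiff_fun_pow contDiff_zbF _), pd_pow contDiff_zF, pd_pow contDiff_zbF,
    pd_zF, pd_zbF, pd_gF]
  funext q
  simp only [landauFn, Pi.add_apply, Pi.mul_apply, Pi.pow_apply, Pi.smul_apply, smul_eq_mul,
    pow_succ, Complex.ofReal_div, Complex.ofReal_ofNat, Complex.ofReal_one,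
    Complex.ofReal_zero]
  have hz : zbF q = q.1 - Complex.I * q.2 := rfl
  rw [show zbF q ^ j * zbF q = zbF q ^ j * (q.1 - Complex.I * q.2) by rw [← hz]]
  linear_combination (-(k : ℂ) * zF q ^ (k - 1) * zbF q ^ j * gF B q
    + (j : ℂ) * zF q ^ k * zbF q ^ (j - 1) * gF B q
    + zF q ^ k * zbF q ^ j * gF B q * B / 2 * q.1) * Complex.I_sq

/-! ### Algebra of the ladder operators on formal combinations -/

/-- Formal linear combinations of the functions `z^k z̄^j g`. -/
abbrev LandauSpace : Type := ℕ × ℕ →₀ ℂ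

/-- The function given by a formal linear combination. -/
def landauEval (B : ℝ) : LandauSpace →ₗ[ℂ] (ℝ × ℝ → ℂ) := Finsupp.linearCombination ℂ (landauFn B)

/-- `p_x + B y` on formal linear combinations. -/
def landauX (B : ℝ) : LandauSpace →ₗ[ℂ] LandauSpace :=
  Finsupp.linearCombination ℂ fun p => (-Complex.I * p.1) • Finsupp.single (p.1 - 1, p.2) 1
    + (-Complex.I * p.2) • Finsupp.single (p.1, p.2 - 1) 1
    + (Complex.I * (B / 2 : ℝ)) • Finsupp.single (p.1, p.2 + 1) 1

/-- `p_y` on formal linear combinations. -/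
def landauY (B : ℝ) : LandauSpace →ₗ[ℂ] LandauSpace :=
  Finsupp.linearCombination ℂ fun p => (p.1 : ℂ) • Finsupp.single (p.1 - 1, p.2) 1
    + (-(p.2 : ℂ)) • Finsupp.single (p.1, p.2 - 1) 1
    + (-((B / 2 : ℝ) : ℂ)) • Finsupp.single (p.1, p.2 + 1) 1

/-- The annihilation operator `X + i Y`. -/
def landauA (B : ℝ) : LandauSpace →ₗ[ℂ] LandauSpace := landauX B + Complex.I • landauY B

/-- The creation operator `X - i Y`. -/
def landauAd (B : ℝ) : LandauSpace →ₗ[ℂ] LandauSpace := landauX B - Complex.I • landauY B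

theorem landauEval_single (B : ℝ) (p : ℕ × ℕ) :
    landauEval B (Finsupp.single p 1) = landauFn B p := by simp [landauEval]

theorem contDiff_landauEval (B : ℝ) (w : LandauSpace) : ContDiff ℝ ∞ (landauEval B w) := by
  induction w using Finsupp.induction_linear with
  | zero =>
    rw [map_zero]
    exact contDiff_const
  | add v w hv hw =>
    rw [map_add]
    exact hv.add hw
  | single p c =>
    rw [← mul_one c, ← Finsupp.smul_single', map_smul, landauEval_single]
    exact contDiff_const.smul (contDiff_landauFn B p)

theorem kinX_landauEval (B : ℝ) (w : LandauSpace) :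
    kinX B (landauEval B w) = landauEval B (landauX B w) := by
  induction w using Finsupp.induction_linear with
  | zero =>
    funext q
    simp [kinX, px]
  | add v w hv hw =>
    rw [map_add, map_add, map_add, kinX_add B (contDiff_landauEval B v) (contDiff_landauEval B w),
      hv, hw]
  | single p c =>
    rw [← mul_one c, ← Finsupp.smul_single', map_smul, map_smul, map_smul, landauEval_single,
      kinX_const_smul B (contDiff_landauFn B p)]
    congr 1
    rw [landauX, Finsupp.linearCombination_single, one_smul]
    simp only [map_add, map_smul, landauEval_single]
    exact kinX_landauFn B p.1 p.2

theorem py_landauEval (B : ℝ) (w : LandauSpace) :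
    py (landauEval B w) = landauEval B (landauY B w) := by
  induction w using Finsupp.induction_linear with
  | zero =>
    funext q
    simp [py]
  | add v w hv hw =>
    rw [map_add, map_add, map_add, py_eq_pd,
      pd_add (contDiff_landauEval B v) (contDiff_landauEval B w), ← py_eq_pd, ← py_eq_pd, hv, hw]
  | single p c =>
    rw [← mul_one c, ← Finsupp.smul_single', map_smul, map_smul, map_smul, landauEval_single,
      py_eq_pd, pd_const_smul (contDiff_landauFn B p), ← py_eq_pd]
    congr 1
    rw [landauY, Finsupp.linearCombination_single, one_smul]
    simp only [map_add, map_smul, landauEval_single]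
    exact py_landauFn B p.1 p.2

/-- The phase in `gF` is the gauge factor `exp(-iBxy/2)` leading from the symmetric to the Landau
gauge. With it annihilation is just `-2i` times the derivative in `z̄`, so it is locally nilpotent
and commutes with the degeneracy index `k`. -/
theorem landauA_single (B : ℝ) (p : ℕ × ℕ) :
    landauA B (Finsupp.single p 1)
      = (-2 * Complex.I * p.2) • Finsupp.single (p.1, p.2 - 1) (1 : ℂ) := by
  simp only [landauA, landauX, landauY, LinearMap.add_apply, LinearMap.smul_apply,
    Finsupp.linearCombination_single, one_smul]
  module

theorem landauAd_single (B : ℝ) (p : ℕ × ℕ) :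
    landauAd B (Finsupp.single p 1)
      = (-2 * Complex.I * p.1) • Finsupp.single (p.1 - 1, p.2) (1 : ℂ)
        + (Complex.I * B) • Finsupp.single (p.1, p.2 + 1) 1 := by
  simp only [landauAd, landauX, landauY, LinearMap.sub_apply, LinearMap.smul_apply,
    Finsupp.linearCombination_single, one_smul, Complex.ofReal_div, Complex.ofReal_ofNat]
  module

theorem landau_commutator (B : ℝ) (w : LandauSpace) :
    landauA B (landauAd B w) = landauAd B (landauA B w) + (2 * B : ℂ) • w := by
  induction w using Finsupp.induction_linear with
  | zero => simp
  | add v w hv hw =>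
    simp only [map_add, hv, hw, smul_add]
    abel
  | single p c =>
    rw [← mul_one c, ← Finsupp.smul_single', map_smul, map_smul, map_smul, map_smul, smul_comm _ c,
      ← smul_add]
    congr 1
    obtain ⟨k, j⟩ := p
    simp only [landauAd_single, landauA_single, map_add, map_smul]
    -- The case `j = 0` is separate because there `(j - 1) + 1` is not `j`; the whole commutator
    -- then comes from `A A†`.
    cases j with
    | zero =>
      simp only [smul_smul, Nat.zero_add, Nat.sub_self, Nat.cast_zero, Nat.cast_one]
      have : Complex.I * (B : ℂ) * (-2 * Complex.I * 1) = 2 * B := by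
        linear_combination (-2 * (B : ℂ)) * Complex.I_sq
      rw [this]
      simp
    | succ j =>
      simp only [Nat.add_sub_cancel, smul_add, smul_smul]
      have h1 : Complex.I * (B : ℂ) * (-2 * Complex.I * ((j + 1 + 1 : ℕ) : ℂ))
          = -2 * Complex.I * ((j + 1 : ℕ) : ℂ) * (Complex.I * B) + 2 * B := by
        push_cast
        linear_combination (-2 * (B : ℂ)) * Complex.I_sq
      rw [h1]
      module

theorem exists_landauA_pow_eq_zero (B : ℝ) (w : LandauSpace) : ∃ n, (landauA B ^ n) w = 0 := by
  have hmono : ∀ {n m : ℕ} {w : LandauSpace}, n ≤ m → (landauA B ^ n) w = 0 →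
      (landauA B ^ m) w = 0 := by
    intro n m w h h0
    obtain ⟨d, rfl⟩ := Nat.exists_eq_add_of_le' h
    rw [pow_add, Module.End.mul_apply, h0, map_zero]
  induction w using Finsupp.induction_linear with
  | zero => exact ⟨0, map_zero _⟩
  | add v w hv hw =>
    obtain ⟨n, hn⟩ := hv
    obtain ⟨m, hm⟩ := hw
    exact ⟨max n m, by rw [map_add, hmono (le_max_left _ _) hn, hmono (le_max_right _ _) hm,
      add_zero]⟩
  | single p c =>
    obtain ⟨k, j⟩ := p
    refine ⟨j + 1, ?_⟩
    rw [← mul_one c, ← Finsupp.smul_single', map_smul]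
    have : ∀ j : ℕ, (landauA B ^ (j + 1)) (Finsupp.single (k, j) 1) = 0 := by
      intro j
      induction j with
      | zero => simp [landauA_single]
      | succ j ih =>
        rw [pow_succ, Module.End.mul_apply, landauA_single, map_smul]
        simp only [Nat.add_sub_cancel]
        rw [ih, smul_zero]
    rw [this, smul_zero]

/-! ### Gaussian bounds and approximation by test functions -/

theorem norm_gF (B : ℝ) (q : ℝ × ℝ) : ‖gF B q‖ = Real.exp (-(B / 4) * (q.1 ^ 2 + q.2 ^ 2)) := by
  rw [gF, Complex.norm_exp]
  congr 1
  have e : (-(B / 4 : ℝ) * ((q.1 : ℂ) ^ 2 + (q.2 : ℂ) ^ 2)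
      - (B / 2 : ℝ) * Complex.I * q.1 * q.2)
      = ((-(B / 4) * (q.1 ^ 2 + q.2 ^ 2) : ℝ) : ℂ) + ((-(B / 2 * q.1 * q.2) : ℝ) : ℂ) * Complex.I := by
    push_cast
    ring
  rw [e, Complex.add_re, Complex.ofReal_re, Complex.re_ofReal_mul, Complex.I_re, mul_zero, add_zero]

theorem memLp_exp_neg_mul_sq {b : ℝ} (hb : 0 < b) :
    MemLp (fun q : ℝ × ℝ => Real.exp (-b * (q.1 ^ 2 + q.2 ^ 2))) 2 volume := by
  rw [memLp_two_iff_integrable_sq (by fun_prop)]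
  have h := (integrable_exp_neg_mul_sq (b := 2 * b) (by positivity)).mul_prod
    (integrable_exp_neg_mul_sq (b := 2 * b) (by positivity))
  refine h.congr (ae_of_all _ fun q => ?_)
  simp only
  rw [← Real.exp_add, sq (Real.exp _), ← Real.exp_add]
  congr 1
  ring

/-- Functions which are exponentially bounded relative to the Gaussian are in `L²`. -/
theorem memLp_of_le_exp_mul_gF {B : ℝ} (hB : 0 < B) {f : ℝ × ℝ → ℂ}
    (hf : AEStronglyMeasurable f volume) {K C : ℝ} (hK : 0 ≤ K)
    (h : ∀ q, ‖f q‖ ≤ K * (Real.exp (C * (|q.1| + |q.2|)) * ‖gF B q‖)) : MemLp f 2 volume := by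
  refine (memLp_exp_neg_mul_sq (b := B / 8) (by positivity)).of_le_mul
    (c := K * Real.exp (4 * C ^ 2 / B)) hf (ae_of_all _ fun q => (h q).trans ?_)
  rw [mul_assoc, Real.norm_of_nonneg (Real.exp_nonneg _), norm_gF, ← Real.exp_add,
    ← Real.exp_add]
  refine mul_le_mul_of_nonneg_left (Real.exp_le_exp.2 ?_) hK
  -- Completing the square spends half of the Gaussian exponent `B / 4` on the exponential growth;
  -- the other half, `B / 8`, keeps the function in `L²`.
  have key : ∀ t : ℝ, C * |t| ≤ 2 * C ^ 2 / B + B / 8 * t ^ 2 := by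
    intro t
    rw [← sub_nonneg]
    have e : 2 * C ^ 2 / B + B / 8 * t ^ 2 - C * |t| = (B * |t| - 4 * C) ^ 2 / (8 * B) := by
      rw [← sq_abs t]
      field_simp
      ring
    rw [e]
    positivity
  have e2 : 4 * C ^ 2 / B = 2 * C ^ 2 / B + 2 * C ^ 2 / B := by ring
  nlinarith [key q.1, key q.2]

theorem norm_zF_le (q : ℝ × ℝ) : ‖zF q‖ ≤ |q.1| + |q.2| := by
  refine (norm_add_le _ _).trans ?_
  simp

theorem norm_zbF_le (q : ℝ × ℝ) : ‖zbF q‖ ≤ |q.1| + |q.2| := by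
  refine (norm_sub_le _ _).trans ?_
  simp

theorem norm_landauFn_le (B : ℝ) (p : ℕ × ℕ) (q : ℝ × ℝ) : ‖landauFn B p q‖
    ≤ ((p.1 + p.2).factorial : ℝ) * (Real.exp (1 * (|q.1| + |q.2|)) * ‖gF B q‖) := by
  have h0 : 0 ≤ |q.1| + |q.2| := by positivity
  have h1 := Real.pow_div_factorial_le_exp _ h0 (p.1 + p.2)
  rw [div_le_iff₀ (by positivity)] at h1
  rw [landauFn, Pi.mul_apply, Pi.mul_apply, Pi.pow_apply, Pi.pow_apply, norm_mul, norm_mul,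
    norm_pow, norm_pow, ← mul_assoc, one_mul, mul_comm _ (Real.exp _)]
  refine mul_le_mul_of_nonneg_right (le_trans ?_ h1) (norm_nonneg _)
  rw [pow_add]
  exact mul_le_mul (pow_le_pow_left₀ (norm_nonneg _) (norm_zF_le q) _)
    (pow_le_pow_left₀ (norm_nonneg _) (norm_zbF_le q) _) (by positivity) (by positivity)

theorem memLp_landauFn {B : ℝ} (hB : 0 < B) (p : ℕ × ℕ) : MemLp (landauFn B p) 2 volume :=
  memLp_of_le_exp_mul_gF hB (contDiff_landauFn B p).continuous.aestronglyMeasurable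
    (by positivity) (norm_landauFn_le B p)

theorem memLp_landauEval {B : ℝ} (hB : 0 < B) (w : LandauSpace) :
    MemLp (landauEval B w) 2 volume := by
  induction w using Finsupp.induction_linear with
  | zero =>
    rw [map_zero]
    exact MemLp.zero'
  | add v w hv hw =>
    rw [map_add]
    exact hv.add hw
  | single p c =>
    rw [← mul_one c, ← Finsupp.smul_single', map_smul, landauEval_single]
    exact (memLp_landauFn hB p).const_smul c

/-- Polynomials times the Gaussian as vectors of `L²(ℝ²)`. -/
def landauL2 {B : ℝ} (hB : 0 < B) : LandauSpace →ₗ[ℂ] L2Plane where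
  toFun w := (memLp_landauEval hB w).toLp
  map_add' v w := by
    rw [← MemLp.toLp_add]
    exact MemLp.toLp_congr _ _ (by rw [map_add])
  map_smul' c w := by
    rw [RingHom.id_apply, ← MemLp.toLp_const_smul]
    exact MemLp.toLp_congr _ _ (by rw [map_smul])

/-- `(p - A)²` on formal linear combinations. -/
def landauK (B : ℝ) : LandauSpace →ₗ[ℂ] LandauSpace :=
  landauX B ∘ₗ landauX B + landauY B ∘ₗ landauY B

/-- Every `w` is approximated by test functions in the graph norm of `(p - A)²`. -/
theorem exists_tendsto_landauL2 {B : ℝ} (hB : 0 < B) (w : LandauSpace) :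
    ∃ φ : ℕ → TestFn, Tendsto (fun n => toL2 (φ n)) atTop (𝓝 (landauL2 hB w)) ∧
      Tendsto (fun n => toL2 (kinOp B (φ n))) atTop (𝓝 (landauL2 hB (landauK B w))) := by
  obtain ⟨m, hm, hms⟩ := exists_isCutoff_hasCompactSupport
  have hsm := fun n => contDiff_scaled hm.smooth n
  have hs : ∀ n, IsTest (scaled m n * landauEval B w) := fun n =>
    ⟨(hsm n).mul (contDiff_landauEval B w), (hasCompactSupport_scaled hms n).mul_right⟩
  have hw := contDiff_landauEval B w
  have hmul : ∀ (f : ℝ × ℝ → ℂ) (hf : IsBddMeas f) (w : LandauSpace),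
      mulL2 f hf (landauL2 hB w) =ᵐ[volume] f * landauEval B w := by
    intro f hf w
    filter_upwards [coeFn_mulL2 hf (landauL2 hB w), (memLp_landauEval hB w).coeFn_toLp]
      with q h1 h2
    rw [h1, Pi.mul_apply, Pi.mul_apply]
    exact congrArg _ h2
  refine ⟨fun n => ⟨_, hs n⟩, ?_, ?_⟩
  · refine (hm.tendsto_mulL2_scaled (landauL2 hB w)).congr fun n => Lp.ext ?_
    exact (hmul _ _ w).trans (coeFn_toL2 ⟨_, hs n⟩).symm
  · have hlim := ((hm.tendsto_mulL2_scaled (landauL2 hB (landauK B w))).add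
      (((hm.tendsto_mulL2_pd_scaled (1, 0) (landauL2 hB (landauX B w))).add
        (hm.tendsto_mulL2_pd_scaled (0, 1) (landauL2 hB (landauY B w)))).const_smul (2 : ℂ))).add
      ((hm.tendsto_mulL2_pd_pd_scaled (1, 0) (1, 0) (landauL2 hB w)).add
        (hm.tendsto_mulL2_pd_pd_scaled (0, 1) (0, 1) (landauL2 hB w)))
    simp only [add_zero, smul_zero] at hlim
    refine hlim.congr fun n => Lp.ext ?_
    -- The Leibniz rule for `(p - A)²`. Every term except the first contains a derivative of the
    -- rescaled cutoff and so is of order `1 / (n + 1)`.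
    have hfun : (kinOp B ⟨_, hs n⟩ : ℝ × ℝ → ℂ) = scaled m n * landauEval B (landauK B w)
        + (2 : ℂ) • (pd (1, 0) (scaled m n) * landauEval B (landauX B w)
          + pd (0, 1) (scaled m n) * landauEval B (landauY B w))
        + (pd (1, 0) (pd (1, 0) (scaled m n)) * landauEval B w
          + pd (0, 1) (pd (0, 1) (scaled m n)) * landauEval B w) := by
      change kinX B (kinX B (scaled m n * landauEval B w))
        + pd (0, 1) (pd (0, 1) (scaled m n * landauEval B w)) = _
      have hX := contDiff_landauEval B (landauX B w)
      have hY := contDiff_landauEval B (landauY B w)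
      have h1 : ContDiff ℝ ∞ (scaled m n * landauEval B (landauX B w)) := (hsm n).mul hX
      have h2 : ContDiff ℝ ∞ (scaled m n * landauEval B (landauY B w)) := (hsm n).mul hY
      have h3 : ∀ v, ContDiff ℝ ∞ (pd v (scaled m n) * landauEval B w) := fun v =>
        (contDiff_pd (hsm n) v).mul hw
      rw [kinX_mul B (hsm n) hw, kinX_landauEval, kinX_add B h1 (h3 _),
        kinX_mul B (hsm n) hX, kinX_mul B (contDiff_pd (hsm n) _) hw, kinX_landauEval,
        kinX_landauEval, pd_mul (hsm n) hw, ← py_eq_pd (landauEval B w), py_landauEval,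
        pd_add h2 (h3 _), pd_mul (hsm n) hY,
        pd_mul (contDiff_pd (hsm n) _) hw, ← py_eq_pd (landauEval B _), py_landauEval,
        ← py_eq_pd (landauEval B _), py_landauEval, landauK, LinearMap.add_apply,
        LinearMap.comp_apply, LinearMap.comp_apply, map_add]
      funext q
      simp only [Pi.add_apply, Pi.mul_apply, Pi.smul_apply, smul_eq_mul]
      ring
    refine EventuallyEq.trans ?_ (coeFn_toL2 (kinOp B ⟨_, hs n⟩)).symm
    rw [hfun]
    refine (Lp.coeFn_add _ _).trans (EventuallyEq.add ((Lp.coeFn_add _ _).trans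
      (EventuallyEq.add (hmul _ _ _) ?_)) ((Lp.coeFn_add _ _).trans
        (EventuallyEq.add (hmul _ _ _) (hmul _ _ _))))
    exact (Lp.coeFn_smul _ _).trans (EventuallyEq.const_smul ((Lp.coeFn_add _ _).trans
      (EventuallyEq.add (hmul _ _ _) (hmul _ _ _))) _)

/-! ### Completeness of the Landau states -/

/-- An integrable function is determined by its Fourier transform: the real case. -/
theorem ae_eq_zero_of_charFun_real {k : ℝ × ℝ → ℝ} (hk : Integrable k volume)
    (h : ∀ L : StrongDual ℝ (ℝ × ℝ), ∫ q, (k q : ℂ) * Complex.exp (L q * Complex.I) = 0) :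
    k =ᵐ[volume] 0 := by
  -- The positive and negative parts of `k` are densities of finite measures. The hypothesis says
  -- that their characteristic functions agree, hence so do the measures.
  set μ := (volume : Measure (ℝ × ℝ)).withDensity fun q => ENNReal.ofReal (k q) with hμ
  set ν := (volume : Measure (ℝ × ℝ)).withDensity fun q => ENNReal.ofReal (-k q) with hν
  have : IsFiniteMeasure μ := isFiniteMeasure_withDensity_ofReal hk.2
  have : IsFiniteMeasure ν := isFiniteMeasure_withDensity_ofReal hk.neg.2
  have hpos : ∀ (f : ℝ × ℝ → ℝ) (hf : Integrable f volume) (e : ℝ × ℝ → ℂ),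
      ∫ q, e q ∂((volume : Measure (ℝ × ℝ)).withDensity fun q => ENNReal.ofReal (f q))
        = ∫ q, (max (f q) 0 : ℝ) • e q := by
    intro f hf e
    rw [integral_withDensity_eq_integral_toReal_smul₀ hf.1.aemeasurable.ennreal_ofReal
      (ae_of_all _ fun q => ENNReal.ofReal_lt_top)]
    rfl
  have hμν : μ = ν := by
    refine Measure.ext_of_charFunDual ?_
    funext L
    rw [charFunDual_apply, charFunDual_apply, hμ, hν, hpos k hk,
      hpos (fun q => -k q) hk.neg, ← sub_eq_zero]
    have hb : ∀ f : ℝ × ℝ → ℝ, Integrable f volume →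
        Integrable (fun q => (max (f q) 0 : ℝ) • Complex.exp (L q * Complex.I)) volume := by
      intro f hf
      refine (hf.pos_part.ofReal (𝕜 := ℂ)).mul_bdd (c := 1)
        (Continuous.aestronglyMeasurable (by fun_prop)) (ae_of_all _ fun q => ?_)
      rw [Complex.norm_exp_ofReal_mul_I]
    rw [← integral_sub (hb k hk) (hb (fun q => -k q) hk.neg), ← h L]
    congr 1
    funext q
    rw [← sub_smul, Complex.real_smul]
    congr 2
    exact max_zero_sub_max_neg_zero_eq_self (k q)
  refine Integrable.ae_eq_zero_of_forall_setIntegral_eq_zero hk fun S hS _ => ?_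
  have h1 : (μ S).toReal = (ν S).toReal := by rw [hμν]
  rw [hμ, hν, withDensity_apply _ hS, withDensity_apply _ hS] at h1
  rw [integral_eq_lintegral_pos_part_sub_lintegral_neg_part hk.integrableOn, h1, sub_self]

/-- An integrable function is determined by its Fourier transform. -/
theorem ae_eq_zero_of_charFun {h : ℝ × ℝ → ℂ} (hi : Integrable h volume)
    (h0 : ∀ L : StrongDual ℝ (ℝ × ℝ), ∫ q, h q * Complex.exp (L q * Complex.I) = 0) :
    h =ᵐ[volume] 0 := by
  have hint : ∀ (f : ℝ × ℝ → ℂ), Integrable f volume → ∀ L : StrongDual ℝ (ℝ × ℝ),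
      Integrable (fun q => f q * Complex.exp (L q * Complex.I)) volume := by
    intro f hf L
    refine hf.mul_bdd (c := 1) (Continuous.aestronglyMeasurable (by fun_prop))
      (ae_of_all _ fun q => ?_)
    rw [Complex.norm_exp_ofReal_mul_I]
  have hconj : ∀ L : StrongDual ℝ (ℝ × ℝ),
      ∫ q, starRingEnd ℂ (h q) * Complex.exp (L q * Complex.I) = 0 := by
    intro L
    have h1 := congrArg (starRingEnd ℂ) (h0 (-L))
    rw [← integral_conj, map_zero] at h1
    rw [← h1]
    congr 1
    funext q
    rw [map_mul, ← Complex.exp_conj]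
    simp
  have hci : Integrable (fun q => starRingEnd ℂ (h q)) volume :=
    Complex.conjCLE.toContinuousLinearMap.integrable_comp hi
  have hre : (fun q => (h q).re) =ᵐ[volume] 0 := by
    refine ae_eq_zero_of_charFun_real hi.re fun L => ?_
    have e : ∀ q, ((h q).re : ℂ) * Complex.exp (L q * Complex.I)
        = (1 / 2 : ℂ) * (h q * Complex.exp (L q * Complex.I)
          + starRingEnd ℂ (h q) * Complex.exp (L q * Complex.I)) := by
      intro q
      rw [Complex.re_eq_add_conj]
      ring
    simp only [e]
    rw [integral_const_mul, integral_add (hint _ hi L) (hint _ hci L), h0, hconj]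
    simp
  have him : (fun q => (h q).im) =ᵐ[volume] 0 := by
    refine ae_eq_zero_of_charFun_real hi.im fun L => ?_
    have e : ∀ q, ((h q).im : ℂ) * Complex.exp (L q * Complex.I)
        = (1 / (2 * Complex.I) : ℂ) * (h q * Complex.exp (L q * Complex.I)
          - starRingEnd ℂ (h q) * Complex.exp (L q * Complex.I)) := by
      intro q
      rw [Complex.im_eq_sub_conj]
      ring
    simp only [e]
    rw [integral_const_mul, integral_sub (hint _ hi L) (hint _ hci L), h0, hconj]
    simp
  filter_upwards [hre, him] with q h1 h2
  exact Complex.ext h1 h2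

/-- Real linear forms on the plane in terms of `z` and `z̄`. -/
theorem dual_eq_zF_zbF (L : StrongDual ℝ (ℝ × ℝ)) (q : ℝ × ℝ) :
    (L q : ℂ) = (L (1, 0) - Complex.I * L (0, 1)) / 2 * zF q
      + (L (1, 0) + Complex.I * L (0, 1)) / 2 * zbF q := by
  have h : L q = q.1 * L (1, 0) + q.2 * L (0, 1) := by
    conv_lhs => rw [show q = q.1 • ((1, 0) : ℝ × ℝ) + q.2 • ((0, 1) : ℝ × ℝ) by ext <;> simp]
    rw [map_add, map_smul, map_smul, smul_eq_mul, smul_eq_mul]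
  rw [h, zF, zbF]
  push_cast
  linear_combination (q.2 * L (0, 1) : ℂ) * Complex.I_sq

/-- Completeness by moments. All polynomial moments of `h = ū g` vanish, and the Gaussian makes `h
e^{|L|}` integrable for every linear form `L`. The Fourier transform may therefore be expanded into
its power series and vanishes, so `h = 0`; `g` has no zeros. -/
theorem eq_zero_of_inner_landauL2 {B : ℝ} (hB : 0 < B) (u : L2Plane)
    (hu : ∀ w, ⟪u, landauL2 hB w⟫_ℂ = 0) : u = 0 := by
  set h : ℝ × ℝ → ℂ := fun q => starRingEnd ℂ (u q) * gF B q with hh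
  have hum : MemLp (fun q => starRingEnd ℂ (u q)) 2 volume := (Lp.memLp u).star
  have hint : ∀ f : ℝ × ℝ → ℂ, MemLp f 2 volume →
      Integrable (fun q => starRingEnd ℂ (u q) * f q) volume := fun f hf => hum.integrable_mul hf
  have hmono : ∀ p : ℕ × ℕ, ∫ q, h q * (zF q ^ p.1 * zbF q ^ p.2) = 0 := by
    intro p
    have h1 := hu (Finsupp.single p 1)
    rw [L2.inner_def] at h1
    rw [← h1]
    refine integral_congr_ae ?_
    filter_upwards [(memLp_landauEval hB (Finsupp.single p 1)).coeFn_toLp] with q hq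
    rw [RCLike.inner_apply]
    have : (landauL2 hB (Finsupp.single p 1) : ℝ × ℝ → ℂ) q = landauFn B p q :=
      hq.trans (congrFun (landauEval_single B p) q)
    rw [this, landauFn, hh]
    simp only [Pi.mul_apply, Pi.pow_apply]
    ring
  have hmonoint : ∀ p : ℕ × ℕ, Integrable (fun q => h q * (zF q ^ p.1 * zbF q ^ p.2)) volume := by
    intro p
    refine (hint _ (memLp_landauFn hB p)).congr (ae_of_all _ fun q => ?_)
    simp only [landauFn, Pi.mul_apply, Pi.pow_apply, hh]
    ring
  have hpow : ∀ (L : StrongDual ℝ (ℝ × ℝ)) (n : ℕ), ∫ q, h q * (L q : ℂ) ^ n = 0 := by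
    intro L n
    have e : ∀ q, h q * (L q : ℂ) ^ n = ∑ k ∈ Finset.range (n + 1),
        (((L (1, 0) - Complex.I * L (0, 1)) / 2) ^ k
          * ((L (1, 0) + Complex.I * L (0, 1)) / 2) ^ (n - k) * (n.choose k : ℂ))
          * (h q * (zF q ^ k * zbF q ^ (n - k))) := by
      intro q
      rw [dual_eq_zF_zbF, add_pow, Finset.mul_sum]
      refine Finset.sum_congr rfl fun k _ => ?_
      rw [mul_pow, mul_pow]
      ring
    simp only [e]
    rw [integral_finsetSum _ fun k _ => (hmonoint (k, n - k)).const_mul _]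
    refine Finset.sum_eq_zero fun k _ => ?_
    rw [integral_const_mul, hmono (k, n - k), mul_zero]
  have hgm : Measurable (gF B) := (contDiff_gF B).continuous.measurable
  have hhi : Integrable h volume := by
    have := hmonoint (0, 0)
    simpa using this
  have hzero : h =ᵐ[volume] 0 := by
    refine ae_eq_zero_of_charFun hhi fun L => ?_
    have hsum : HasSum (fun n : ℕ => ∫ q, h q * ((L q * Complex.I) ^ n / (n.factorial : ℂ)))
        (∫ q, h q * Complex.exp (L q * Complex.I)) := by
      refine hasSum_integral_of_dominated_convergence
        (fun n q => ‖h q‖ * (|L q| ^ n / (n.factorial : ℝ))) (fun n => ?_) (fun n => ?_) ?_ ?_ ?_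
      · exact hhi.1.mul (Continuous.aestronglyMeasurable (by fun_prop))
      · refine ae_of_all _ fun q => ?_
        rw [norm_mul, norm_div, norm_pow, norm_mul (L q : ℂ) Complex.I, Complex.norm_I, Complex.norm_real, mul_one,
          Complex.norm_natCast, Real.norm_eq_abs]
      · exact ae_of_all _ fun q => (Real.summable_pow_div_factorial _).mul_left _
      · have e : ∀ q, ∑' n : ℕ, ‖h q‖ * (|L q| ^ n / (n.factorial : ℝ))
            = ‖h q‖ * Real.exp |L q| := by
          intro q
          rw [tsum_mul_left, Real.exp_eq_exp_ℝ, NormedSpace.exp_eq_tsum_div]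
        simp only [e]
        have hm : MemLp (fun q => gF B q * (Real.exp |L q| : ℂ)) 2 volume := by
          refine memLp_of_le_exp_mul_gF hB (K := 1) (C := ‖L‖)
            ((contDiff_gF B).continuous.mul (by fun_prop)).aestronglyMeasurable zero_le_one
            fun q => ?_
          rw [one_mul, norm_mul, mul_comm, Complex.norm_real, Real.norm_of_nonneg (Real.exp_nonneg _)]
          refine mul_le_mul_of_nonneg_right (Real.exp_le_exp.2 ?_) (norm_nonneg _)
          refine (L.le_opNorm q).trans (mul_le_mul_of_nonneg_left ?_ (norm_nonneg _))
          rw [Prod.norm_def]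
          exact max_le (le_add_of_nonneg_right (abs_nonneg _))
            (le_add_of_nonneg_left (abs_nonneg _))
        refine (hint _ hm).norm.congr (ae_of_all _ fun q => ?_)
        simp only [hh, norm_mul, Complex.norm_real, Real.norm_of_nonneg (Real.exp_nonneg _)]
        ring
      · refine ae_of_all _ fun q => HasSum.mul_left _ ?_
        rw [Complex.exp_eq_exp_ℂ]
        exact NormedSpace.expSeries_div_hasSum_exp _
    refine hsum.unique ?_
    have e : ∀ n : ℕ, ∫ q, h q * ((L q * Complex.I) ^ n / (n.factorial : ℂ)) = 0 := by
      intro n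
      have : ∀ q, h q * ((L q * Complex.I) ^ n / (n.factorial : ℂ))
          = (Complex.I ^ n / (n.factorial : ℂ)) * (h q * (L q : ℂ) ^ n) := by
        intro q
        rw [mul_pow]
        ring
      simp only [this]
      rw [integral_const_mul, hpow, mul_zero]
    simp only [e]
    exact hasSum_zero
  rw [Lp.eq_zero_iff_ae_eq_zero]
  filter_upwards [hzero] with q hq
  have h1 : starRingEnd ℂ (u q) = 0 := by
    refine (mul_eq_zero.1 hq).resolve_right ?_
    rw [gF]
    exact Complex.exp_ne_zero _
  simpa using h1

theorem denseRange_landauL2 {B : ℝ} (hB : 0 < B) : DenseRange (landauL2 hB) := by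
  have h : (LinearMap.range (landauL2 hB)).topologicalClosure = ⊤ := by
    rw [Submodule.topologicalClosure_eq_top_iff, Submodule.eq_bot_iff]
    intro u hu
    exact eq_zero_of_inner_landauL2 hB u fun w =>
      (Submodule.mem_orthogonal' _ _).1 hu _ ⟨w, rfl⟩
  have := Submodule.dense_iff_topologicalClosure_eq_top.2 h
  rwa [LinearMap.coe_range] at this

/-! ### The gaps between the Landau levels -/

/-- The symmetrized product `A A† + A† A` is `2 (X² + Y²)`; the commutator `[A, A†] = 2B` then moves
one product past the other. Eigenvalues `2Bj` of `A† A` become the levels `(2j + 1) B`. -/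
theorem landauK_eq (B : ℝ) (w : LandauSpace) :
    landauK B w = landauAd B (landauA B w) + (B : ℂ) • w := by
  have h1 : landauA B (landauAd B w) + landauAd B (landauA B w) = (2 : ℂ) • landauK B w := by
    simp only [landauA, landauAd, landauK, LinearMap.add_apply, LinearMap.sub_apply,
      LinearMap.smul_apply, LinearMap.comp_apply, map_add, map_sub, map_smul, smul_add, smul_sub,
      smul_smul, Complex.I_mul_I]
    module
  rw [landau_commutator] at h1
  have h2 : (2 : ℂ) • landauK B w
      = (2 : ℂ) • (landauAd B (landauA B w) + (B : ℂ) • w) := by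
    rw [← h1]
    module
  exact smul_right_injective _ two_ne_zero h2

/-- Symmetry is inherited from test functions by graph-norm approximation, so no boundary terms at
infinity arise. -/
theorem inner_landauK {B : ℝ} (hB : 0 < B) (v w : LandauSpace) :
    ⟪landauL2 hB (landauK B v), landauL2 hB w⟫_ℂ
      = ⟪landauL2 hB v, landauL2 hB (landauK B w)⟫_ℂ := by
  obtain ⟨φ, h1, h2⟩ := exists_tendsto_landauL2 hB v
  obtain ⟨ψ, h3, h4⟩ := exists_tendsto_landauL2 hB w
  refine tendsto_nhds_unique (h2.inner h3) ?_
  simp only [inner_kinOp]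
  exact h1.inner h4

/-- Every vector is a sum of eigenvectors of `(p - A)²` with eigenvalues `(2 j + 1) B`. -/
theorem exists_landau_decomposition {B : ℝ} (hB : 0 < B) (w : LandauSpace) :
    ∃ (n : ℕ) (v : ℕ → LandauSpace), (∑ j ∈ Finset.range n, v j = w) ∧
      ∀ j, landauK B (v j) = (((2 * (j : ℝ) + 1) * B : ℝ) : ℂ) • v j := by
  obtain ⟨n, hn⟩ := exists_landauA_pow_eq_zero B w
  have hc : (2 * B : ℂ) ≠ 0 := mul_ne_zero two_ne_zero (Complex.ofReal_ne_zero.2 hB.ne')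
  obtain ⟨v, hv1, hv2⟩ := exists_ladder_decomposition (landau_commutator B) hc n w hn
  refine ⟨n, v, hv1, fun j => ?_⟩
  rw [landauK_eq, hv2, ← add_smul]
  congr 1
  push_cast
  ring

theorem norm_sq_sum_of_orthogonal {E : Type*} [NormedAddCommGroup E] [InnerProductSpace ℂ E]
    (s : Finset ℕ) (x : ℕ → E) (h : ∀ i j, i ≠ j → ⟪x i, x j⟫_ℂ = 0) :
    ‖∑ j ∈ s, x j‖ ^ 2 = ∑ j ∈ s, ‖x j‖ ^ 2 := by
  induction s using Finset.induction_on with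
  | empty => simp
  | insert a s ha ih =>
    have h0 : ⟪x a, ∑ j ∈ s, x j⟫_ℂ = 0 := by
      rw [inner_sum]
      exact Finset.sum_eq_zero fun j hj => h a j fun e => ha (e ▸ hj)
    rw [Finset.sum_insert ha, Finset.sum_insert ha, norm_add_sq (𝕜 := ℂ), h0, ih]
    simp

/-- Only finitely many levels lie below `E + 1`; the remaining ones are at distance at least `1`. -/
theorem exists_dist_landau_levels {B : ℝ} (hB : 0 < B) {E : ℝ}
    (hE : ∀ n : ℕ, E ≠ (2 * (n : ℝ) + 1) * B) :
    ∃ d > 0, ∀ j : ℕ, d ≤ |(2 * (j : ℝ) + 1) * B - E| := by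
  have hfin : ∀ N : ℕ, ∃ d > 0, ∀ j < N, d ≤ |(2 * (j : ℝ) + 1) * B - E| := by
    intro N
    induction N with
    | zero => exact ⟨1, one_pos, fun j hj => absurd hj (Nat.not_lt_zero j)⟩
    | succ N ih =>
      obtain ⟨d, hd, h⟩ := ih
      refine ⟨min d |(2 * (N : ℝ) + 1) * B - E|,
        lt_min hd (abs_pos.2 (sub_ne_zero.2 (hE N).symm)), fun j hj => ?_⟩
      rcases Nat.lt_succ_iff_lt_or_eq.1 hj with h1 | rfl
      · exact (min_le_left _ _).trans (h j h1)
      · exact min_le_right _ _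
  obtain ⟨N, hN⟩ := exists_nat_ge ((E + 1) / B)
  obtain ⟨d, hd, h⟩ := hfin N
  refine ⟨min d 1, lt_min hd one_pos, fun j => ?_⟩
  by_cases hj : j < N
  · exact (min_le_left _ _).trans (h j hj)
  · refine (min_le_right _ _).trans (le_trans ?_ (le_abs_self _))
    have h1 : (N : ℝ) ≤ j := Nat.cast_le.2 (not_lt.1 hj)
    rw [div_le_iff₀ hB] at hN
    have hj0 : (0 : ℝ) ≤ j := j.cast_nonneg
    nlinarith

/-- The kinetic energy shifted by `E` on Landau states. -/
theorem le_norm_landauK_sub {B : ℝ} (hB : 0 < B) {E d : ℝ} (hd0 : 0 ≤ d)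
    (hd : ∀ j : ℕ, d ≤ |(2 * (j : ℝ) + 1) * B - E|) (w : LandauSpace) :
    d * ‖landauL2 hB w‖ ≤ ‖landauL2 hB (landauK B w - (E : ℂ) • w)‖ := by
  obtain ⟨n, v, rfl, hv⟩ := exists_landau_decomposition hB w
  have hort : ∀ i j, i ≠ j → ⟪landauL2 hB (v i), landauL2 hB (v j)⟫_ℂ = 0 := by
    intro i j hij
    have h := inner_landauK hB (v i) (v j)
    rw [hv, hv, map_smul, map_smul, inner_smul_left, inner_smul_right, Complex.conj_ofReal] at h
    have h2 : ((((2 * (i : ℝ) + 1) * B - (2 * (j : ℝ) + 1) * B : ℝ)) : ℂ)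
        * ⟪landauL2 hB (v i), landauL2 hB (v j)⟫_ℂ = 0 := by
      rw [Complex.ofReal_sub, sub_mul, h, sub_self]
    refine (mul_eq_zero.1 h2).resolve_left (Complex.ofReal_ne_zero.2 fun h3 => hij ?_)
    have h4 : ((i : ℝ) - j) * (2 * B) = 0 := by linarith
    have h5 := (mul_eq_zero.1 h4).resolve_right (by positivity)
    exact_mod_cast sub_eq_zero.1 h5
  have e : landauL2 hB (landauK B (∑ j ∈ Finset.range n, v j)
      - (E : ℂ) • ∑ j ∈ Finset.range n, v j)
      = ∑ j ∈ Finset.range n,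
        (((2 * (j : ℝ) + 1) * B - E : ℝ) : ℂ) • landauL2 hB (v j) := by
    rw [map_sum, Finset.smul_sum, ← Finset.sum_sub_distrib, map_sum]
    refine Finset.sum_congr rfl fun j _ => ?_
    rw [hv, ← sub_smul, map_smul, Complex.ofReal_sub]
  refine le_of_sq_le_sq ?_ (norm_nonneg _)
  rw [e, map_sum, mul_pow, norm_sq_sum_of_orthogonal _ _ hort,
    norm_sq_sum_of_orthogonal _ (fun j => (((2 * (j : ℝ) + 1) * B - E : ℝ) : ℂ) • landauL2 hB (v j))
      (fun i j hij => by rw [inner_smul_left, inner_smul_right, hort i j hij, mul_zero, mul_zero]),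
    Finset.mul_sum]
  refine Finset.sum_le_sum fun j _ => ?_
  rw [norm_smul, mul_pow, Complex.norm_real, Real.norm_eq_abs]
  exact mul_le_mul_of_nonneg_right (pow_le_pow_left₀ hd0 (hd j) 2) (by positivity)

theorem exists_landauK_sub_eq {B : ℝ} (hB : 0 < B) {E : ℝ}
    (hE : ∀ n : ℕ, E ≠ (2 * (n : ℝ) + 1) * B) (w : LandauSpace) :
    ∃ v, landauK B v - (E : ℂ) • v = w := by
  obtain ⟨n, v, rfl, hv⟩ := exists_landau_decomposition hB w
  refine ⟨∑ j ∈ Finset.range n, (((2 * (j : ℝ) + 1) * B - E : ℝ) : ℂ)⁻¹ • v j, ?_⟩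
  rw [map_sum, Finset.smul_sum, ← Finset.sum_sub_distrib]
  refine Finset.sum_congr rfl fun j _ => ?_
  have hne : (((2 * (j : ℝ) + 1) * B - E : ℝ) : ℂ) ≠ 0 :=
    Complex.ofReal_ne_zero.2 (sub_ne_zero.2 (hE j).symm)
  rw [map_smul, hv, smul_smul, smul_smul, ← sub_smul, mul_comm (E : ℂ), ← mul_sub,
    ← Complex.ofReal_sub, inv_mul_cancel₀ hne, one_smul]

theorem denseRange_kinOp_sub {B : ℝ} (hB : 0 < B) {E : ℝ}
    (hE : ∀ n : ℕ, E ≠ (2 * (n : ℝ) + 1) * B) :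
    DenseRange (toL2 ∘ₗ kinOp B - (E : ℂ) • toL2) := by
  have hsub : Set.range (landauL2 hB) ⊆ closure (Set.range (toL2 ∘ₗ kinOp B - (E : ℂ) • toL2)) := by
    rintro _ ⟨w, rfl⟩
    obtain ⟨v, rfl⟩ := exists_landauK_sub_eq hB hE w
    obtain ⟨φ, h1, h2⟩ := exists_tendsto_landauL2 hB v
    rw [map_sub, map_smul]
    exact mem_closure_of_tendsto (h2.sub (h1.const_smul (E : ℂ)))
      (Eventually.of_forall fun n => ⟨φ n, rfl⟩)
  intro u
  have := closure_mono hsub (denseRange_landauL2 hB u)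
  rwa [closure_closure] at this

/-- The distance of `E` from the Landau levels bounds `(p - A)² - E` from below. -/
theorem le_norm_kinOp_sub {B : ℝ} (hB : 0 < B) {E d : ℝ} (hd0 : 0 < d)
    (hd : ∀ j : ℕ, d ≤ |(2 * (j : ℝ) + 1) * B - E|) (φ : TestFn) :
    d * ‖toL2 φ‖ ≤ ‖toL2 (kinOp B φ) - (E : ℂ) • toL2 φ‖ := by
  have hE : ∀ n : ℕ, E ≠ (2 * (n : ℝ) + 1) * B := by
    intro n h
    have := hd n
    rw [← h, sub_self, abs_zero] at this
    linarith
  set η := toL2 (kinOp B φ) - (E : ℂ) • toL2 φ with hη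
  have hdense : DenseRange fun w => landauL2 hB (landauK B w - (E : ℂ) • w) := by
    intro u
    refine closure_mono ?_ (denseRange_landauL2 hB u)
    rintro _ ⟨w, rfl⟩
    obtain ⟨v, rfl⟩ := exists_landauK_sub_eq hB hE w
    exact ⟨v, rfl⟩
  obtain ⟨x, hx, hlim⟩ := mem_closure_iff_seq_limit.1 (hdense η)
  choose w hw using hx
  have hlim' : Tendsto (fun n => landauL2 hB (landauK B (w n) - (E : ℂ) • w n)) atTop (𝓝 η) := by
    simpa only [hw] using hlim
  -- The approximated vector is `η`, not `φ`: the gap estimate on Landau states makes the preimages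
  -- `wₙ` of the approximations converge.
  have hC : CauchySeq fun n => landauL2 hB (w n) := by
    have h1 := hlim'.cauchySeq
    rw [Metric.cauchySeq_iff'] at h1 ⊢
    intro ε hε
    obtain ⟨N, hN⟩ := h1 (d * ε) (by positivity)
    refine ⟨N, fun n hn => ?_⟩
    have h2 := hN n hn
    rw [dist_eq_norm, ← map_sub] at h2 ⊢
    have h3 := le_norm_landauK_sub hB hd0.le hd (w n - w N)
    have e : landauK B (w n - w N) - (E : ℂ) • (w n - w N)
        = landauK B (w n) - (E : ℂ) • w n - (landauK B (w N) - (E : ℂ) • w N) := by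
      rw [map_sub, smul_sub]
      abel
    rw [e] at h3
    exact lt_of_mul_lt_mul_left (h3.trans_lt h2) hd0.le
  obtain ⟨u, hu⟩ := cauchySeq_tendsto_of_complete hC
  -- Both `u` and `φ` solve `((p - A)² - E) u = η` weakly against test functions. Density of the
  -- range of `(p - A)² - E` on test functions makes this solution unique.
  have huφ : u = toL2 φ := by
    rw [← sub_eq_zero]
    have hz : ∀ v : L2Plane, ⟪u - toL2 φ, v⟫_ℂ = 0 := by
      intro v
      refine (denseRange_kinOp_sub hB hE).induction_on (p := fun v => ⟪u - toL2 φ, v⟫_ℂ = 0) v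
        (isClosed_eq (by fun_prop) continuous_const) fun θ => ?_
      simp only [LinearMap.sub_apply, LinearMap.comp_apply, LinearMap.smul_apply]
      have h1 : Tendsto (fun n => ⟪landauL2 hB (landauK B (w n) - (E : ℂ) • w n), toL2 θ⟫_ℂ) atTop
          (𝓝 ⟪u, toL2 (kinOp B θ) - (E : ℂ) • toL2 θ⟫_ℂ) := by
        refine (hu.inner tendsto_const_nhds).congr fun n => ?_
        obtain ⟨χ, h2, h3⟩ := exists_tendsto_landauL2 hB (w n)
        rw [map_sub, map_smul]
        refine tendsto_nhds_unique (h2.inner tendsto_const_nhds)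
          (((h3.sub (h2.const_smul (E : ℂ))).inner tendsto_const_nhds).congr fun k => ?_)
        rw [inner_sub_left, inner_sub_right, inner_smul_left, inner_smul_right, inner_kinOp,
          Complex.conj_ofReal]
      have h4 := tendsto_nhds_unique h1 (hlim'.inner tendsto_const_nhds)
      rw [inner_sub_left, h4, hη, inner_sub_left, inner_sub_right, inner_smul_left,
        inner_smul_right, inner_kinOp, Complex.conj_ofReal, sub_self]
    exact inner_self_eq_zero.1 (hz _)
  rw [← huφ]
  exact le_of_tendsto_of_tendsto' (hu.norm.const_mul d) hlim'.norm fun n =>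
    le_norm_landauK_sub hB hd0.le hd (w n)

/-! ### Essential self-adjointness -/

theorem denseRange_of_inner (A : TestFn →ₗ[ℂ] L2Plane)
    (h : ∀ u, (∀ φ, ⟪A φ, u⟫_ℂ = 0) → u = 0) : DenseRange A := by
  have h : (LinearMap.range A).topologicalClosure = ⊤ := by
    rw [Submodule.topologicalClosure_eq_top_iff, Submodule.eq_bot_iff]
    exact fun u hu => h u fun φ => hu _ ⟨φ, rfl⟩
  intro u
  have hu : u ∈ (LinearMap.range A).topologicalClosure := h ▸ Submodule.mem_top
  exact hu

/-- Density of the range is stable under relatively small perturbations. -/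
theorem denseRange_add {A S : TestFn →ₗ[ℂ] L2Plane} (hA : DenseRange A) {θ : ℝ} (hθ : θ < 1)
    (hS : ∀ φ, ‖S φ‖ ≤ θ * ‖A φ‖) : DenseRange (A + S) := by
  refine denseRange_of_inner _ fun u hu => ?_
  -- For `u` orthogonal to the range of `A + S`, the pairing with `A φ` equals minus the pairing
  -- with `S φ`. The bound extends to all `w` by density, and `w = u` forces `u = 0` since `θ < 1`.
  have h : ∀ w, ‖⟪w, u⟫_ℂ‖ ≤ θ * ‖w‖ * ‖u‖ := by
    refine fun w => hA.induction_on (p := fun w => ‖⟪w, u⟫_ℂ‖ ≤ θ * ‖w‖ * ‖u‖) w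
      (isClosed_le (by fun_prop) (by fun_prop)) fun φ => ?_
    have h1 := hu φ
    rw [LinearMap.add_apply, inner_add_left] at h1
    rw [eq_neg_of_add_eq_zero_left h1, norm_neg]
    exact (norm_inner_le_norm _ _).trans (mul_le_mul_of_nonneg_right (hS φ) (norm_nonneg _))
  have h2 := h u
  rw [inner_self_eq_norm_sq_to_K, norm_pow, RCLike.norm_ofReal, abs_norm] at h2
  by_contra hne
  have : 0 < ‖u‖ := norm_pos_iff.2 hne
  nlinarith [mul_pos this this]

theorem mul_norm_le_of_inner {c : ℝ} {u w : L2Plane} (h : c * ‖u‖ ^ 2 ≤ (⟪u, w⟫_ℂ).re) :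
    c * ‖u‖ ≤ ‖w‖ := by
  rcases eq_or_ne u 0 with rfl | hu
  · simp
  · have h1 := h.trans ((Complex.re_le_norm _).trans (norm_inner_le_norm u w))
    have h2 : 0 < ‖u‖ := norm_pos_iff.2 hu
    exact le_of_mul_le_mul_left (by linarith [sq ‖u‖]) h2

/-- The operator `(p - A)² + V + λ` on test functions. -/
def shiftedOp (B : ℝ) (V : ℝ × ℝ → ℝ) (hV : IsPotential V) (lam : ℝ) : TestFn →ₗ[ℂ] L2Plane :=
  hamOp B V hV + (lam : ℂ) • toL2

theorem shiftedOp_apply (B : ℝ) {V : ℝ × ℝ → ℝ} (hV : IsPotential V) (lam : ℝ) (φ : TestFn) :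
    shiftedOp B V hV lam φ = hamOp B V hV φ + (lam : ℂ) • toL2 φ := rfl

theorem inner_shiftedOp_self (B : ℝ) {V : ℝ × ℝ → ℝ} (hV : IsPotential V) (lam : ℝ)
    (φ : TestFn) : (⟪toL2 φ, shiftedOp B V hV lam φ⟫_ℂ).re
      = (⟪toL2 φ, hamOp B V hV φ⟫_ℂ).re + lam * ‖toL2 φ‖ ^ 2 := by
  rw [shiftedOp_apply, inner_add_right, inner_smul_right, Complex.add_re, Complex.re_ofReal_mul]
  congr 2
  exact (norm_sq_eq_re_inner (𝕜 := ℂ) _).symm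

theorem norm_sq_le_inner_shiftedOp (B : ℝ) {V : ℝ × ℝ → ℝ} (hV : IsPotential V) {δ : ℝ}
    (h : ∀ q, -δ ≤ V q) (lam : ℝ) (φ : TestFn) :
    ‖toL2 (kinXOp B φ)‖ ^ 2 + ‖toL2 (kinYOp φ)‖ ^ 2 + (lam - δ) * ‖toL2 φ‖ ^ 2
      ≤ (⟪toL2 φ, shiftedOp B V hV lam φ⟫_ℂ).re := by
  rw [inner_shiftedOp_self]
  linarith [norm_kin_sq_le B hV h φ]

theorem le_norm_shiftedOp (B : ℝ) {V : ℝ × ℝ → ℝ} (hV : IsPotential V) {δ : ℝ}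
    (h : ∀ q, -δ ≤ V q) (lam : ℝ) (φ : TestFn) :
    (lam - δ) * ‖toL2 φ‖ ≤ ‖shiftedOp B V hV lam φ‖ :=
  mul_norm_le_of_inner (by
    linarith [norm_sq_le_inner_shiftedOp B hV h lam φ, sq_nonneg ‖toL2 (kinXOp B φ)‖,
      sq_nonneg ‖toL2 (kinYOp φ)‖])

theorem denseRange_shiftedOp_of_bdd {B : ℝ} (hB : 0 < B) {V : ℝ × ℝ → ℝ} (hV : IsPotential V)
    {c δ lam : ℝ} (hc : ∀ q, |V q| ≤ c) (h : ∀ q, -δ ≤ V q) (hδ : 0 ≤ δ) (hlam : δ < lam) :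
    DenseRange (shiftedOp B V hV lam) := by
  have hc0 : 0 ≤ c := (abs_nonneg _).trans (hc 0)
  -- The point `-M` lies below every Landau level, and `M > c` makes `V` small relative to `(p - A)²
  -- + M`, with relative bound `c / M`.
  set M : ℝ := c + lam + 1 with hM
  have hM0 : 0 < M := by linarith
  have h1 := denseRange_kinOp_sub hB (E := -M) fun n => by
    have : 0 < (2 * (n : ℝ) + 1) * B := by positivity
    linarith
  have h2 : DenseRange (shiftedOp B V hV M) := by
    have h3 := denseRange_add (S := potOp V hV) h1 (θ := c / M) ((div_lt_one hM0).2 (by linarith))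
      fun φ => by
        have h4 : M * ‖toL2 φ‖ ≤ ‖(toL2 ∘ₗ kinOp B - ((-M : ℝ) : ℂ) • toL2) φ‖ := by
          refine mul_norm_le_of_inner ?_
          rw [LinearMap.sub_apply, LinearMap.comp_apply, LinearMap.smul_apply, inner_sub_right,
            inner_smul_right, Complex.sub_re, Complex.re_ofReal_mul, inner_kinOp_self]
          have h5 : (⟪toL2 φ, toL2 φ⟫_ℂ).re = ‖toL2 φ‖ ^ 2 :=
            (norm_sq_eq_re_inner (𝕜 := ℂ) _).symm
          rw [h5]
          nlinarith [sq_nonneg ‖toL2 (kinXOp B φ)‖, sq_nonneg ‖toL2 (kinYOp φ)‖]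
        refine (norm_potOp_le hV hc φ).trans ?_
        rw [div_mul_eq_mul_div, le_div_iff₀ hM0]
        nlinarith
    have e : toL2 ∘ₗ kinOp B - ((-M : ℝ) : ℂ) • toL2 + potOp V hV = shiftedOp B V hV M := by
      rw [shiftedOp, hamOp, Complex.ofReal_neg]
      module
    rwa [e] at h3
  have hMd : 0 < M - δ := by linarith
  -- A second perturbation lowers the shift from `M` to `lam`; the relative bound is below `1`
  -- exactly because `δ < lam`.
  have h3 := denseRange_add (S := (((lam - M : ℝ)) : ℂ) • toL2) h2 (θ := (M - lam) / (M - δ))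
    ((div_lt_one hMd).2 (by linarith)) fun φ => by
      rw [LinearMap.smul_apply, norm_smul, Complex.norm_real, Real.norm_of_nonpos (by linarith),
        div_mul_eq_mul_div, le_div_iff₀ hMd]
      have := le_norm_shiftedOp B hV h M φ
      nlinarith
  have e : shiftedOp B V hV M + (((lam - M : ℝ)) : ℂ) • toL2 = shiftedOp B V hV lam := by
    rw [shiftedOp, shiftedOp, Complex.ofReal_sub]
    module
  rwa [e] at h3

theorem kinOp_mulOp (B : ℝ) {m : ℝ × ℝ → ℂ} (hm : ContDiff ℝ ∞ m) (φ : TestFn) :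
    kinOp B (mulOp m hm φ) = mulOp m hm (kinOp B φ)
      + ((2 : ℂ) • mulOp _ (contDiff_pd hm (1, 0)) (kinXOp B φ)
        + (2 : ℂ) • mulOp _ (contDiff_pd hm (0, 1)) (kinYOp φ)
        + mulOp _ (contDiff_pd (contDiff_pd hm (1, 0)) (1, 0)) φ
        + mulOp _ (contDiff_pd (contDiff_pd hm (0, 1)) (0, 1)) φ) := by
  simp only [kinOp, LinearMap.add_apply, LinearMap.comp_apply, kinXOp_mulOp, kinYOp_mulOp, map_add]
  module

theorem potOp_mulOp {V V' : ℝ × ℝ → ℝ} (hV : IsPotential V) (hV' : IsPotential V')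
    {m : ℝ × ℝ → ℂ} (hm : ContDiff ℝ ∞ m) (h0 : IsBddMeas m)
    (h : ∀ q, m q ≠ 0 → V q = V' q) (φ : TestFn) :
    potOp V hV (mulOp m hm φ) = mulL2 m h0 (potOp V' hV' φ) := by
  refine Lp.ext ?_
  filter_upwards [coeFn_potOp hV (mulOp m hm φ), coeFn_mulL2 h0 (potOp V' hV' φ),
    coeFn_potOp hV' φ] with q h1 h2 h3
  rw [h1, h2, Pi.mul_apply, h3, coe_mulOp, Pi.mul_apply]
  by_cases hq : m q = 0
  · simp [hq]
  · rw [h q hq]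
    ring

/-- Two potentials are allowed so that a truncated potential can be exchanged for the full one on
the support of the cutoff. -/
theorem hamOp_mulOp (B : ℝ) {V V' : ℝ × ℝ → ℝ} (hV : IsPotential V) (hV' : IsPotential V')
    {m : ℝ × ℝ → ℂ} (hm : ContDiff ℝ ∞ m) (h0 : IsBddMeas m) (h1 : ∀ v, IsBddMeas (pd v m))
    (h2 : ∀ v w, IsBddMeas (pd v (pd w m))) (h : ∀ q, m q ≠ 0 → V q = V' q) (φ : TestFn) :
    hamOp B V hV (mulOp m hm φ) = mulL2 m h0 (hamOp B V' hV' φ)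
      + ((2 : ℂ) • mulL2 _ (h1 (1, 0)) (toL2 (kinXOp B φ))
        + (2 : ℂ) • mulL2 _ (h1 (0, 1)) (toL2 (kinYOp φ))
        + mulL2 _ (h2 (1, 0) (1, 0)) (toL2 φ) + mulL2 _ (h2 (0, 1) (0, 1)) (toL2 φ)) := by
  simp only [hamOp, LinearMap.add_apply, LinearMap.comp_apply, kinOp_mulOp,
    potOp_mulOp hV hV' hm h0 h, map_add, map_smul, mulL2_toL2 h0 hm,
    mulL2_toL2 (h1 _) (contDiff_pd hm _), mulL2_toL2 (h2 _ _) (contDiff_pd (contDiff_pd hm _) _)]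
  module

theorem IsPotential.indicator {V : ℝ × ℝ → ℝ} (hV : IsPotential V) (r : ℝ) :
    IsPotential ((Metric.closedBall 0 r).indicator V) := by
  refine ⟨hV.measurable.indicator Metric.isClosed_closedBall.measurableSet, fun s => ?_⟩
  obtain ⟨C, hC⟩ := hV.locBdd s
  refine ⟨C, fun q hq => ?_⟩
  by_cases h : q ∈ Metric.closedBall (0 : ℝ × ℝ) r
  · rw [Set.indicator_of_mem h]
    exact hC q hq
  · rw [Set.indicator_of_notMem h, abs_zero]
    exact (abs_nonneg _).trans (hC q hq)

theorem norm_sq_kin_le_shiftedOp (B : ℝ) {V : ℝ × ℝ → ℝ} (hV : IsPotential V) {δ : ℝ}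
    (h : ∀ q, -δ ≤ V q) (φ : TestFn) :
    ‖toL2 (kinXOp B φ)‖ ^ 2 + ‖toL2 (kinYOp φ)‖ ^ 2 + ‖toL2 φ‖ ^ 2
      ≤ ‖shiftedOp B V hV (δ + 1) φ‖ ^ 2 := by
  have h1 := norm_sq_le_inner_shiftedOp B hV h (δ + 1) φ
  have h2 := le_norm_shiftedOp B hV h (δ + 1) φ
  rw [add_sub_cancel_left, one_mul] at h1 h2
  refine h1.trans (((Complex.re_le_norm _).trans (norm_inner_le_norm _ _)).trans ?_)
  rw [sq]
  exact mul_le_mul_of_nonneg_right h2 (norm_nonneg _)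

/-- `(p - A)² + V` is essentially self-adjoint on test functions. -/
theorem denseRange_shiftedOp {B : ℝ} (hB : 0 < B) {V : ℝ × ℝ → ℝ} (hV : IsPotential V) {δ : ℝ}
    (h : ∀ q, -δ ≤ V q) (hδ : 0 ≤ δ) : DenseRange (shiftedOp B V hV (δ + 1)) := by
  intro u
  obtain ⟨m, hm, hmc⟩ := exists_isCutoff_hasCompactSupport
  have hr : ∀ n : ℕ, ∃ r, ∀ q ∈ tsupport (scaled m n), ‖q‖ ≤ r := fun n =>
    (hasCompactSupport_scaled hmc n).isCompact.isBounded.exists_norm_le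
  choose r hr using hr
  -- The potential is truncated outside a ball containing the support of the `n`-th cutoff. The
  -- bounded case then gives an approximate solution `φₙ` for `W n`, and the cutoff times `φₙ` is an
  -- approximate solution for `V`.
  set W : ℕ → ℝ × ℝ → ℝ := fun n => (Metric.closedBall 0 (r n)).indicator V with hW
  have hWa : ∀ n q, W n q = (Metric.closedBall 0 (r n)).indicator V q := fun _ _ => rfl
  have hWp : ∀ n, IsPotential (W n) := fun n => hV.indicator _
  have hWδ : ∀ n q, -δ ≤ W n q := by
    intro n q
    by_cases hq : q ∈ Metric.closedBall (0 : ℝ × ℝ) (r n)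
    · rw [hWa, Set.indicator_of_mem hq]
      exact h q
    · rw [hWa, Set.indicator_of_notMem hq]
      linarith
  have hd : ∀ n, ∃ φ, ‖shiftedOp B (W n) (hWp n) (δ + 1) φ - u‖ ≤ ((n : ℝ) + 1)⁻¹ := by
    intro n
    obtain ⟨C, hC⟩ := hV.locBdd (r n)
    have hC' : ∀ q, |W n q| ≤ max C 0 := by
      intro q
      by_cases hq : q ∈ Metric.closedBall (0 : ℝ × ℝ) (r n)
      · rw [hWa, Set.indicator_of_mem hq]
        exact (hC q (by simpa using hq)).trans (le_max_left _ _)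
      · rw [hWa, Set.indicator_of_notMem hq, abs_zero]
        exact le_max_right _ _
    obtain ⟨φ, hφ⟩ := (denseRange_shiftedOp_of_bdd hB (hWp n) hC' (hWδ n) hδ
      (lt_add_one δ)).exists_dist_lt u (ε := ((n : ℝ) + 1)⁻¹) (by positivity)
    rw [dist_comm, dist_eq_norm] at hφ
    exact ⟨φ, hφ.le⟩
  choose φ hφ using hd
  have hinv : Tendsto (fun n : ℕ => ((n : ℝ) + 1)⁻¹) atTop (𝓝 0) := by
    simpa using tendsto_one_div_add_atTop_nhds_zero_nat (𝕜 := ℝ)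
  set w : ℕ → L2Plane := fun n => shiftedOp B (W n) (hWp n) (δ + 1) (φ n) with hw
  have hwu : Tendsto w atTop (𝓝 u) := by
    rw [tendsto_iff_norm_sub_tendsto_zero]
    exact squeeze_zero (fun n => norm_nonneg _) hφ hinv
  have hwb : ∀ n, ‖w n‖ ≤ ‖u‖ + 1 := by
    intro n
    have h1 : ((n : ℝ) + 1)⁻¹ ≤ 1 :=
      inv_le_one_of_one_le₀ (by linarith [n.cast_nonneg (α := ℝ)])
    linarith [norm_le_norm_add_norm_sub u (w n), norm_sub_rev u (w n), hφ n]
  -- The bounds on `φₙ` and its kinetic momenta depend only on the lower bound `-δ`, hence are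
  -- uniform in the truncation. They make the cutoff errors vanish.
  have key := fun n => norm_sq_kin_le_shiftedOp B (hWp n) (hWδ n) (φ n)
  have hX : ∀ n, ‖toL2 (kinXOp B (φ n))‖ ≤ ‖u‖ + 1 := fun n =>
    (le_of_sq_le_sq (by nlinarith [key n]) (norm_nonneg _)).trans (hwb n)
  have hY : ∀ n, ‖toL2 (kinYOp (φ n))‖ ≤ ‖u‖ + 1 := fun n =>
    (le_of_sq_le_sq (by nlinarith [key n]) (norm_nonneg _)).trans (hwb n)
  have h0 : ∀ n, ‖toL2 (φ n)‖ ≤ ‖u‖ + 1 := fun n =>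
    (le_of_sq_le_sq (by nlinarith [key n]) (norm_nonneg _)).trans (hwb n)
  have hzero : ∀ {f : ℕ → ℝ × ℝ → ℂ} (hf : ∀ n, IsBddMeas (f n)) (v : ℕ → L2Plane),
      (∃ C, ∀ n q, ‖f n q‖ ≤ C * ((n : ℝ) + 1)⁻¹) → (∀ n, ‖v n‖ ≤ ‖u‖ + 1) →
      Tendsto (fun n => mulL2 (f n) (hf n) (v n)) atTop (𝓝 0) := by
    rintro f hf v ⟨C, hC⟩ hv
    have hC0 : 0 ≤ C := by simpa using (norm_nonneg _).trans (hC 0 0)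
    refine squeeze_zero_norm (fun n => (norm_mulL2_le (hf n) (hC n) (v n)).trans
      (mul_le_mul_of_nonneg_left (hv n) (by positivity))) ?_
    simpa using (hinv.const_mul C).mul_const (‖u‖ + 1)
  have hm0 : Tendsto (fun n => mulL2 (scaled m n) (hm.isBddMeas_scaled n) (w n)) atTop (𝓝 u) := by
    obtain ⟨C, hC⟩ := hm.bdd
    have h1 : Tendsto (fun n => mulL2 (scaled m n) (hm.isBddMeas_scaled n) (w n - u)) atTop
        (𝓝 0) := by
      refine squeeze_zero_norm (fun n => norm_mulL2_le _ (fun q => hC _) (w n - u)) ?_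
      simpa using (tendsto_iff_norm_sub_tendsto_zero.1 hwu).const_mul C
    have h2 := h1.add (hm.tendsto_mulL2_scaled u)
    simpa only [map_sub, sub_add_cancel, zero_add] using h2
  have hlim := hm0.add ((((hzero (hm.isBddMeas_pd_scaled (1, 0)) _ (hm.norm_pd_scaled_le _)
      hX).const_smul (2 : ℂ)).add ((hzero (hm.isBddMeas_pd_scaled (0, 1)) _
      (hm.norm_pd_scaled_le _) hY).const_smul (2 : ℂ))).add (hzero
      (hm.isBddMeas_pd_pd_scaled (1, 0) (1, 0)) _ (hm.norm_pd_pd_scaled_le _ _) h0) |>.add (hzero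
      (hm.isBddMeas_pd_pd_scaled (0, 1) (0, 1)) _ (hm.norm_pd_pd_scaled_le _ _) h0))
  simp only [smul_zero, add_zero] at hlim
  refine mem_closure_of_tendsto hlim (Eventually.of_forall fun n =>
    ⟨mulOp (scaled m n) (contDiff_scaled hm.smooth n) (φ n), ?_⟩)
  rw [shiftedOp_apply, hamOp_mulOp B hV (hWp n) (contDiff_scaled hm.smooth n)
    (hm.isBddMeas_scaled n) (fun v => hm.isBddMeas_pd_scaled v n)
    (fun v w => hm.isBddMeas_pd_pd_scaled v w n), ← mulL2_toL2 (hm.isBddMeas_scaled n),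
    show w n = _ from shiftedOp_apply B (hWp n) (δ + 1) (φ n), map_add, map_smul]
  · abel
  · intro q hq
    rw [hWa, Set.indicator_of_mem]
    simpa using hr n q (subset_tsupport _ hq)

/-! ### The resolvent of the Hamiltonian -/

/-- The resolvent `(H + δ + 1)⁻¹`. -/
def resolvent (B : ℝ) (V : ℝ × ℝ → ℝ) (hV : IsPotential V) (δ : ℝ) : L2Plane →L[ℂ] L2Plane :=
  toL2.extendOfNorm (shiftedOp B V hV (δ + 1))

/-- The bounded operator `(p_x - A_x) (H + δ + 1)⁻¹`. -/
def kinXRes (B : ℝ) (V : ℝ × ℝ → ℝ) (hV : IsPotential V) (δ : ℝ) : L2Plane →L[ℂ] L2Plane :=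
  (toL2 ∘ₗ kinXOp B).extendOfNorm (shiftedOp B V hV (δ + 1))

/-- The bounded operator `p_y (H + δ + 1)⁻¹`. -/
def kinYRes (B : ℝ) (V : ℝ × ℝ → ℝ) (hV : IsPotential V) (δ : ℝ) : L2Plane →L[ℂ] L2Plane :=
  (toL2 ∘ₗ kinYOp).extendOfNorm (shiftedOp B V hV (δ + 1))

/-- The form of the commutator `[H, iΠ]` in terms of `w = (H + δ + 1) ψ`. -/
def commForm (B : ℝ) (V : ℝ × ℝ → ℝ) (hV : IsPotential V) (δ : ℝ) (w : L2Plane) : ℝ :=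
  -2 * (⟪w - ((δ + 1 : ℝ) : ℂ) • resolvent B V hV δ w, kinYRes B V hV δ w⟫_ℂ).im
    + 2 * B * (⟪kinXRes B V hV δ w, resolvent B V hV δ w⟫_ℂ).re

theorem continuous_commForm (B : ℝ) {V : ℝ × ℝ → ℝ} (hV : IsPotential V) (δ : ℝ) :
    Continuous (commForm B V hV δ) := by
  have h1 : Continuous fun w => w - ((δ + 1 : ℝ) : ℂ) • resolvent B V hV δ w := by fun_prop
  have h2 : Continuous fun w => ⟪w - ((δ + 1 : ℝ) : ℂ) • resolvent B V hV δ w,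
    kinYRes B V hV δ w⟫_ℂ := h1.inner (kinYRes B V hV δ).continuous
  have h3 : Continuous fun w => ⟪kinXRes B V hV δ w, resolvent B V hV δ w⟫_ℂ :=
    (kinXRes B V hV δ).continuous.inner (resolvent B V hV δ).continuous
  exact (continuous_const.mul (Complex.continuous_im.comp h2)).add
    (continuous_const.mul (Complex.continuous_re.comp h3))

theorem shiftedOp_sub (B : ℝ) {V : ℝ × ℝ → ℝ} (hV : IsPotential V) (lam : ℝ) (φ : TestFn) :
    shiftedOp B V hV lam φ - (lam : ℂ) • toL2 φ = hamOp B V hV φ :=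
  add_sub_cancel_right _ _

theorem im_inner_eq_zero {S : TestFn → TestFn}
    (hS : ∀ φ ψ, ⟪toL2 (S φ), toL2 ψ⟫_ℂ = ⟪toL2 φ, toL2 (S ψ)⟫_ℂ) (φ : TestFn) :
    (⟪toL2 φ, toL2 (S φ)⟫_ℂ).im = 0 := by
  have h := hS φ φ
  rw [← inner_conj_symm, Complex.conj_eq_iff_im] at h
  exact h

/-- This explains the shape of `commForm`. Using `p_y` in place of `Π` avoids the unbounded `B x`
but leaves the term `B Re ⟪(p_x + B y) φ, φ⟫`, which the second summand of `commForm` cancels. -/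
theorem im_inner_hamOp_kinYOp (B : ℝ) {V : ℝ × ℝ → ℝ} (hV : IsPotential V) (φ : TestFn) :
    (⟪hamOp B V hV φ, toL2 (kinYOp φ)⟫_ℂ).im
      = B * (⟪toL2 (kinXOp B φ), toL2 φ⟫_ℂ).re + (⟪potOp V hV φ, toL2 (kinYOp φ)⟫_ℂ).im := by
  simp only [hamOp, kinOp, LinearMap.add_apply, LinearMap.comp_apply, map_add, inner_add_left,
    Complex.add_im]
  rw [inner_kinXOp, inner_kinYOp, kinXOp_kinYOp, map_add, map_smul, inner_add_right,
    inner_smul_right, Complex.add_im, im_inner_eq_zero inner_kinYOp,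
    im_inner_eq_zero inner_kinYOp]
  simp

/-- The kinetic part drops out because `Π` commutes with it and the kinetic momenta and `Π` are
symmetric; the `B x` part of `Π` commutes with `V` and contributes a real number. -/
theorem im_inner_hamOp_guidingOp (B : ℝ) {V : ℝ × ℝ → ℝ} (hV : IsPotential V) (φ : TestFn) :
    (⟪hamOp B V hV φ, toL2 (guidingOp B φ)⟫_ℂ).im
      = (⟪potOp V hV φ, toL2 (kinYOp φ)⟫_ℂ).im := by
  have h : (⟪potOp V hV φ, toL2 (mulOp (magX B) (contDiff_magX B) φ)⟫_ℂ).im = 0 := by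
    rw [inner_potOp_left]
    have e : (fun q => (V q : ℂ) * (starRingEnd ℂ ((φ : ℝ × ℝ → ℂ) q)
        * (mulOp (magX B) (contDiff_magX B) φ : ℝ × ℝ → ℂ) q))
        = fun q => ((V q * (B * q.1) * ‖(φ : ℝ × ℝ → ℂ) q‖ ^ 2 : ℝ) : ℂ) := by
      funext q
      rw [coe_mulOp, Pi.mul_apply, mul_left_comm (starRingEnd ℂ _), Complex.conj_mul']
      simp only [magX]
      push_cast
      ring
    rw [e, integral_complex_ofReal, Complex.ofReal_im]
  simp only [hamOp, kinOp, LinearMap.add_apply, LinearMap.comp_apply, map_add, inner_add_left,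
    Complex.add_im]
  rw [inner_kinXOp, inner_kinYOp, kinXOp_guidingOp, kinYOp_guidingOp,
    im_inner_eq_zero (inner_guidingOp B), im_inner_eq_zero (inner_guidingOp B), guidingOp,
    LinearMap.add_apply, map_add, inner_add_right, Complex.add_im, h]
  ring

/-- On test functions the commutator is `-∂_y V` in the sense of distributions. -/
theorem im_inner_potOp_kinYOp {V : ℝ × ℝ → ℝ} (hV : IsPotential V) (φ : TestFn) :
    -2 * (⟪potOp V hV φ, toL2 (kinYOp φ)⟫_ℂ).im
      = ∫ q, V q * fderiv ℝ (fun r => ‖(φ : ℝ × ℝ → ℂ) r‖ ^ 2) q (0, 1) := by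
  have hi : Integrable (fun q => (V q : ℂ) * (starRingEnd ℂ ((φ : ℝ × ℝ → ℂ) q)
      * (kinYOp φ : ℝ × ℝ → ℂ) q)) := by
    refine ((hV.memLp_mul φ).star.integrable_mul ((kinYOp φ).memLp 2)).congr
      (ae_of_all _ fun q => ?_)
    simp [mul_assoc]
  rw [inner_potOp_left]
  have e := integral_im hi
  rw [RCLike.im_to_complex] at e
  rw [← e, ← integral_const_mul]
  refine integral_congr_ae (ae_of_all _ fun q => ?_)
  have hd : HasFDerivAt (φ : ℝ × ℝ → ℂ) (fderiv ℝ (φ : ℝ × ℝ → ℂ) q) q :=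
    ((φ.contDiff.differentiable (by simp)) q).hasFDerivAt
  have hn := (hd.norm_sq).fderiv
  simp only [hn]
  simp only [coe_kinYOp, py, RCLike.im_to_complex, Complex.im_ofReal_mul]
  simp [Complex.inner]
  ring

section Resolvent

variable {B : ℝ} (hB : 0 < B) {V : ℝ × ℝ → ℝ} (hV : IsPotential V) {δ : ℝ}
  (h : ∀ q, -δ ≤ V q) (hδ : 0 ≤ δ)

include h in
theorem norm_le_shiftedOp (φ : TestFn) :
    ‖toL2 φ‖ ≤ 1 * ‖shiftedOp B V hV (δ + 1) φ‖ ∧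
      ‖toL2 (kinXOp B φ)‖ ≤ 1 * ‖shiftedOp B V hV (δ + 1) φ‖ ∧
        ‖toL2 (kinYOp φ)‖ ≤ 1 * ‖shiftedOp B V hV (δ + 1) φ‖ := by
  have key := norm_sq_kin_le_shiftedOp B hV h φ
  simp only [one_mul]
  refine ⟨?_, ?_, ?_⟩ <;> refine le_of_sq_le_sq ?_ (norm_nonneg _) <;>
    nlinarith [sq_nonneg ‖toL2 φ‖, sq_nonneg ‖toL2 (kinXOp B φ)‖, sq_nonneg ‖toL2 (kinYOp φ)‖]

include hB hV h hδ

theorem resolvent_shiftedOp (φ : TestFn) :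
    resolvent B V hV δ (shiftedOp B V hV (δ + 1) φ) = toL2 φ :=
  LinearMap.extendOfNorm_eq (denseRange_shiftedOp hB hV h hδ)
    ⟨1, fun φ => (norm_le_shiftedOp hV h φ).1⟩ φ

theorem kinXRes_shiftedOp (φ : TestFn) :
    kinXRes B V hV δ (shiftedOp B V hV (δ + 1) φ) = toL2 (kinXOp B φ) :=
  LinearMap.extendOfNorm_eq (f := toL2 ∘ₗ kinXOp B) (denseRange_shiftedOp hB hV h hδ)
    ⟨1, fun φ => (norm_le_shiftedOp hV h φ).2.1⟩ φ

theorem kinYRes_shiftedOp (φ : TestFn) :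
    kinYRes B V hV δ (shiftedOp B V hV (δ + 1) φ) = toL2 (kinYOp φ) :=
  LinearMap.extendOfNorm_eq (f := toL2 ∘ₗ kinYOp) (denseRange_shiftedOp hB hV h hδ)
    ⟨1, fun φ => (norm_le_shiftedOp hV h φ).2.2⟩ φ

theorem exists_tendsto_shiftedOp (w : L2Plane) :
    ∃ φ : ℕ → TestFn, Tendsto (fun n => shiftedOp B V hV (δ + 1) (φ n)) atTop (𝓝 w) ∧
      Tendsto (fun n => toL2 (φ n)) atTop (𝓝 (resolvent B V hV δ w)) ∧
      Tendsto (fun n => toL2 (kinXOp B (φ n))) atTop (𝓝 (kinXRes B V hV δ w)) ∧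
      Tendsto (fun n => toL2 (kinYOp (φ n))) atTop (𝓝 (kinYRes B V hV δ w)) := by
  obtain ⟨x, hx, hlim⟩ := mem_closure_iff_seq_limit.1 (denseRange_shiftedOp hB hV h hδ w)
  choose φ hφ using hx
  obtain rfl : (fun n => shiftedOp B V hV (δ + 1) (φ n)) = x := funext hφ
  refine ⟨φ, hlim, ?_, ?_, ?_⟩
  · simpa only [Function.comp_def, resolvent_shiftedOp hB hV h hδ] using
      ((resolvent B V hV δ).continuous.tendsto w).comp hlim
  · simpa only [Function.comp_def, kinXRes_shiftedOp hB hV h hδ] using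
      ((kinXRes B V hV δ).continuous.tendsto w).comp hlim
  · simpa only [Function.comp_def, kinYRes_shiftedOp hB hV h hδ] using
      ((kinYRes B V hV δ).continuous.tendsto w).comp hlim

theorem mem_graph_hamiltonian_iff_resolvent (ψ η : L2Plane) :
    (ψ, η) ∈ (hamiltonian B V).graph
      ↔ resolvent B V hV δ (η + ((δ + 1 : ℝ) : ℂ) • ψ) = ψ := by
  rw [mem_graph_hamiltonian B hV]
  constructor
  · rintro ⟨φ, h1, h2⟩
    have h3 := ((resolvent B V hV δ).continuous.tendsto _).comp
      (h2.add (h1.const_smul ((δ + 1 : ℝ) : ℂ)))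
    simp only [Function.comp_def, ← shiftedOp_apply, resolvent_shiftedOp hB hV h hδ] at h3
    exact tendsto_nhds_unique h3 h1
  · intro he
    obtain ⟨φ, h1, h2, -, -⟩ :=
      exists_tendsto_shiftedOp hB hV h hδ (η + ((δ + 1 : ℝ) : ℂ) • ψ)
    rw [he] at h2
    refine ⟨φ, h2, ?_⟩
    have h3 := h1.sub (h2.const_smul ((δ + 1 : ℝ) : ℂ))
    simpa only [shiftedOp_sub, add_sub_cancel_right] using h3

theorem isSelfAdjoint_resolvent : IsSelfAdjoint (resolvent B V hV δ) := by
  rw [ContinuousLinearMap.isSelfAdjoint_iff_isSymmetric]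
  intro w w'
  refine (denseRange_shiftedOp hB hV h hδ).induction_on₂
    (p := fun w w' => ⟪resolvent B V hV δ w, w'⟫_ℂ = ⟪w, resolvent B V hV δ w'⟫_ℂ)
    (isClosed_eq (by fun_prop) (by fun_prop)) (fun φ ψ => ?_) w w'
  rw [resolvent_shiftedOp hB hV h hδ, resolvent_shiftedOp hB hV h hδ, shiftedOp_apply,
    shiftedOp_apply, inner_add_left, inner_add_right, inner_hamOp, inner_smul_left,
    inner_smul_right, Complex.conj_ofReal]

theorem injective_resolvent : Function.Injective (resolvent B V hV δ) := by
  rw [injective_iff_map_eq_zero]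
  intro w hw
  refine eq_zero_of_inner_toL2 w fun φ => ?_
  have h1 := (ContinuousLinearMap.isSelfAdjoint_iff_isSymmetric.1
    (isSelfAdjoint_resolvent hB hV h hδ)) (shiftedOp B V hV (δ + 1) φ) w
  simp only [ContinuousLinearMap.coe_coe] at h1
  rwa [resolvent_shiftedOp hB hV h hδ, hw, inner_zero_right] at h1

/-- The Hamiltonian is self-adjoint: it has a spectral measure. -/
theorem exists_spectralMeasure_hamiltonian :
    ∃ P : PVM L2Plane, P.IsSpectralMeasureOf (hamiltonian B V) :=
  exists_isSpectralMeasureOf (isSelfAdjoint_resolvent hB hV h hδ)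
    (injective_resolvent hB hV h hδ) (δ + 1) (hamiltonian B V)
    (mem_graph_hamiltonian_iff_resolvent hB hV h hδ)

theorem commForm_shiftedOp (φ : TestFn) :
    commForm B V hV δ (shiftedOp B V hV (δ + 1) φ)
      = -2 * (⟪potOp V hV φ, toL2 (kinYOp φ)⟫_ℂ).im := by
  rw [commForm, resolvent_shiftedOp hB hV h hδ, kinXRes_shiftedOp hB hV h hδ,
    kinYRes_shiftedOp hB hV h hδ, shiftedOp_sub, im_inner_hamOp_kinYOp]
  ring

end Resolvent

/-! ### The commutator form -/

/-- A cutoff in `x` alone suffices: `H` already controls the `p_y` part of `Π`, and only `B x` has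
to be made bounded. -/
theorem exists_isCutoff_magX (B : ℝ) :
    ∃ m, IsCutoff m ∧ ∀ n, IsBddMeas (magX B * scaled m n) := by
  obtain ⟨f, hf, hfs, hf1, hf2, hfb⟩ := exists_bump_line
  have hm := isCutoff_comp_linear hf hfs hf1 (ContinuousLinearMap.fst ℝ ℝ ℝ)
  refine ⟨_, hm, fun n => ⟨((contDiff_magX B).continuous.mul
    (contDiff_scaled hm.smooth n).continuous).measurable, |B| * (2 * ((n : ℝ) + 1)), fun q => ?_⟩⟩
  have hn : (0 : ℝ) < (n : ℝ) + 1 := by positivity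
  rw [Pi.mul_apply, norm_mul, magX, Complex.norm_real, Real.norm_eq_abs, abs_mul, mul_assoc]
  refine mul_le_mul_of_nonneg_left ?_ (abs_nonneg _)
  by_cases hq : 2 ≤ |((n : ℝ) + 1)⁻¹ * q.1|
  · have : scaled (fun q => f (ContinuousLinearMap.fst ℝ ℝ ℝ q)) n q = 0 := hf2 _ hq
    rw [this, norm_zero, mul_zero]
    positivity
  · rw [not_le, abs_mul, abs_of_pos (inv_pos.2 hn), inv_mul_lt_iff₀ hn] at hq
    calc |q.1| * _ ≤ ((n + 1) * 2) * 1 :=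
          mul_le_mul hq.le (hfb _) (norm_nonneg _) (by positivity)
      _ = 2 * ((n : ℝ) + 1) := by ring

theorem tendsto_im_inner {u v : ℕ → L2Plane} {a b : L2Plane} (hu : Tendsto u atTop (𝓝 a))
    (hv : Tendsto v atTop (𝓝 b)) :
    Tendsto (fun n => -2 * (⟪u n, v n⟫_ℂ).im) atTop (𝓝 (-2 * (⟪a, b⟫_ℂ).im)) :=
  ((Complex.continuous_im.tendsto _).comp (hu.inner hv)).const_mul _

section CommutatorForm

variable {B : ℝ} (hB : 0 < B) {V : ℝ × ℝ → ℝ} (hV : IsPotential V) {δ : ℝ}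
  (h : ∀ q, -δ ≤ V q) (hδ : 0 ≤ δ)

include hB hV h hδ

/-- The commutator form after localization by a cutoff function which controls `x`. -/
theorem commForm_cutoff {m : ℝ × ℝ → ℂ} (hm : ContDiff ℝ ∞ m) (h0 : IsBddMeas m)
    (h1 : ∀ v, IsBddMeas (pd v m)) (h2 : ∀ v w, IsBddMeas (pd v (pd w m)))
    (hx : IsBddMeas (magX B * m)) {w ζ η : L2Plane}
    (hζ : (resolvent B V hV δ w, ζ) ∈ (guidingCenter B).graph)
    (hη : η = mulL2 m h0 (w - ((δ + 1 : ℝ) : ℂ) • resolvent B V hV δ w)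
      + ((2 : ℂ) • mulL2 _ (h1 (1, 0)) (kinXRes B V hV δ w)
        + (2 : ℂ) • mulL2 _ (h1 (0, 1)) (kinYRes B V hV δ w)
        + mulL2 _ (h2 (1, 0) (1, 0)) (resolvent B V hV δ w)
        + mulL2 _ (h2 (0, 1) (0, 1)) (resolvent B V hV δ w))) :
    commForm B V hV δ (η + ((δ + 1 : ℝ) : ℂ) • mulL2 m h0 (resolvent B V hV δ w))
      = -2 * (⟪η, mulL2 m h0 ζ + mulL2 _ (h1 (0, 1)) (resolvent B V hV δ w)⟫_ℂ).im := by
  obtain ⟨φ, hφ, hφ0, hφX, hφY⟩ := exists_tendsto_shiftedOp hB hV h hδ w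
  have hmul : ∀ {f : ℝ × ℝ → ℂ} (hf : IsBddMeas f) {u : ℕ → L2Plane} {a : L2Plane},
      Tendsto u atTop (𝓝 a) → Tendsto (fun n => mulL2 f hf (u n)) atTop (𝓝 (mulL2 f hf a)) :=
    fun hf _ a hu => ((mulL2 _ hf).continuous.tendsto a).comp hu
  have hH : Tendsto (fun n => hamOp B V hV (mulOp m hm (φ n))) atTop (𝓝 η) := by
    have h3 := hφ.sub (hφ0.const_smul ((δ + 1 : ℝ) : ℂ))
    simp only [shiftedOp_sub] at h3
    simp only [hamOp_mulOp B hV hV hm h0 h1 h2 (fun _ _ => rfl)]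
    rw [hη]
    exact (hmul h0 h3).add (((((hmul (h1 _) hφX).const_smul (2 : ℂ)).add
      ((hmul (h1 _) hφY).const_smul (2 : ℂ))).add (hmul (h2 _ _) hφ0)).add (hmul (h2 _ _) hφ0))
  have h0' : Tendsto (fun n => toL2 (mulOp m hm (φ n))) atTop
      (𝓝 (mulL2 m h0 (resolvent B V hV δ w))) := by
    simp only [← mulL2_toL2 h0]
    exact hmul h0 hφ0
  -- Two expressions for `Π (m φ)` are needed. This one passes to the limit along sequences
  -- converging in the graph of `Π`; the next, with `B x m` bounded, along sequences converging in
  -- the graph of `H`.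
  have hG : ∀ φ : TestFn, toL2 (guidingOp B (mulOp m hm φ))
      = mulL2 m h0 (toL2 (guidingOp B φ)) + mulL2 _ (h1 (0, 1)) (toL2 φ) := by
    intro φ
    rw [mulL2_toL2 h0 hm, mulL2_toL2 (h1 _) (contDiff_pd hm _), ← map_add]
    congr 1
    simp only [guidingOp, LinearMap.add_apply, kinYOp_mulOp, map_add, mulOp_comm m (magX B)]
    abel
  have hG' : ∀ φ : TestFn, toL2 (guidingOp B (mulOp m hm φ))
      = mulL2 m h0 (toL2 (kinYOp φ)) + mulL2 _ (h1 (0, 1)) (toL2 φ) + mulL2 _ hx (toL2 φ) := by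
    intro φ
    rw [mulL2_toL2 h0 hm, mulL2_toL2 (h1 _) (contDiff_pd hm _),
      mulL2_toL2 hx ((contDiff_magX B).mul hm), ← map_add, ← map_add, guidingOp,
      LinearMap.add_apply, kinYOp_mulOp, mulOp_mulOp]
  obtain ⟨χ, hχ1, hχ2⟩ := (mem_graph_guidingCenter B _ _).1 hζ
  have hmem : (mulL2 m h0 (resolvent B V hV δ w),
      mulL2 m h0 ζ + mulL2 _ (h1 (0, 1)) (resolvent B V hV δ w)) ∈ (guidingCenter B).graph := by
    rw [mem_graph_guidingCenter]
    refine ⟨fun n => mulOp m hm (χ n), ?_, ?_⟩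
    · simp only [← mulL2_toL2 h0]
      exact hmul h0 hχ1
    · simp only [hG]
      exact (hmul h0 hχ2).add (hmul (h1 _) hχ1)
  have hlim : Tendsto (fun n => toL2 (guidingOp B (mulOp m hm (φ n)))) atTop
      (𝓝 (mulL2 m h0 (kinYRes B V hV δ w) + mulL2 _ (h1 (0, 1)) (resolvent B V hV δ w)
        + mulL2 _ hx (resolvent B V hV δ w))) := by
    simp only [hG']
    exact ((hmul h0 hφY).add (hmul (h1 _) hφ0)).add (hmul hx hφ0)
  have hmem2 := (mem_graph_guidingCenter B _ _).2 ⟨fun n => mulOp m hm (φ n), h0', hlim⟩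
  -- The approximating sequences for `H` and for `Π` are unrelated. Their limits are identified
  -- because both lie in the graph of the closed operator `Π` over the same vector.
  rw [(guidingCenter B).mem_graph_snd_inj hmem2 hmem rfl] at hlim
  refine tendsto_nhds_unique (((continuous_commForm B hV δ).tendsto _).comp
    (hH.add (h0'.const_smul ((δ + 1 : ℝ) : ℂ)))) ?_
  refine (tendsto_im_inner hH hlim).congr fun n => ?_
  rw [Function.comp_apply, ← shiftedOp_apply, commForm_shiftedOp hB hV h hδ,
    im_inner_hamOp_guidingOp]

/-- After localization the formula is known; the cutoffs are removed by letting their scale tend to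
infinity, where all their derivative terms vanish and `commForm` is continuous. -/
theorem commForm_eq {w ζ : L2Plane}
    (hζ : (resolvent B V hV δ w, ζ) ∈ (guidingCenter B).graph) :
    commForm B V hV δ w
      = -2 * (⟪w - ((δ + 1 : ℝ) : ℂ) • resolvent B V hV δ w, ζ⟫_ℂ).im := by
  obtain ⟨m, hm, hx⟩ := exists_isCutoff_magX B
  have hlim1 := ((hm.tendsto_mulL2_scaled
    (w - ((δ + 1 : ℝ) : ℂ) • resolvent B V hV δ w)).add
      (((((hm.tendsto_mulL2_pd_scaled (1, 0) (kinXRes B V hV δ w)).const_smul (2 : ℂ)).add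
      ((hm.tendsto_mulL2_pd_scaled (0, 1) (kinYRes B V hV δ w)).const_smul (2 : ℂ))).add
      (hm.tendsto_mulL2_pd_pd_scaled (1, 0) (1, 0) (resolvent B V hV δ w))).add
      (hm.tendsto_mulL2_pd_pd_scaled (0, 1) (0, 1) (resolvent B V hV δ w))))
  have hlim2 := (hm.tendsto_mulL2_scaled ζ).add
    (hm.tendsto_mulL2_pd_scaled (0, 1) (resolvent B V hV δ w))
  have hlim3 := hlim1.add ((hm.tendsto_mulL2_scaled (resolvent B V hV δ w)).const_smul
    ((δ + 1 : ℝ) : ℂ))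
  simp only [smul_zero, add_zero, sub_add_cancel] at hlim1 hlim2 hlim3
  refine tendsto_nhds_unique (((continuous_commForm B hV δ).tendsto _).comp hlim3) ?_
  refine (tendsto_im_inner hlim1 hlim2).congr fun n => ?_
  exact (commForm_cutoff hB hV h hδ (contDiff_scaled hm.smooth n) (hm.isBddMeas_scaled n)
    (fun v => hm.isBddMeas_pd_scaled v n) (fun v w => hm.isBddMeas_pd_pd_scaled v w n) (hx n)
    hζ rfl).symm

end CommutatorForm

/-- Any subspace between the original domain and the domain of the closure is a core. Here the test
functions already lie in `D(H) ∩ D(Π)`. -/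
theorem hasCore_closure_of_le {f : L2Plane →ₗ.[ℂ] L2Plane} (hf : f.IsClosable)
    {S : Submodule ℂ L2Plane} (h1 : f.domain ≤ S) (h2 : S ≤ f.closure.domain) :
    f.closure.HasCore S := by
  refine ⟨h2, le_antisymm ?_ ?_⟩
  · have h3 := hf.closureIsClosable.closure_mono
      (LinearPMap.domRestrict_le : f.closure.domRestrict S ≤ f.closure)
    have h4 : f.closure.closure = f.closure := by
      refine LinearPMap.eq_of_eq_graph ?_
      rw [← hf.closureIsClosable.graph_closure_eq_closure_graph]
      exact hf.closure_isClosed.submodule_topologicalClosure_eq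
    rwa [h4] at h3
  · refine (hf.closureIsClosable.leIsClosable LinearPMap.domRestrict_le).closure_mono ?_
    refine ⟨fun x hx => ⟨h1 hx, f.le_closure.1 hx⟩, fun x y hxy => ?_⟩
    have hy : (y : L2Plane) ∈ f.closure.domain := y.2.2
    exact (f.le_closure.2 (y := ⟨y, hy⟩) hxy).trans
      (LinearPMap.domRestrict_apply (f := f.closure) (x := y) (y := ⟨y, hy⟩) rfl).symm

theorem domain_testOperator {L : (ℝ × ℝ → ℂ) → ℝ × ℝ → ℂ} (A : TestFn →ₗ[ℂ] L2Plane)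
    (hA : ∀ φ : TestFn, A φ =ᵐ[volume] L φ) :
    (testOperator L).domain = LinearMap.range toL2 := by
  ext x
  rw [LinearPMap.mem_domain_iff, graph_testOperator A hA]
  constructor
  · rintro ⟨y, φ, hφ⟩
    exact ⟨φ, congrArg Prod.fst hφ⟩
  · rintro ⟨φ, rfl⟩
    exact ⟨A φ, φ, rfl⟩

theorem hasCore_hamiltonian (B : ℝ) {V : ℝ × ℝ → ℝ} (hV : IsPotential V) :
    (hamiltonian B V).HasCore ((hamiltonian B V).domain ⊓ (guidingCenter B).domain) := by
  refine hasCore_closure_of_le (isClosable_testOperator _ (coeFn_hamOp B hV) (inner_hamOp B hV))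
    (le_inf (LinearPMap.le_closure _).1 ?_) inf_le_left
  rw [domain_testOperator _ (coeFn_hamOp B hV), ← domain_testOperator _ (coeFn_guidingOp B)]
  exact (LinearPMap.le_closure _).1

theorem isCommutatorForm_commForm {B : ℝ} (hB : 0 < B) {V : ℝ × ℝ → ℝ} (hV : IsPotential V)
    {δ : ℝ} (h : ∀ q, -δ ≤ V q) (hδ : 0 ≤ δ) :
    IsCommutatorForm (hamiltonian B V) (guidingCenter B) fun ψ =>
      commForm B V hV δ (hamiltonian B V ψ + ((δ + 1 : ℝ) : ℂ) • (ψ : L2Plane)) where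
  hasCore := hasCore_hamiltonian B hV
  apply_eq ψ hT hA := by
    have h1 := (mem_graph_hamiltonian_iff_resolvent hB hV h hδ _ _).1
      ((hamiltonian B V).mem_graph ⟨ψ, hT⟩)
    have h2 : (ψ, guidingCenter B ⟨ψ, hA⟩) ∈ (guidingCenter B).graph :=
      (guidingCenter B).mem_graph ⟨ψ, hA⟩
    rw [commForm_eq hB hV h hδ (ζ := guidingCenter B ⟨ψ, hA⟩) (by rwa [h1]), h1,
      add_sub_cancel_right, ← inner_conj_symm (guidingCenter B ⟨ψ, hA⟩), Complex.sub_conj]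
    push_cast
    linear_combination (-2 * ((⟪hamiltonian B V ⟨ψ, hT⟩, guidingCenter B ⟨ψ, hA⟩⟫_ℂ).im : ℂ))
      * Complex.I_mul_I
  continuous u ψ hu hT := ((continuous_commForm B hV δ).tendsto _).comp
    (hT.add (hu.const_smul ((δ + 1 : ℝ) : ℂ)))

/-! ### Localization near the edge -/

/-- A real-valued function of `y`, as a function on the plane. -/
def yMul (g : ℝ → ℝ) (q : ℝ × ℝ) : ℂ := (g q.2 : ℝ)

theorem contDiff_yMul {g : ℝ → ℝ} (hg : ContDiff ℝ ∞ g) : ContDiff ℝ ∞ (yMul g) :=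
  Complex.ofRealCLM.contDiff.comp (hg.comp contDiff_snd)

theorem isBddMeas_yMul {g : ℝ → ℝ} (hg : ContDiff ℝ ∞ g) {C : ℝ} (h : ∀ t, |g t| ≤ C) :
    IsBddMeas (yMul g) :=
  ⟨(contDiff_yMul hg).continuous.measurable, C, fun q => by
    rw [yMul, Complex.norm_real]
    exact h _⟩

theorem pd_yMul {g : ℝ → ℝ} (hg : ContDiff ℝ ∞ g) (v : ℝ × ℝ) :
    pd v (yMul g) = (-Complex.I * v.2) • yMul (deriv g) := by
  have hg' : ContDiff ℝ ∞ fun t => (g t : ℂ) := Complex.ofRealCLM.contDiff.comp hg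
  refine (pd_comp_linear hg' (ContinuousLinearMap.snd ℝ ℝ ℝ) v).trans ?_
  funext q
  have h1 : deriv (fun t => (g t : ℂ)) q.2 = (deriv g q.2 : ℝ) :=
    (((hg.differentiable (by simp)) q.2).hasDerivAt.ofReal_comp).deriv
  simp [yMul, h1]

theorem contDiff_deriv {g : ℝ → ℝ} (hg : ContDiff ℝ ∞ g) : ContDiff ℝ ∞ (deriv g) :=
  (contDiff_infty_iff_deriv.1 hg).2

theorem kinXOp_mulOp_yMul (B : ℝ) {g : ℝ → ℝ} (hg : ContDiff ℝ ∞ g) (φ : TestFn) :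
    kinXOp B (mulOp (yMul g) (contDiff_yMul hg) φ)
      = mulOp (yMul g) (contDiff_yMul hg) (kinXOp B φ) := by
  rw [kinXOp_mulOp, add_eq_left]
  refine Subtype.ext ?_
  rw [coe_mulOp, pd_yMul hg]
  simp

theorem kinYOp_mulOp_yMul {g : ℝ → ℝ} (hg : ContDiff ℝ ∞ g) (φ : TestFn) :
    kinYOp (mulOp (yMul g) (contDiff_yMul hg) φ)
      = mulOp (yMul g) (contDiff_yMul hg) (kinYOp φ)
        - Complex.I • mulOp (yMul (deriv g)) (contDiff_yMul (contDiff_deriv hg)) φ := by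
  rw [kinYOp_mulOp, sub_eq_add_neg]
  congr 1
  refine Subtype.ext ?_
  rw [coe_mulOp, pd_yMul hg]
  funext q
  simp [mul_assoc]

theorem inner_mulOp_yMul {g : ℝ → ℝ} (hg : ContDiff ℝ ∞ g) (φ ψ : TestFn) :
    ⟪toL2 (mulOp (yMul g) (contDiff_yMul hg) φ), toL2 ψ⟫_ℂ
      = ⟪toL2 φ, toL2 (mulOp (yMul g) (contDiff_yMul hg) ψ)⟫_ℂ :=
  inner_mulOp _ _ (fun _ => Complex.ofReal_im _) φ ψ

/-- The indicator function of the half-plane `y ≥ b`. -/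
def upper (b : ℝ) : ℝ × ℝ → ℂ := {q : ℝ × ℝ | b ≤ q.2}.indicator 1

theorem isBddMeas_upper (b : ℝ) : IsBddMeas (upper b) := by
  refine ⟨measurable_one.indicator (measurableSet_le measurable_const measurable_snd), 1,
    fun q => ?_⟩
  exact (norm_indicator_le_norm_self _ _).trans (by simp)

theorem norm_le_mul_norm_upper {b C : ℝ} {m : ℝ × ℝ → ℂ} (h : ∀ q, ‖m q‖ ≤ C)
    (h0 : ∀ q : ℝ × ℝ, q.2 < b → m q = 0) (q : ℝ × ℝ) : ‖m q‖ ≤ C * ‖upper b q‖ := by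
  rcases lt_or_ge q.2 b with hq | hq
  · rw [h0 q hq, norm_zero]
    exact mul_nonneg ((norm_nonneg _).trans (h q)) (norm_nonneg _)
  · rw [upper, Set.indicator_of_mem (by exact hq), Pi.one_apply, norm_one, mul_one]
    exact h q

theorem norm_toL2_mulOp_yMul_le {b C : ℝ} {g : ℝ → ℝ} (hg : ContDiff ℝ ∞ g)
    (h : ∀ t, |g t| ≤ C) (h0 : ∀ t < b, g t = 0) (φ : TestFn) :
    ‖toL2 (mulOp (yMul g) (contDiff_yMul hg) φ)‖
      ≤ C * ‖mulL2 (upper b) (isBddMeas_upper b) (toL2 φ)‖ := by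
  rw [← mulL2_toL2 (isBddMeas_yMul hg h)]
  refine norm_mulL2_le_mul _ _ (norm_le_mul_norm_upper (fun q => ?_) fun q hq => ?_) _
  · rw [yMul, Complex.norm_real]
    exact h _
  · rw [yMul, h0 _ hq, Complex.ofReal_zero]

theorem norm_sq_toL2 (u : L2Plane) : (⟪u, u⟫_ℂ).re = ‖u‖ ^ 2 :=
  (norm_sq_eq_re_inner (𝕜 := ℂ) u).symm

/-- A Caccioppoli estimate: moving one kinetic momentum across `g²` in `⟪g² φ, (p - A)² φ⟫` gives
the localized kinetic energy and one cross term with `g'`. The nonnegative `x` part is dropped. -/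
theorem norm_sq_mulOp_kin_le (B : ℝ) {g : ℝ → ℝ} (hg : ContDiff ℝ ∞ g) (φ : TestFn) :
    ‖toL2 (mulOp (yMul g) (contDiff_yMul hg) (kinYOp φ))‖ ^ 2
      ≤ (⟪toL2 (mulOp (yMul g) (contDiff_yMul hg) (mulOp (yMul g) (contDiff_yMul hg) φ)),
          toL2 (kinOp B φ)⟫_ℂ).re
        + 2 * (‖toL2 (mulOp (yMul (deriv g)) (contDiff_yMul (contDiff_deriv hg)) φ)‖
          * ‖toL2 (mulOp (yMul g) (contDiff_yMul hg) (kinYOp φ))‖) := by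
  set G := mulOp (yMul g) (contDiff_yMul hg) with hG
  set G' := mulOp (yMul (deriv g)) (contDiff_yMul (contDiff_deriv hg)) with hG'
  have hX : ⟪toL2 (G (G φ)), toL2 (kinXOp B (kinXOp B φ))⟫_ℂ
      = ⟪toL2 (G (kinXOp B φ)), toL2 (G (kinXOp B φ))⟫_ℂ := by
    rw [← inner_kinXOp, kinXOp_mulOp_yMul B hg, kinXOp_mulOp_yMul B hg, inner_mulOp_yMul hg]
  have hY : ⟪toL2 (G (G φ)), toL2 (kinYOp (kinYOp φ))⟫_ℂ
      = ⟪toL2 (G (kinYOp φ)), toL2 (G (kinYOp φ))⟫_ℂ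
        + 2 * (Complex.I * ⟪toL2 (G' φ), toL2 (G (kinYOp φ))⟫_ℂ) := by
    rw [← inner_kinYOp, kinYOp_mulOp_yMul hg, kinYOp_mulOp_yMul hg, map_sub, map_sub, map_sub, map_smul,
      map_smul, map_smul, inner_sub_left, inner_sub_left, inner_smul_left, inner_smul_left,
      inner_mulOp_yMul hg, inner_mulOp_yMul hg (G' φ), mulOp_comm, inner_mulOp_yMul hg (G' φ),
      Complex.conj_I]
    ring
  have hb := (Complex.abs_re_le_norm (Complex.I * ⟪toL2 (G' φ), toL2 (G (kinYOp φ))⟫_ℂ)).trans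
    ((norm_mul_le _ _).trans_eq (by rw [Complex.norm_I, one_mul]))
  have hb' := (neg_le_of_abs_le hb)
  have hc := norm_inner_le_norm (𝕜 := ℂ) (toL2 (G' φ)) (toL2 (G (kinYOp φ)))
  have e : (2 * (Complex.I * ⟪toL2 (G' φ), toL2 (G (kinYOp φ))⟫_ℂ)).re
      = 2 * (Complex.I * ⟪toL2 (G' φ), toL2 (G (kinYOp φ))⟫_ℂ).re := by
    rw [← Complex.re_ofReal_mul, Complex.ofReal_ofNat]
  rw [kinOp, LinearMap.add_apply, LinearMap.comp_apply, LinearMap.comp_apply, map_add,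
    inner_add_right, hX, hY, Complex.add_re, Complex.add_re, e, norm_sq_toL2, norm_sq_toL2]
  nlinarith [sq_nonneg ‖toL2 (G (kinXOp B φ))‖]

/-- Local energy estimate, obtained by inserting `(p - A)² φ = η + E φ - V φ` into the Caccioppoli
estimate. The potential enters with the favourable sign, so only its lower bound is needed, although
`V₀` is unbounded on the support of `g`. -/
theorem norm_sq_mulOp_kinYOp_le (B : ℝ) {V : ℝ × ℝ → ℝ} (hV : IsPotential V)
    (hV1 : ∀ q, -1 ≤ V q) (E : ℝ) {g : ℝ → ℝ} (hg : ContDiff ℝ ∞ g) {b C : ℝ}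
    (h : ∀ t, |g t| ≤ C) (h' : ∀ t, |deriv g t| ≤ C) (h0 : ∀ t < b, g t = 0) (φ : TestFn) :
    ‖toL2 (mulOp (yMul g) (contDiff_yMul hg) (kinYOp φ))‖ ^ 2
      ≤ 2 * C ^ 2 * (‖hamOp B V hV φ - (E : ℂ) • toL2 φ‖ * ‖toL2 φ‖)
        + (2 * (|E| + 1) + 4) * C ^ 2
          * ‖mulL2 (upper b) (isBddMeas_upper b) (toL2 φ)‖ ^ 2 := by
  have hC : 0 ≤ C := (abs_nonneg _).trans (h 0)
  have hd0 : ∀ t < b, deriv g t = 0 := fun t ht => by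
    have : g =ᶠ[𝓝 t] fun _ => 0 := by
      filter_upwards [Iio_mem_nhds ht] with x hx using h0 x hx
    rw [this.deriv_eq, deriv_const]
  have key := norm_sq_mulOp_kin_le B hg φ
  have hG' := norm_toL2_mulOp_yMul_le (contDiff_deriv hg) h' hd0 φ
  have hG := norm_toL2_mulOp_yMul_le hg h h0 φ
  set G := mulOp (yMul g) (contDiff_yMul hg) with hGdef
  set s := ‖mulL2 (upper b) (isBddMeas_upper b) (toL2 φ)‖ with hs
  set N := ‖toL2 (G (kinYOp φ))‖ with hN
  set η := hamOp B V hV φ - (E : ℂ) • toL2 φ with hη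
  have hb := isBddMeas_yMul hg h
  have hn : ∀ u, ‖mulL2 (yMul g) hb u‖ ≤ C * ‖u‖ := norm_mulL2_le hb fun q => by
    rw [yMul, Complex.norm_real]
    exact h _
  have e1 : toL2 (kinOp B φ) = η + (E : ℂ) • toL2 φ - potOp V hV φ := by
    rw [hη, sub_add_cancel]
    exact (add_sub_cancel_right _ _).symm
  have e2 : ⟪toL2 (G (G φ)), potOp V hV φ⟫_ℂ = ⟪toL2 (G φ), potOp V hV (G φ)⟫_ℂ := by
    rw [potOp_mulOp hV hV (contDiff_yMul hg) hb (fun _ _ => rfl), ← mulL2_toL2 hb (contDiff_yMul hg),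
      inner_mulL2 hb (fun _ => Complex.ofReal_im _)]
  have h1 : (⟪toL2 (G (G φ)), η⟫_ℂ).re ≤ C ^ 2 * (‖η‖ * ‖toL2 φ‖) := by
    refine (Complex.re_le_norm _).trans ((norm_inner_le_norm _ _).trans ?_)
    have : ‖toL2 (G (G φ))‖ ≤ C * (C * ‖toL2 φ‖) := by
      rw [hGdef, ← mulL2_toL2 hb, ← mulL2_toL2 hb]
      exact (hn _).trans (mul_le_mul_of_nonneg_left (hn _) hC)
    calc _ ≤ C * (C * ‖toL2 φ‖) * ‖η‖ := mul_le_mul_of_nonneg_right this (norm_nonneg _)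
      _ = _ := by ring
  have h2 : -1 * ‖toL2 (G φ)‖ ^ 2 ≤ (⟪toL2 (G φ), potOp V hV (G φ)⟫_ℂ).re :=
    neg_mul_norm_sq_le_inner_potOp hV hV1 (G φ)
  have h3 : ‖toL2 (G φ)‖ ^ 2 ≤ C ^ 2 * s ^ 2 := by
    rw [← mul_pow]
    exact pow_le_pow_left₀ (norm_nonneg _) hG 2
  have h4 : E * ‖toL2 (G φ)‖ ^ 2 ≤ |E| * ‖toL2 (G φ)‖ ^ 2 :=
    mul_le_mul_of_nonneg_right (le_abs_self E) (by positivity)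
  have h5 : (|E| + 1) * ‖toL2 (G φ)‖ ^ 2 ≤ (|E| + 1) * (C ^ 2 * s ^ 2) :=
    mul_le_mul_of_nonneg_left h3 (by positivity)
  rw [e1, inner_sub_right, inner_add_right, inner_smul_right, e2, Complex.sub_re, Complex.add_re,
    Complex.re_ofReal_mul, inner_mulOp_yMul hg (G φ), norm_sq_toL2] at key
  have h6 : ‖toL2 (mulOp (yMul (deriv g)) (contDiff_yMul (contDiff_deriv hg)) φ)‖ * N
      ≤ C * s * N := mul_le_mul_of_nonneg_right hG' (norm_nonneg _)
  -- Half of `N²` absorbs the cross term, `2 C s N ≤ N² / 2 + 2 C² s²`; this is the source of the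
  -- factor `2` and of the summand `4` in the statement.
  nlinarith [sq_nonneg (N - 2 * (C * s))]

theorem exists_edge_cutoff {b : ℝ} (hb : 0 < b) : ∃ (f : ℝ → ℝ) (C : ℝ), ContDiff ℝ ∞ f ∧
    (∀ t, 0 ≤ f t ∧ f t ≤ 1) ∧ (∀ t ≤ b, f t = 1) ∧ (∀ t ≥ 2 * b, f t = 0) ∧
    (∀ t, |deriv f t| ≤ C) ∧ ∀ t, |deriv (deriv f) t| ≤ C := by
  set f : ℝ → ℝ := fun t => Real.smoothTransition (2 - t / b) with hf
  have hs : ContDiff ℝ ∞ f :=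
    Real.smoothTransition.contDiff.comp (contDiff_const.sub (contDiff_id.div_const b))
  have h1 : ∀ t ≤ b, f t = 1 := fun t ht =>
    Real.smoothTransition.one_of_one_le (by linarith [(div_le_one hb).2 ht])
  have h0 : ∀ t ≥ 2 * b, f t = 0 := fun t ht =>
    Real.smoothTransition.zero_of_nonpos (by linarith [(le_div_iff₀ hb).2 ht])
  have hc : HasCompactSupport (deriv f) := by
    refine HasCompactSupport.intro (isCompact_Icc (a := b) (b := 2 * b)) fun t ht => ?_
    rw [Set.mem_Icc, not_and_or, not_le, not_le] at ht
    rcases ht with ht | ht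
    · have : f =ᶠ[𝓝 t] fun _ => 1 := by
        filter_upwards [Iio_mem_nhds ht] with x hx using h1 x (le_of_lt hx)
      rw [this.deriv_eq, deriv_const]
    · have : f =ᶠ[𝓝 t] fun _ => 0 := by
        filter_upwards [Ioi_mem_nhds ht] with x hx using h0 x (le_of_lt hx)
      rw [this.deriv_eq, deriv_const]
  obtain ⟨C, hC⟩ := hc.exists_bound_of_continuous (contDiff_deriv hs).continuous
  obtain ⟨C', hC'⟩ :=
    hc.deriv.exists_bound_of_continuous (contDiff_deriv (contDiff_deriv hs)).continuous
  exact ⟨f, max C C', hs, fun t => ⟨Real.smoothTransition.nonneg _, Real.smoothTransition.le_one _⟩,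
    h1, h0, fun t => (hC t).trans (le_max_left _ _), fun t => (hC' t).trans (le_max_right _ _)⟩

theorem kinOp_mulOp_yMul (B : ℝ) {f : ℝ → ℝ} (hf : ContDiff ℝ ∞ f) (φ : TestFn) :
    kinOp B (mulOp (yMul f) (contDiff_yMul hf) φ)
      = mulOp (yMul f) (contDiff_yMul hf) (kinOp B φ)
        - (2 * Complex.I) • mulOp (yMul (deriv f)) (contDiff_yMul (contDiff_deriv hf)) (kinYOp φ)
        - mulOp (yMul (deriv (deriv f))) (contDiff_yMul (contDiff_deriv (contDiff_deriv hf))) φ := by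
  simp only [kinOp, LinearMap.add_apply, LinearMap.comp_apply, kinXOp_mulOp_yMul B hf,
    kinYOp_mulOp_yMul hf, kinYOp_mulOp_yMul (contDiff_deriv hf), map_add, map_sub, map_smul,
    smul_sub, smul_smul, Complex.I_mul_I]
  module

theorem norm_potOp_mulOp_le {V : ℝ × ℝ → ℝ} (hV : IsPotential V) {m : ℝ × ℝ → ℂ}
    (hm : ContDiff ℝ ∞ m) {C : ℝ} (h : ∀ q, |V q| * ‖m q‖ ≤ C) (φ : TestFn) :
    ‖potOp V hV (mulOp m hm φ)‖ ≤ C * ‖toL2 φ‖ := by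
  refine Lp.norm_le_mul_norm_of_ae_le_mul ?_
  filter_upwards [coeFn_potOp hV (mulOp m hm φ), coeFn_toL2 φ] with q h1 h2
  rw [h1, h2, coe_mulOp, Pi.mul_apply, norm_mul, norm_mul, Complex.norm_real, ← mul_assoc]
  exact mul_le_mul_of_nonneg_right (h q) (norm_nonneg _)

/-- Away from the Landau levels, approximate eigenfunctions do not vanish near the edge. -/
theorem exists_norm_sq_le_upper {B : ℝ} (hB : 0 < B) {E d : ℝ} (hd0 : 0 < d)
    (hd : ∀ j : ℕ, d ≤ |(2 * (j : ℝ) + 1) * B - E|) {b : ℝ} (hb : 0 < b) :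
    ∃ C > 0, ∀ (V : ℝ × ℝ → ℝ) (hV : IsPotential V), (∀ q, -1 ≤ V q) →
      (∀ q : ℝ × ℝ, q.2 < 2 * b → |V q| ≤ d / 2) → ∀ φ : TestFn,
      ‖toL2 φ‖ ^ 2 ≤ C * (‖hamOp B V hV φ - (E : ℂ) • toL2 φ‖ ^ 2
        + ‖hamOp B V hV φ - (E : ℂ) • toL2 φ‖ * ‖toL2 φ‖
        + ‖mulL2 (upper b) (isBddMeas_upper b) (toL2 φ)‖ ^ 2) := by
  obtain ⟨f, C, hf, hf01, hf1, hf0, hC1, hC2⟩ := exists_edge_cutoff hb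
  have hC0 : 0 ≤ C := (abs_nonneg _).trans (hC1 0)
  set M := (2 * (|E| + 1) + 4) * C ^ 2 with hM
  have hM0 : 0 ≤ M := by positivity
  -- The factor `3` comes from squaring a sum of three terms, `24 C²` and `12 M` from inserting the
  -- local energy estimate for `f' p_y φ`, and `4 / d²` from undoing `(d / 2)²`.
  refine ⟨4 / d ^ 2 * (3 + 24 * C ^ 2 + 12 * M + 3 * (C + d) ^ 2), by positivity,
    fun V hV hV1 hVd φ => ?_⟩
  have hd1 : ∀ t < b, deriv f t = 0 := fun t ht => by
    have : f =ᶠ[𝓝 t] fun _ => 1 := by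
      filter_upwards [Iio_mem_nhds ht] with x hx using hf1 x (le_of_lt hx)
    rw [this.deriv_eq, deriv_const]
  have hd2 : ∀ t < b, deriv (deriv f) t = 0 := fun t ht => by
    have : deriv f =ᶠ[𝓝 t] fun _ => 0 := by
      filter_upwards [Iio_mem_nhds ht] with x hx using hd1 x hx
    rw [this.deriv_eq, deriv_const]
  have hN := norm_sq_mulOp_kinYOp_le B hV hV1 E (contDiff_deriv hf) hC1 hC2 hd1 φ
  have h2 := norm_toL2_mulOp_yMul_le (contDiff_deriv (contDiff_deriv hf)) hC2 hd2 φ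
  have h3 := norm_toL2_mulOp_yMul_le (b := b) (g := fun t => 1 - f t) (C := 1)
    (contDiff_const.sub hf) (fun t => abs_le.2 ⟨by linarith [hf01 t], by linarith [hf01 t]⟩)
    (fun t ht => by rw [hf1 t ht.le, sub_self]) φ
  have hfb : ∀ t, |f t| ≤ 1 := fun t => abs_le.2 ⟨by linarith [hf01 t], (hf01 t).2⟩
  have hP : ‖potOp V hV (mulOp (yMul f) (contDiff_yMul hf) φ)‖ ≤ d / 2 * ‖toL2 φ‖ := by
    refine norm_potOp_mulOp_le hV _ (fun q => ?_) φ
    rw [yMul, Complex.norm_real]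
    rcases lt_or_ge q.2 (2 * b) with hq | hq
    · exact (mul_le_mul (hVd q hq) (hfb _) (abs_nonneg _) (by positivity)).trans_eq (mul_one _)
    · rw [hf0 _ hq, norm_zero, mul_zero]
      positivity
  have hgap := le_norm_kinOp_sub hB hd0 hd (mulOp (yMul f) (contDiff_yMul hf) φ)
  set η := hamOp B V hV φ - (E : ℂ) • toL2 φ with hη
  have hfη : ‖mulL2 (yMul f) (isBddMeas_yMul hf hfb) η‖ ≤ 1 * ‖η‖ :=
    norm_mulL2_le _ (fun q => by
      rw [yMul, Complex.norm_real]
      exact hfb _) η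
  set s := ‖mulL2 (upper b) (isBddMeas_upper b) (toL2 φ)‖ with hs
  set w := mulOp (yMul (deriv f)) (contDiff_yMul (contDiff_deriv hf)) (kinYOp φ) with hw
  set w2 := mulOp (yMul (deriv (deriv f)))
    (contDiff_yMul (contDiff_deriv (contDiff_deriv hf))) φ with hw2
  -- The free equation satisfied by `f φ`. Here `w = f' p_y φ` and `w2 = f'' φ` live on `y ≥ b`,
  -- where their size is controlled by `s` and the energy.
  have e : toL2 (kinOp B (mulOp (yMul f) (contDiff_yMul hf) φ))
      - (E : ℂ) • toL2 (mulOp (yMul f) (contDiff_yMul hf) φ)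
      = mulL2 (yMul f) (isBddMeas_yMul hf hfb) η
        - potOp V hV (mulOp (yMul f) (contDiff_yMul hf) φ)
        - (2 * Complex.I) • toL2 w - toL2 w2 := by
    rw [kinOp_mulOp_yMul B hf, map_sub, map_sub, map_smul, ← hw, ← hw2,
      potOp_mulOp hV hV (contDiff_yMul hf) (isBddMeas_yMul hf hfb) (fun _ _ => rfl),
      ← mulL2_toL2 (isBddMeas_yMul hf hfb), ← mulL2_toL2 (isBddMeas_yMul hf hfb), hη, hamOp,
      LinearMap.add_apply, LinearMap.comp_apply, map_sub, map_add, map_smul]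
    abel
  have hw' : ‖(2 * Complex.I) • toL2 w‖ = 2 * ‖toL2 w‖ := by
    rw [norm_smul, norm_mul, Complex.norm_I, mul_one, Complex.norm_ofNat]
  have h4 : d * ‖toL2 (mulOp (yMul f) (contDiff_yMul hf) φ)‖
      ≤ ‖η‖ + d / 2 * ‖toL2 φ‖ + 2 * ‖toL2 w‖ + C * s := by
    rw [e] at hgap
    refine hgap.trans ((norm_sub_le _ _).trans (add_le_add ((norm_sub_le _ _).trans
      (add_le_add ((norm_sub_le _ _).trans (add_le_add (by simpa using hfη) hP)) hw'.le)) h2))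
  have h5 : ‖toL2 φ‖ ≤ ‖toL2 (mulOp (yMul f) (contDiff_yMul hf) φ)‖ + s := by
    have e2 : φ = mulOp (yMul f) (contDiff_yMul hf) φ
        + mulOp (yMul fun t => 1 - f t) (contDiff_yMul (contDiff_const.sub hf)) φ := by
      refine Subtype.ext (funext fun q => ?_)
      simp only [Submodule.coe_add, Pi.add_apply, coe_mulOp, Pi.mul_apply, yMul]
      push_cast
      ring
    calc ‖toL2 φ‖ ≤ _ := by
          conv_lhs => rw [e2, map_add]
          exact norm_add_le _ _
      _ ≤ _ := add_le_add_right (by simpa using h3) _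
  -- The potential costs `d / 2` of the gap `d`; replacing `f φ` by `φ` costs another `d s`.
  have h6 : d / 2 * ‖toL2 φ‖ ≤ ‖η‖ + 2 * ‖toL2 w‖ + (C + d) * s := by nlinarith
  have h7 : (d / 2 * ‖toL2 φ‖) ^ 2 ≤ 3 * (‖η‖ ^ 2 + (2 * ‖toL2 w‖) ^ 2 + ((C + d) * s) ^ 2) := by
    refine (pow_le_pow_left₀ (by positivity) h6 2).trans ?_
    nlinarith [sq_nonneg (‖η‖ - 2 * ‖toL2 w‖), sq_nonneg (‖η‖ - (C + d) * s),
      sq_nonneg (2 * ‖toL2 w‖ - (C + d) * s)]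
  have hηn : 0 ≤ ‖η‖ * ‖toL2 φ‖ := by positivity
  have h8 : (d / 2 * ‖toL2 φ‖) ^ 2 ≤ (3 + 24 * C ^ 2 + 12 * M + 3 * (C + d) ^ 2)
      * (‖η‖ ^ 2 + ‖η‖ * ‖toL2 φ‖ + s ^ 2) := by
    have a1 : 0 ≤ (24 * C ^ 2 + 12 * M + 3 * (C + d) ^ 2) * ‖η‖ ^ 2 := by positivity
    have a2 : 0 ≤ (3 + 12 * M + 3 * (C + d) ^ 2) * (‖η‖ * ‖toL2 φ‖) := by positivity
    have a3 : 0 ≤ (3 + 24 * C ^ 2) * s ^ 2 := by positivity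
    linarith
  have h9 : ‖toL2 φ‖ ^ 2 = 4 / d ^ 2 * (d / 2 * ‖toL2 φ‖) ^ 2 := by
    field_simp
    ring
  rw [h9, mul_assoc]
  exact mul_le_mul_of_nonneg_left h8 (by positivity)

/-! ### The Mourre estimate -/

theorem isPotential_of_bdd {g : ℝ × ℝ → ℝ} (hg : Measurable g) {C : ℝ} (h : ∀ q, |g q| ≤ C) :
    IsPotential g := ⟨hg, fun _ => ⟨C, fun q _ => h q⟩⟩

theorem isPotential_totalPotential {f : ℝ → ℝ} (hf : Continuous f) {g : ℝ × ℝ → ℝ}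
    (hg : IsPotential g) : IsPotential (totalPotential f g) := by
  refine ⟨(hf.measurable.comp measurable_snd).add hg.measurable, fun r => ?_⟩
  obtain ⟨C, hC⟩ := (isCompact_Icc (a := -r) (b := r)).exists_bound_of_continuousOn hf.continuousOn
  obtain ⟨C', hC'⟩ := hg.locBdd r
  refine ⟨C + C', fun q hq => (abs_add_le _ _).trans (add_le_add (hC _ ?_) (hC' q hq))⟩
  exact abs_le.1 ((norm_snd_le q).trans hq)

theorem potOp_totalPotential {f : ℝ → ℝ} (hf : ContDiff ℝ ∞ f) {g : ℝ × ℝ → ℝ}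
    (hg : IsPotential g) (hfg : IsPotential (totalPotential f g)) (φ : TestFn) :
    potOp (totalPotential f g) hfg φ
      = toL2 (mulOp (yMul f) (contDiff_yMul hf) φ) + potOp g hg φ := by
  refine Lp.ext ?_
  filter_upwards [coeFn_potOp hfg φ, coeFn_potOp hg φ,
    coeFn_toL2 (mulOp (yMul f) (contDiff_yMul hf) φ),
    Lp.coeFn_add (toL2 (mulOp (yMul f) (contDiff_yMul hf) φ)) (potOp g hg φ)] with q h1 h2 h3 h4
  rw [h1, h4, Pi.add_apply, h2, h3, coe_mulOp, Pi.mul_apply, totalPotential, yMul]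
  push_cast
  ring

theorem inner_mulL2_upper (b : ℝ) (u : L2Plane) :
    (⟪u, mulL2 (upper b) (isBddMeas_upper b) u⟫_ℂ).re
      = ‖mulL2 (upper b) (isBddMeas_upper b) u‖ ^ 2 := by
  have h1 : mulL2 (upper b) (isBddMeas_upper b) (mulL2 (upper b) (isBddMeas_upper b) u)
      = mulL2 (upper b) (isBddMeas_upper b) u := by
    refine Lp.ext ?_
    filter_upwards [coeFn_mulL2 (isBddMeas_upper b) u,
      coeFn_mulL2 (isBddMeas_upper b) (mulL2 (upper b) (isBddMeas_upper b) u)] with q h1 h2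
    rw [h2, Pi.mul_apply, h1, Pi.mul_apply, ← mul_assoc]
    congr 1
    by_cases hq : q ∈ {q : ℝ × ℝ | b ≤ q.2}
    · rw [upper, Set.indicator_of_mem hq, Pi.one_apply, mul_one]
    · rw [upper, Set.indicator_of_notMem hq, mul_zero]
  have hr : ∀ q, (upper b q).im = 0 := by
    intro q
    by_cases hq : q ∈ {q : ℝ × ℝ | b ≤ q.2}
    · rw [upper, Set.indicator_of_mem hq, Pi.one_apply, Complex.one_im]
    · rw [upper, Set.indicator_of_notMem hq, Complex.zero_im]
  rw [← norm_sq_toL2, inner_mulL2 _ hr, h1]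

/-- This is `i[p_y, f] = f'` in form language: exchanging the two factors conjugates the inner
product up to the term with `f'`. -/
theorem im_inner_mulOp_yMul {f : ℝ → ℝ} (hf : ContDiff ℝ ∞ f) (φ : TestFn) :
    2 * (⟪toL2 (mulOp (yMul f) (contDiff_yMul hf) φ), toL2 (kinYOp φ)⟫_ℂ).im
      = (⟪toL2 φ, toL2 (mulOp (yMul (deriv f)) (contDiff_yMul (contDiff_deriv hf)) φ)⟫_ℂ).re := by
  have h1 : ⟪toL2 (mulOp (yMul f) (contDiff_yMul hf) φ), toL2 (kinYOp φ)⟫_ℂ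
      = starRingEnd ℂ ⟪toL2 (mulOp (yMul f) (contDiff_yMul hf) φ), toL2 (kinYOp φ)⟫_ℂ
        + Complex.I *
          ⟪toL2 φ, toL2 (mulOp (yMul (deriv f)) (contDiff_yMul (contDiff_deriv hf)) φ)⟫_ℂ := by
    rw [inner_conj_symm]
    conv_lhs => rw [← inner_kinYOp, kinYOp_mulOp_yMul hf, map_sub, map_smul, inner_sub_left,
      inner_smul_left, inner_mulOp_yMul hf, inner_mulOp_yMul (contDiff_deriv hf), Complex.conj_I]
    ring
  have h2 := congrArg Complex.im h1
  rw [Complex.add_im, Complex.conj_im, Complex.I_mul_im] at h2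
  linarith

theorem mul_norm_sq_upper_le {f : ℝ → ℝ} (hf : ContDiff ℝ ∞ f) (h0 : ∀ t, 0 ≤ deriv f t)
    {b c : ℝ} (hc : ∀ t ≥ b, c ≤ deriv f t) (φ : TestFn) :
    c * ‖mulL2 (upper b) (isBddMeas_upper b) (toL2 φ)‖ ^ 2
      ≤ 2 * (⟪toL2 (mulOp (yMul f) (contDiff_yMul hf) φ), toL2 (kinYOp φ)⟫_ℂ).im := by
  rw [im_inner_mulOp_yMul hf]
  have hub : ∀ q, |-c * (upper b q).re| ≤ |c| * 1 := fun q => by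
    obtain hq | hq := em (q ∈ {q : ℝ × ℝ | b ≤ q.2})
    · simp [upper, Set.indicator_of_mem hq]
    · simp [upper, Set.indicator_of_notMem hq]
  -- The inequality is positivity of the potential `f' - c 1_{y ≥ b}`, so the lower bound for
  -- potentials applies with constant `0`.
  have hg : IsPotential fun q => -c * (upper b q).re :=
    isPotential_of_bdd ((Complex.measurable_re.comp (isBddMeas_upper b).measurable).const_mul _) hub
  have hW := isPotential_totalPotential (contDiff_deriv hf).continuous hg
  have h1 := neg_mul_norm_sq_le_inner_potOp hW (C := 0) (fun q => by
    rw [neg_zero, totalPotential]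
    obtain hq | hq := em (q ∈ {q : ℝ × ℝ | b ≤ q.2})
    · rw [upper, Set.indicator_of_mem hq, Pi.one_apply, Complex.one_re]
      linarith [hc q.2 hq]
    · rw [upper, Set.indicator_of_notMem hq, Complex.zero_re, mul_zero, add_zero]
      exact h0 _) φ
  have h2 : potOp (fun q => -c * (upper b q).re) hg φ
      = ((-c : ℝ) : ℂ) • mulL2 (upper b) (isBddMeas_upper b) (toL2 φ) := by
    refine Lp.ext ?_
    filter_upwards [coeFn_potOp hg φ, coeFn_mulL2 (isBddMeas_upper b) (toL2 φ), coeFn_toL2 φ,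
      Lp.coeFn_smul ((-c : ℝ) : ℂ) (mulL2 (upper b) (isBddMeas_upper b) (toL2 φ))] with q h1 h2 h3 h4
    rw [h1, h4, Pi.smul_apply, h2, Pi.mul_apply, h3, smul_eq_mul]
    obtain hq | hq := em (q ∈ {q : ℝ × ℝ | b ≤ q.2})
    · simp [upper, Set.indicator_of_mem hq]
    · simp [upper, Set.indicator_of_notMem hq]
  rw [potOp_totalPotential (contDiff_deriv hf) hg hW, inner_add_right, h2, inner_smul_right,
    Complex.add_re, Complex.re_ofReal_mul, inner_mulL2_upper] at h1
  linarith

/-- The energy bounds `p_y φ`. This allows the disorder to be estimated as `⟪V_d φ, p_y φ⟫` without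
differentiating `V_d`. -/
theorem two_mul_norm_kinYOp_le (B : ℝ) {V : ℝ × ℝ → ℝ} (hV : IsPotential V)
    (hV1 : ∀ q, -1 ≤ V q) (E : ℝ) (φ : TestFn) :
    2 * (‖toL2 φ‖ * ‖toL2 (kinYOp φ)‖) ≤ (|E| + 2) * ‖toL2 φ‖ ^ 2
      + ‖hamOp B V hV φ - (E : ℂ) • toL2 φ‖ * ‖toL2 φ‖ := by
  have h1 := norm_kin_sq_le B hV hV1 φ
  set η := hamOp B V hV φ - (E : ℂ) • toL2 φ with hη
  have e : hamOp B V hV φ = η + (E : ℂ) • toL2 φ := (sub_add_cancel _ _).symm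
  rw [e, inner_add_right, inner_smul_right, Complex.add_re, Complex.re_ofReal_mul,
    norm_sq_toL2] at h1
  have h2 := (Complex.re_le_norm _).trans (norm_inner_le_norm (𝕜 := ℂ) (toL2 φ) η)
  have h3 : E * ‖toL2 φ‖ ^ 2 ≤ |E| * ‖toL2 φ‖ ^ 2 :=
    mul_le_mul_of_nonneg_right (le_abs_self E) (by positivity)
  nlinarith [sq_nonneg (‖toL2 φ‖ - ‖toL2 (kinYOp φ)‖), sq_nonneg ‖toL2 (kinXOp B φ)‖]

end HalfPlaneLandau

/-! ### Sign and smallness of edge potentials -/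

namespace HalfPlaneLandau.IsEdgePotential

variable {V₀ : ℝ → ℝ} (hV₀ : IsEdgePotential V₀)
include hV₀

theorem monotone : Monotone V₀ :=
  monotone_of_deriv_nonneg (hV₀.smooth.differentiable (by simp)) hV₀.deriv_nonneg

theorem nonneg (y : ℝ) : 0 ≤ V₀ y := by
  have h : V₀ (min y 0 - 1) = 0 := hV₀.eq_zero _ (by linarith [min_le_right y 0])
  rw [← h]
  exact hV₀.monotone (by linarith [min_le_left y 0])

theorem apply_zero : V₀ 0 = 0 := by
  have hc : IsClosed {t | V₀ t = 0} := isClosed_eq hV₀.smooth.continuous continuous_const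
  have h := closure_minimal (s := Set.Iio 0) (fun t ht => hV₀.eq_zero t ht) hc
  rw [closure_Iio] at h
  exact h Set.self_mem_Iic

/-- Continuity at `0`, where `V₀` vanishes, gives the bound at one positive point; monotonicity
carries it to the half-line below. -/
theorem exists_small {ε : ℝ} (hε : 0 < ε) : ∃ b > 0, ∀ y < 2 * b, |V₀ y| ≤ ε := by
  have h := hV₀.smooth.continuous.continuousAt (x := 0)
  obtain ⟨r, hr, hr'⟩ := Metric.continuousAt_iff.1 h ε hε
  refine ⟨r / 4, by positivity, fun y hy => ?_⟩
  rw [abs_of_nonneg (hV₀.nonneg y)]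
  refine (hV₀.monotone hy.le).trans ?_
  have h1 := hr' (x := 2 * (r / 4)) (by
    rw [Real.dist_eq, sub_zero, abs_of_pos (by positivity)]
    linarith)
  rw [hV₀.apply_zero, Real.dist_eq, sub_zero] at h1
  exact (le_abs_self _).trans h1.le

end HalfPlaneLandau.IsEdgePotential

/-! ### From test functions to spectral projections -/

namespace HalfPlaneLandau

/-- All constants are fixed before `V_d`, so `δ` depends only on `B`, `V₀` and `E`. The positive
commutator `c s²` controls the mass on `y ≥ b`, and `exists_norm_sq_le_upper` converts this mass
into `‖φ‖²`. -/
theorem exists_mourre_test {B : ℝ} (hB : 0 < B) {V₀ : ℝ → ℝ} (hV₀ : IsEdgePotential V₀) {E : ℝ}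
    (hE : ∀ n : ℕ, E ≠ (2 * (n : ℝ) + 1) * B) :
    ∃ δ > 0, ∃ α > 0, ∃ C ≥ 0, ∀ Vd : ℝ × ℝ → ℝ, (∀ q, |Vd q| ≤ δ) → Measurable Vd →
      ∀ (hV : IsPotential (totalPotential V₀ Vd)) (φ : TestFn),
        α * ‖toL2 φ‖ ^ 2 ≤ 2 * (⟪potOp _ hV φ, toL2 (kinYOp φ)⟫_ℂ).im
          + C * (‖hamOp B _ hV φ - (E : ℂ) • toL2 φ‖ ^ 2
            + ‖hamOp B _ hV φ - (E : ℂ) • toL2 φ‖ * ‖toL2 φ‖) := by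
  obtain ⟨d, hd0, hd⟩ := exists_dist_landau_levels hB hE
  obtain ⟨b, hb, hbd⟩ := hV₀.exists_small (ε := d / 4) (by positivity)
  obtain ⟨c, hc, hcb⟩ := hV₀.deriv_pos b hb
  obtain ⟨C, hC, key⟩ := exists_norm_sq_le_upper hB hd0 hd hb
  have hE2 : 0 < |E| + 2 := by positivity
  -- In `δ`, the `1` ensures `V ≥ -1`; `d / 4`, added to `V₀ ≤ d / 4`, keeps `|V| ≤ d / 2` on `y <
  -- 2b`; the last term makes the disorder consume at most half of the gain `c / C`, leaving `α = c
  -- / (2C)`.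
  refine ⟨min (min 1 (d / 4)) (c / (2 * C * (|E| + 2))), by positivity, c / (2 * C), by positivity,
    c + 1, by positivity, fun Vd hVd hm hV φ => ?_⟩
  set δ := min (min 1 (d / 4)) (c / (2 * C * (|E| + 2))) with hδ
  have hδ0 : 0 < δ := by positivity
  have hδ1 : δ ≤ 1 := (min_le_left _ _).trans (min_le_left _ _)
  have hδd : δ ≤ d / 4 := (min_le_left _ _).trans (min_le_right _ _)
  have hδc : δ * (|E| + 2) ≤ c / (2 * C) := by
    have : δ * (2 * C * (|E| + 2)) ≤ c := (le_div_iff₀ (by positivity)).1 (min_le_right _ _)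
    rw [le_div_iff₀ (by positivity)]
    linarith
  have hV1 : ∀ q, -1 ≤ totalPotential V₀ Vd q := fun q => by
    have h1 := (abs_le.1 (hVd q)).1
    have h2 := hV₀.nonneg q.2
    rw [totalPotential]
    linarith
  have h1 := key _ hV hV1 (fun q hq => (abs_add_le _ _).trans
    (by linarith [hbd q.2 hq, hVd q])) φ
  have h2 := two_mul_norm_kinYOp_le B hV hV1 E φ
  have h3 := mul_norm_sq_upper_le hV₀.smooth hV₀.deriv_nonneg hcb φ
  have hVdp := isPotential_of_bdd hm hVd
  have h4 : (⟪potOp _ hV φ, toL2 (kinYOp φ)⟫_ℂ).im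
      = (⟪toL2 (mulOp (yMul V₀) (contDiff_yMul hV₀.smooth) φ), toL2 (kinYOp φ)⟫_ℂ).im
        + (⟪potOp Vd hVdp φ, toL2 (kinYOp φ)⟫_ℂ).im := by
    rw [potOp_totalPotential hV₀.smooth hVdp, inner_add_left, Complex.add_im]
  have h5 : -(δ * (‖toL2 φ‖ * ‖toL2 (kinYOp φ)‖))
      ≤ (⟪potOp Vd hVdp φ, toL2 (kinYOp φ)⟫_ℂ).im := by
    refine neg_le_of_abs_le ((Complex.abs_im_le_norm _).trans ((norm_inner_le_norm _ _).trans ?_))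
    rw [← mul_assoc]
    exact mul_le_mul_of_nonneg_right (norm_potOp_le hVdp hVd φ) (norm_nonneg _)
  set η := ‖hamOp B _ hV φ - (E : ℂ) • toL2 φ‖ with hη
  set s := ‖mulL2 (upper b) (isBddMeas_upper b) (toL2 φ)‖ with hs
  set n := ‖toL2 φ‖ with hn
  have h6 : c / C * n ^ 2 ≤ c * (η ^ 2 + η * n + s ^ 2) := by
    calc c / C * n ^ 2 ≤ c / C * (C * (η ^ 2 + η * n + s ^ 2)) :=
          mul_le_mul_of_nonneg_left h1 (by positivity)
      _ = _ := by
        field_simp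
  have h7 : δ * (2 * (n * ‖toL2 (kinYOp φ)‖)) ≤ δ * ((|E| + 2) * n ^ 2 + η * n) :=
    mul_le_mul_of_nonneg_left h2 hδ0.le
  have h8 : δ * (η * n) ≤ 1 * (η * n) := mul_le_mul_of_nonneg_right hδ1 (by positivity)
  have h9 : δ * (|E| + 2) * n ^ 2 ≤ c / (2 * C) * n ^ 2 :=
    mul_le_mul_of_nonneg_right hδc (by positivity)
  have h10 : c / C = 2 * (c / (2 * C)) := by
    field_simp
  rw [h10] at h6
  rw [h4]
  nlinarith [sq_nonneg η]

/-- The Mourre estimate for approximate eigenfunctions in the domain of the Hamiltonian. -/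
theorem mourre_commForm {B : ℝ} (hB : 0 < B) {V : ℝ × ℝ → ℝ} (hV : IsPotential V) {δ : ℝ}
    (h : ∀ q, -δ ≤ V q) (hδ : 0 ≤ δ) {E α C : ℝ}
    (key : ∀ φ : TestFn, α * ‖toL2 φ‖ ^ 2 ≤ 2 * (⟪potOp _ hV φ, toL2 (kinYOp φ)⟫_ℂ).im
          + C * (‖hamOp B _ hV φ - (E : ℂ) • toL2 φ‖ ^ 2
            + ‖hamOp B _ hV φ - (E : ℂ) • toL2 φ‖ * ‖toL2 φ‖))
    (ψ : (hamiltonian B V).domain) :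
    α * ‖(ψ : L2Plane)‖ ^ 2
      ≤ -commForm B V hV δ (hamiltonian B V ψ + ((δ + 1 : ℝ) : ℂ) • (ψ : L2Plane))
        + C * (‖hamiltonian B V ψ - (E : ℂ) • (ψ : L2Plane)‖ ^ 2
          + ‖hamiltonian B V ψ - (E : ℂ) • (ψ : L2Plane)‖ * ‖(ψ : L2Plane)‖) := by
  obtain ⟨φ, h1, h2⟩ := (mem_graph_hamiltonian B hV _ _).1 ((hamiltonian B V).mem_graph ψ)
  have h3 := ((continuous_commForm B hV δ).tendsto _).comp
    (h2.add (h1.const_smul ((δ + 1 : ℝ) : ℂ)))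
  have h4 := (h2.sub (h1.const_smul (E : ℂ))).norm
  refine le_of_tendsto_of_tendsto' ((h1.norm.pow 2).const_mul α)
    (h3.neg.add (((h4.pow 2).add (h4.mul h1.norm)).const_mul C)) fun n => ?_
  rw [Function.comp_apply, ← shiftedOp_apply, commForm_shiftedOp hB hV h hδ]
  linarith [key (φ n)]

theorem dense_domain_hamiltonian (B : ℝ) {V : ℝ × ℝ → ℝ} (hV : IsPotential V) :
    Dense ((hamiltonian B V).domain : Set L2Plane) := by
  have h : (LinearMap.range toL2 : Submodule ℂ L2Plane) ≤ (hamiltonian B V).domain := by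
    rw [← domain_testOperator _ (coeFn_hamOp B hV)]
    exact (LinearPMap.le_closure _).1
  exact Dense.mono h denseRange_toL2

theorem hamiltonian_apply_toL2 (B : ℝ) {V : ℝ × ℝ → ℝ} (hV : IsPotential V)
    {u : (hamiltonian B V).domain} {φ : TestFn} (hu : (u : L2Plane) = toL2 φ) :
    hamiltonian B V u = hamOp B V hV φ := by
  have h : (toL2 φ, hamOp B V hV φ) ∈ (hamiltonian B V).graph :=
    (mem_graph_hamiltonian B hV _ _).2 ⟨fun _ => φ, tendsto_const_nhds, tendsto_const_nhds⟩
  exact (hamiltonian B V).mem_graph_snd_inj ((hamiltonian B V).mem_graph u) h hu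

/-- A Mourre estimate for approximate eigenfunctions gives one for spectral projections. -/
theorem exists_mourre_proj {B : ℝ} {V : ℝ × ℝ → ℝ} (hV : IsPotential V) {P : PVM L2Plane}
    (hP : P.IsSpectralMeasureOf (hamiltonian B V)) {E α C : ℝ} (hα : 0 < α) (hC : 0 ≤ C)
    {Q : (hamiltonian B V).domain → ℝ}
    (hQ : ∀ ψ : (hamiltonian B V).domain, α * ‖(ψ : L2Plane)‖ ^ 2 ≤ -Q ψ
      + C * (‖hamiltonian B V ψ - (E : ℂ) • (ψ : L2Plane)‖ ^ 2
        + ‖hamiltonian B V ψ - (E : ℂ) • (ψ : L2Plane)‖ * ‖(ψ : L2Plane)‖)) :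
    ∃ r > 0, ∀ ψ : L2Plane,
      ∃ h : P.toFun (Set.Ioo (E - r) (E + r)) ψ ∈ (hamiltonian B V).domain,
        α / 2 * (⟪ψ, P.toFun (Set.Ioo (E - r) (E + r)) ψ⟫_ℂ).re ≤ -Q ⟨_, h⟩ := by
  -- On the spectral subspace `‖(H - E) ψ‖ ≤ r ‖ψ‖`, so for `r ≤ 1` the error is at most `2 C r
  -- ‖ψ‖²`. The choice of `r` makes this at most `α / 2` times `‖ψ‖²`.
  refine ⟨min 1 (α / (4 * (C + 1))), by positivity, fun ψ => ?_⟩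
  set r := min 1 (α / (4 * (C + 1))) with hr
  have hr0 : 0 < r := by positivity
  have hr1 : r ≤ 1 := min_le_left _ _
  have hrα : r * (4 * (C + 1)) ≤ α := (le_div_iff₀ (by positivity)).1 (min_le_right _ _)
  refine ⟨hP.mem_domain_proj E r ψ, ?_⟩
  rw [P.inner_self measurableSet_Ioo]
  have h1 := hP.norm_sub_le (dense_domain_hamiltonian B hV) hr0
    (ψ := ⟨_, hP.mem_domain_proj E r ψ⟩)
    (by rw [P.apply_apply measurableSet_Ioo measurableSet_Ioo, Set.inter_self])
  have h2 := hQ ⟨_, hP.mem_domain_proj E r ψ⟩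
  simp only at h1 h2
  set n := ‖P.toFun (Set.Ioo (E - r) (E + r)) ψ‖ with hn
  set η := ‖hamiltonian B V ⟨_, hP.mem_domain_proj E r ψ⟩
    - (E : ℂ) • P.toFun (Set.Ioo (E - r) (E + r)) ψ‖ with hη
  have hn0 : 0 ≤ n := norm_nonneg _
  have hη0 : 0 ≤ η := norm_nonneg _
  have h3 : η ^ 2 + η * n ≤ 2 * r * n ^ 2 := by
    have h4 : η ≤ n := h1.trans (mul_le_of_le_one_left hn0 hr1)
    nlinarith
  have h4 : C * (η ^ 2 + η * n) ≤ C * (2 * r * n ^ 2) := mul_le_mul_of_nonneg_left h3 hC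
  have h5 : r * (4 * (C + 1)) * n ^ 2 ≤ α * n ^ 2 := mul_le_mul_of_nonneg_right hrα (by positivity)
  have h6 : 0 ≤ r * n ^ 2 := by positivity
  linarith

end HalfPlaneLandau

end

open HalfPlaneLandau
theorem mainTheorem1 (B : ℝ) (hB : 0 < B) (V₀ : ℝ → ℝ) (hV₀ : IsEdgePotential V₀) (E : ℝ)
    (hE : ∀ n : ℕ, E ≠ (2 * (n : ℝ) + 1) * B) :
    ∃ δ : ℝ, 0 < δ ∧ ∀ Vd : ℝ × ℝ → ℝ, Measurable Vd → (∀ q, |Vd q| ≤ δ) →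
      -- the quadratic form of the commutator `[H, iΠ]` on the domain of `H`
      ∃ Q : (hamiltonian B (totalPotential V₀ Vd)).domain → ℝ,
        IsCommutatorForm (hamiltonian B (totalPotential V₀ Vd)) (guidingCenter B) Q ∧
        -- `[H, iΠ] = -∂_y V` in the sense of distributions
        (∀ (φ : ℝ × ℝ → ℂ) (u : (hamiltonian B (totalPotential V₀ Vd)).domain),
          IsTest φ → (u : L2Plane) =ᵐ[volume] φ →
            Q u = ∫ q, totalPotential V₀ Vd q * fderiv ℝ (fun r => ‖φ r‖ ^ 2) q (0, 1)) ∧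
        -- the Mourre estimate on the interval `Δ = (a, b)`
        ∃ a b α : ℝ, a < E ∧ E < b ∧ 0 < α ∧
          ∀ ψ : L2Plane,
            ∃ h : spectralProjection (hamiltonian B (totalPotential V₀ Vd)) (Set.Ioo a b) ψ ∈
                (hamiltonian B (totalPotential V₀ Vd)).domain,
              α * (⟪ψ, spectralProjection (hamiltonian B (totalPotential V₀ Vd))
                (Set.Ioo a b) ψ⟫_ℂ).re ≤ -Q ⟨_, h⟩ := by
  obtain ⟨δ, hδ, α, hα, C, hC, key⟩ := exists_mourre_test hB hV₀ hE
  refine ⟨δ, hδ, fun Vd hm hVd => ?_⟩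
  have hV : IsPotential (totalPotential V₀ Vd) :=
    isPotential_totalPotential hV₀.smooth.continuous (isPotential_of_bdd hm hVd)
  have h : ∀ q, -δ ≤ totalPotential V₀ Vd q := fun q => by
    have h1 := (abs_le.1 (hVd q)).1
    have h2 := hV₀.nonneg q.2
    rw [totalPotential]
    linarith
  refine ⟨_, isCommutatorForm_commForm hB hV h hδ.le, fun φ u hφ hu => ?_, ?_⟩
  · have hu' : (u : L2Plane) = toL2 ⟨φ, hφ⟩ := Lp.ext (hu.trans (coeFn_toL2 ⟨φ, hφ⟩).symm)
    rw [hamiltonian_apply_toL2 B hV hu', hu', ← shiftedOp_apply, commForm_shiftedOp hB hV h hδ.le]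
    exact im_inner_potOp_kinYOp hV ⟨φ, hφ⟩
  · have hs := exists_spectralMeasure_hamiltonian hB hV h hδ.le
    -- The estimate holds for every spectral measure of `H`, hence for the one selected by choice in
    -- `spectralProjection`; uniqueness plays no role.
    have e : ∀ S, spectralProjection (hamiltonian B (totalPotential V₀ Vd)) S
        = hs.choose.toFun S := fun S => by rw [spectralProjection, dif_pos hs]
    obtain ⟨r, hr, hmourre⟩ := exists_mourre_proj hV hs.choose_spec hα hC
      (mourre_commForm hB hV h hδ.le (key Vd hVd hm hV))
    refine ⟨E - r, E + r, α / 2, by linarith, by linarith, by positivity, ?_⟩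
    simp only [e]
    exact hmourre
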